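/- Let $n\ge 0$. Identify $T^*S^n$ with $\{(p,q)\in\mathbb{R}^{n+1}\oplus\mathbb{R}^{n+1} : |p|=1,\ \langle p,q\rangle=0\}$, with the restriction of $\omega_{std}=\sum_i dp_i\wedge dq_i$, and $T^*\mathbb{R}P^n$ with its quotient by $(p,q)\mapsto(-p,-q)$, with the induced form; let $p_n:T^*S^n\to T^*\mathbb{R}P^n$ be the quotient map, a symplectic double cover. Let $H(p,q)=|q|$ on either space, and let $U_1^*=\{H<1\}$ be the open unit disc bundle. Off the zero section the Hamiltonian flow $\sigma_t$ of $H$ is the normalized cogeodesic flow $\sigma_t(p,q)=(\cos t\,p+\sin t\,q/|q|,\ \cos t\,q-\sin t\,|q|\,p)$; it is a circle action of period $T=2\pi$ on $T^*S^n$ and of period $T=\pi$ on $T^*\mathbb{R}P^n$, free on $\{H=1\}$. The cut $C(S^n)$, resp. $C(\mathbb{R}P^n)$, is the quotient of $\{H\le 1\}$ by the $\sigma$-orbits in $\{H=1\}$. The smooth structure of the symplectic cut on it is the one for which the open piece $\{H<1\}$ is smoothly embedded as an open set, and for which near the image of $\{H=1\}$ the natural map to the cut from $\{(m,w) : H(m)>0,\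 w\in\mathbb{C},\ H(m)+\tfrac{\pi}{T}|w|^2=1\}$, the quotient map for the action $t\cdot(m,w)=(\sigma_t m,e^{-2\pi i t/T}w)$ of $\mathbb{R}/T\mathbb{Z}$, which sends $(m,w)$ with $w\ge0$ to the class of $m$, is a submersion. Let $Q^n=\{\sum_{i=0}^{n+1} z_i^2=0\}\subset\mathbb{C}P^{n+1}$ and $Q^{n-1}=\{\sum_{i=0}^{n} z_i^2=0\}\subset\mathbb{C}P^{n}$. Then: 1. The map $\pi:Q^n\to\mathbb{C}P^n$, $[z_0:\dots:z_{n+1}]\mapsto[z_0:\dots:z_n]$, is a branched double cover, branched along $Q^{n-1}$: it is holomorphic, it is a two-sheeted unramified cover over $\mathbb{C}P^n\setminus Q^{n-1}$, and over each point of $Q^{n-1}$ it has exactly one point, near which it has the form $(u,w)\mapsto(u,w^2)$ in holomorphic coordinates in which $Q^{n-1}=\{w=0\}$. 2. The symplectic cut $C(\mathbb{R}P^n)$ exists as a smooth manifold, and there are a diffeomorphism $\Phi:C(\mathbb{R}P^n)\to\mathbb{C}P^n$ and a homeomorphism $\Psi:C(S^n)\to Q^n$ such that $\Phi$ carries the image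 of $\{H=1\}$ onto $Q^{n-1}$, $\Psi$ restricts to a diffeomorphism of $U_1^*S^n$ onto $Q^n\setminus\pi^{-1}(Q^{n-1})$, and $\pi(\Psi([x]))=\Phi([p_n(x)])$ for all $x$ in the closed disc bundle of $S^n$. In particular, $p_n:U_1^*S^n\to U_1^*\mathbb{R}P^n$ extends to the branched double cover $\pi:Q^n\to\mathbb{C}P^n$. 3. Likewise the symplectic cut $C(S^n)$ exists as a smooth manifold, and there are a diffeomorphism $\Psi:C(S^n)\to Q^n$ and a homeomorphism $\Phi:C(\mathbb{R}P^n)\to\mathbb{C}P^n$ such that $\Phi$ carries the image of $\{H=1\}$ onto $Q^{n-1}$ and restricts to a diffeomorphism of $U_1^*\mathbb{R}P^n$ onto $\mathbb{C}P^n\setminus Q^{n-1}$, and $\pi(\Psi([x]))=\Phi([p_n(x)])$ for all $x$ in the closed disc bundle of $S^n$. -/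

import Mathlib

open scoped Manifold ContDiff Topology LinearAlgebra.Projectivization
open Set Topology

noncomputable section

theorem contDiffOn_insertNth {𝕜 E : Type*} [NontriviallyNormedField 𝕜] [NormedAddCommGroup E]
    [NormedSpace 𝕜 E] {m : ℕ} {F : Type*} [NormedAddCommGroup F] [NormedSpace 𝕜 F]
    (i : Fin (m + 1)) {s : Set E} {f : E → F} {g : E → Fin m → F}
    (hf : ContDiffOn 𝕜 ω f s) (hg : ContDiffOn 𝕜 ω g s) :
    ContDiffOn 𝕜 ω (fun x => (i.insertNth (f x) (g x) : Fin (m + 1) → F)) s := by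
  rw [contDiffOn_pi]
  intro k
  induction k using i.succAboveCases with
  | x => simpa using hf
  | p j => simpa using (contDiffOn_pi.1 hg j)

/-- Complex projective space of complex dimension `n`. -/
abbrev CP (n : ℕ) : Type := ℙ ℂ (Fin (n + 1) → ℂ)

instance CP.instTopologicalSpace (n : ℕ) : TopologicalSpace (CP n) :=
  inferInstanceAs (TopologicalSpace (Quotient (projectivizationSetoid ℂ (Fin (n + 1) → ℂ))))

namespace CP

theorem isQuotientMap_mk' (n : ℕ) :
    IsQuotientMap (Projectivization.mk' ℂ : {v : Fin (n + 1) → ℂ // v ≠ 0} → CP n) :=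
  isQuotientMap_quotient_mk'

theorem rep_mk {n : ℕ} (v : Fin (n + 1) → ℂ) (hv : v ≠ 0) :
    ∃ a : ℂ, a ≠ 0 ∧ (Projectivization.mk ℂ v hv).rep = a • v := by
  obtain ⟨a, ha⟩ := Projectivization.exists_smul_eq_mk_rep ℂ v hv
  exact ⟨a, a.ne_zero, ha.symm⟩

variable {n : ℕ} (l : (Fin (n + 1) → ℂ) →ₗ[ℂ] ℂ)

theorem ne_zero_mk_iff (v : Fin (n + 1) → ℂ) (hv : v ≠ 0) :
    l (Projectivization.mk ℂ v hv).rep ≠ 0 ↔ l v ≠ 0 := by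
  obtain ⟨a, ha, h⟩ := rep_mk v hv
  simp [h, ha]

theorem div_mk (v : Fin (n + 1) → ℂ) (hv : v ≠ 0) (k : Fin (n + 1)) :
    (Projectivization.mk ℂ v hv).rep k / l (Projectivization.mk ℂ v hv).rep = v k / l v := by
  obtain ⟨a, ha, h⟩ := rep_mk v hv
  simp [h, mul_div_mul_left _ _ ha]

theorem isOpen_ne_zero : IsOpen {z : CP n | l z.rep ≠ 0} := by
  rw [← (isQuotientMap_mk' n).isOpen_preimage]
  have : (Projectivization.mk' ℂ ⁻¹' {z : CP n | l z.rep ≠ 0}) =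
      {v : {v : Fin (n + 1) → ℂ // v ≠ 0} | l v ≠ 0} := by
    ext v
    simp only [mem_preimage, mem_ofPred_eq, Projectivization.mk'_eq_mk]
    exact ne_zero_mk_iff l v.1 v.2
  rw [this]
  exact isOpen_ne_fun (l.continuous_of_finiteDimensional.comp continuous_subtype_val)
    continuous_const

theorem continuousOn_div (k : Fin (n + 1)) :
    ContinuousOn (fun z : CP n => z.rep k / l z.rep) {z : CP n | l z.rep ≠ 0} := by
  rw [(isQuotientMap_mk' n).continuousOn_isOpen_iff (isOpen_ne_zero l)]
  have h : ContinuousOn (fun v : {v : Fin (n + 1) → ℂ // v ≠ 0} => v.1 k / l v.1)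
      (Projectivization.mk' ℂ ⁻¹' {z : CP n | l z.rep ≠ 0}) := by
    refine ContinuousOn.div ((continuous_apply k).comp continuous_subtype_val).continuousOn
      (l.continuous_of_finiteDimensional.comp continuous_subtype_val).continuousOn ?_
    intro v hv
    exact (ne_zero_mk_iff l v.1 v.2).1 hv
  refine h.congr fun v _ => ?_
  exact div_mk l v.1 v.2 k

theorem continuous_mk {X : Type*} [TopologicalSpace X] (f : X → Fin (n + 1) → ℂ)
    (hf : Continuous f) (h : ∀ x, f x ≠ 0) :
    Continuous fun x => (Projectivization.mk ℂ (f x) (h x) : CP n) :=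
  (isQuotientMap_mk' n).continuous.comp (hf.subtype_mk h)

theorem insertNth_one_ne_zero (i : Fin (n + 1)) (u : Fin n → ℂ) :
    (i.insertNth (1 : ℂ) u : Fin (n + 1) → ℂ) ≠ 0 := fun h => by
  simpa using congrFun h i

/-- The affine chart `[z] ↦ (z_j / z_i)_{j ≠ i}` on `{z_i ≠ 0}`. -/
def chart (i : Fin (n + 1)) : OpenPartialHomeomorph (CP n) (Fin n → ℂ) where
  toFun z := fun j => z.rep (i.succAbove j) / z.rep i
  invFun u := Projectivization.mk ℂ (i.insertNth (1 : ℂ) u : Fin (n + 1) → ℂ)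
    (insertNth_one_ne_zero i u)
  source := {z | z.rep i ≠ 0}
  target := univ
  map_source' _ _ := mem_univ _
  map_target' u _ :=
    (ne_zero_mk_iff (LinearMap.proj i) _ (insertNth_one_ne_zero i u)).2 (by simp)
  left_inv' z hz := by
    conv_rhs => rw [← z.mk_rep]
    rw [Projectivization.mk_eq_mk_iff']
    refine ⟨(z.rep i)⁻¹, ?_⟩
    ext k
    have hz' : z.rep i ≠ 0 := hz
    induction k using i.succAboveCases with
    | x => simp [hz']
    | p j => simp [div_eq_inv_mul]
  right_inv' u _ := by
    ext j
    have := div_mk (LinearMap.proj i) _ (insertNth_one_ne_zero i u) (i.succAbove j)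
    simpa using this
  open_source := isOpen_ne_zero (LinearMap.proj i)
  open_target := isOpen_univ
  continuousOn_toFun := continuousOn_pi.2 fun j =>
    continuousOn_div (LinearMap.proj i) (i.succAbove j)
  continuousOn_invFun := (continuous_mk _ (by fun_prop) _).continuousOn

theorem exists_rep_ne_zero (z : CP n) : ∃ i, z.rep i ≠ 0 := by
  by_contra! h
  exact z.rep_nonzero (funext h)

instance instChartedSpace (n : ℕ) : ChartedSpace (Fin n → ℂ) (CP n) where
  atlas := range chart
  chartAt z := chart (exists_rep_ne_zero z).choose
  mem_chart_source z := (exists_rep_ne_zero z).choose_spec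
  chart_mem_atlas _ := mem_range_self _

theorem contDiffOn_transition (i k : Fin (n + 1)) :
    ContDiffOn ℂ ω ((chart i).symm ≫ₕ chart k) ((chart i).symm ≫ₕ chart k).source := by
  have h1 : ∀ m, ContDiffOn ℂ ω
      (fun u : Fin n → ℂ => (i.insertNth (1 : ℂ) u : Fin (n + 1) → ℂ) m)
      ((chart i).symm ≫ₕ chart k).source :=
    contDiffOn_pi.1 (contDiffOn_insertNth i contDiffOn_const contDiffOn_id)
  rw [contDiffOn_pi]
  intro j
  refine ((h1 (k.succAbove j)).div (h1 k) ?_).congr ?_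
  · intro u hu
    exact (ne_zero_mk_iff (LinearMap.proj k) _ (insertNth_one_ne_zero i u)).1 hu.2
  · intro u _
    exact div_mk (LinearMap.proj k) _ (insertNth_one_ne_zero i u) (k.succAbove j)

/-- `CP n` is a complex manifold. -/
instance instIsManifoldComplex (n : ℕ) : IsManifold 𝓘(ℂ, Fin n → ℂ) ω (CP n) := by
  refine isManifold_of_contDiffOn _ _ _ ?_
  rintro _ _ ⟨i, rfl⟩ ⟨k, rfl⟩
  simpa using contDiffOn_transition i k

/-- `CP n` is a smooth real manifold, with the same charts. -/
instance instIsManifoldReal (n : ℕ) : IsManifold 𝓘(ℝ, Fin n → ℂ) ∞ (CP n) := by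
  refine isManifold_of_contDiffOn _ _ _ ?_
  rintro _ _ ⟨i, rfl⟩ ⟨k, rfl⟩
  simpa using ((contDiffOn_transition i k).restrict_scalars ℝ).of_le le_top

end CP

/-- The quadric `{[z] | ∑ z_i ^ 2 = 0}` in `CP N`, of complex dimension `N - 1`. -/
def quadric (N : ℕ) : Set (CP N) := {z | ∑ i, z.rep i ^ 2 = 0}

/-- The `n`-dimensional quadric in `CP (n + 1)`. -/
abbrev Q (n : ℕ) : Type := quadric (n + 1)

namespace Q

variable {n : ℕ}

theorem mk_mem_quadric {N : ℕ} (v : Fin (N + 1) → ℂ) (hv : v ≠ 0) :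
    (Projectivization.mk ℂ v hv : CP N) ∈ quadric N ↔ ∑ i, v i ^ 2 = 0 := by
  obtain ⟨a, ha, h⟩ := CP.rep_mk v hv
  simp [quadric, h, mul_pow, ← Finset.mul_sum, ha]

/-- The linear form `z_a + i z_b`, where `b` is the `b`-th index different from `a`. -/
def form (a : Fin (n + 2)) (b : Fin (n + 1)) : (Fin (n + 2) → ℂ) →ₗ[ℂ] ℂ :=
  LinearMap.proj a + Complex.I • LinearMap.proj (a.succAbove b)

theorem form_apply (a : Fin (n + 2)) (b : Fin (n + 1)) (z : Fin (n + 2) → ℂ) :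
    form a b z = z a + Complex.I * z (a.succAbove b) := rfl

/-- The point of the affine quadric cone with `z_a + i z_b = 1` and other coordinates `u`. -/
def point (a : Fin (n + 2)) (b : Fin (n + 1)) (u : Fin n → ℂ) : Fin (n + 2) → ℂ :=
  a.insertNth ((1 - ∑ j, u j ^ 2) / 2)
    (b.insertNth (-Complex.I * (1 + ∑ j, u j ^ 2) / 2) u : Fin (n + 1) → ℂ)

theorem form_point (a : Fin (n + 2)) (b : Fin (n + 1)) (u : Fin n → ℂ) :
    form a b (point a b u) = 1 := by
  simp only [form_apply, point, Fin.insertNth_apply_same, Fin.insertNth_apply_succAbove]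
  linear_combination (-(1 + ∑ j, u j ^ 2) / 2) * Complex.I_sq

theorem point_ne_zero (a : Fin (n + 2)) (b : Fin (n + 1)) (u : Fin n → ℂ) :
    point a b u ≠ 0 := fun h => by
  simpa [h] using form_point a b u

theorem sum_split (a : Fin (n + 2)) (b : Fin (n + 1)) (z : Fin (n + 2) → ℂ) :
    ∑ i, z i ^ 2 = z a ^ 2 + (z (a.succAbove b) ^ 2 +
      ∑ j, z (a.succAbove (b.succAbove j)) ^ 2) := by
  rw [Fin.sum_univ_succAbove _ a, Fin.sum_univ_succAbove _ b]

theorem point_mem (a : Fin (n + 2)) (b : Fin (n + 1)) (u : Fin n → ℂ) :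
    (Projectivization.mk ℂ (point a b u) (point_ne_zero a b u) : CP (n + 1)) ∈
      quadric (n + 1) := by
  rw [mk_mem_quadric, sum_split a b]
  simp only [point, Fin.insertNth_apply_same, Fin.insertNth_apply_succAbove]
  linear_combination ((1 + ∑ j, u j ^ 2) ^ 2 / 4) * Complex.I_sq

theorem continuous_point (a : Fin (n + 2)) (b : Fin (n + 1)) :
    Continuous (point a b : (Fin n → ℂ) → _) := by
  unfold point
  fun_prop

/-- The chart `[z] ↦ (z_j / (z_a + i z_b))_{j ≠ a, b}` of the quadric on `{z_a + i z_b ≠ 0}`: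
there the equation reads `(z_a + i z_b) (z_a - i z_b) = - ∑_{j ≠ a, b} z_j ^ 2`, so the
remaining coordinates are free. -/
def chart (a : Fin (n + 2)) (b : Fin (n + 1)) : OpenPartialHomeomorph (Q n) (Fin n → ℂ) where
  toFun z := fun j => z.1.rep (a.succAbove (b.succAbove j)) / form a b z.1.rep
  invFun u := ⟨Projectivization.mk ℂ (point a b u) (point_ne_zero a b u), point_mem a b u⟩
  source := {z | form a b z.1.rep ≠ 0}
  target := univ
  map_source' _ _ := mem_univ _
  map_target' u _ :=
    (CP.ne_zero_mk_iff (form a b) _ (point_ne_zero a b u)).2 (by simp [form_point])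
  left_inv' z hz := by
    have hz' : form a b z.1.rep ≠ 0 := hz
    have hq : ∑ i, z.1.rep i ^ 2 = 0 := z.2
    rw [sum_split a b] at hq
    apply Subtype.ext
    conv_rhs => rw [← z.1.mk_rep]
    rw [Projectivization.mk_eq_mk_iff']
    refine ⟨(form a b z.1.rep)⁻¹, ?_⟩
    have hs : ∑ j, (z.1.rep (a.succAbove (b.succAbove j)) / form a b z.1.rep) ^ 2 =
        -(z.1.rep a - Complex.I * z.1.rep (a.succAbove b)) / form a b z.1.rep := by
      simp only [div_pow, ← Finset.sum_div]
      rw [div_eq_div_iff (pow_ne_zero 2 hz') hz']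
      rw [form_apply]
      linear_combination (z.1.rep a + Complex.I * z.1.rep (a.succAbove b)) *
        (hq - (z.1.rep (a.succAbove b)) ^ 2 * Complex.I_sq)
    ext k
    unfold point
    rw [hs]
    induction k using a.succAboveCases with
    | x =>
      simp only [Fin.insertNth_apply_same, Pi.smul_apply, smul_eq_mul]
      field_simp
      rw [form_apply]; ring
    | p k =>
      induction k using b.succAboveCases with
      | x =>
        simp only [Fin.insertNth_apply_same, Fin.insertNth_apply_succAbove, Pi.smul_apply,
          smul_eq_mul]
        field_simp
        rw [form_apply]
        linear_combination (2 * z.1.rep (a.succAbove b)) * Complex.I_sq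
      | p j => simp [div_eq_inv_mul]
  right_inv' u _ := by
    ext j
    have := CP.div_mk (form a b) _ (point_ne_zero a b u) (a.succAbove (b.succAbove j))
    rw [form_point] at this
    simpa [point] using this
  open_source := (CP.isOpen_ne_zero (form a b)).preimage continuous_subtype_val
  open_target := isOpen_univ
  continuousOn_toFun := continuousOn_pi.2 fun j =>
    (CP.continuousOn_div (form a b) (a.succAbove (b.succAbove j))).comp
      continuous_subtype_val.continuousOn fun _ h => h
  continuousOn_invFun :=
    ((CP.continuous_mk _ (continuous_point a b) _).subtype_mk _).continuousOn

theorem exists_form_ne_zero (z : Q n) :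
    ∃ ab : Fin (n + 2) × Fin (n + 1), form ab.1 ab.2 z.1.rep ≠ 0 := by
  by_contra! h
  refine z.1.rep_nonzero (funext fun k => ?_)
  have key : ∀ a c : Fin (n + 2), c ≠ a → z.1.rep a + Complex.I * z.1.rep c = 0 := by
    intro a c hc
    obtain ⟨b, rfl⟩ := Fin.exists_succAbove_eq hc
    exact h (a, b)
  obtain ⟨c, hc⟩ := exists_ne k
  have h1 := key k c hc
  have h2 := key c k hc.symm
  simp only [Pi.zero_apply]
  linear_combination (1 / 2 : ℂ) * h1 - (Complex.I / 2) * h2 +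
    (z.1.rep k / 2) * Complex.I_sq

instance instChartedSpace (n : ℕ) : ChartedSpace (Fin n → ℂ) (Q n) where
  atlas := range fun ab : Fin (n + 2) × Fin (n + 1) => chart ab.1 ab.2
  chartAt z := chart (exists_form_ne_zero z).choose.1 (exists_form_ne_zero z).choose.2
  mem_chart_source z := (exists_form_ne_zero z).choose_spec
  chart_mem_atlas _ := mem_range_self _

theorem contDiffOn_transition (a c : Fin (n + 2)) (b d : Fin (n + 1)) :
    ContDiffOn ℂ ω ((chart a b).symm ≫ₕ chart c d) ((chart a b).symm ≫ₕ chart c d).source := by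
  have hs : ContDiff ℂ ω fun u : Fin n → ℂ => ∑ j, u j ^ 2 := by fun_prop
  have h1 : ∀ m, ContDiffOn ℂ ω (fun u : Fin n → ℂ => point a b u m)
      ((chart a b).symm ≫ₕ chart c d).source :=
    contDiffOn_pi.1 (contDiffOn_insertNth a (by fun_prop)
      (contDiffOn_insertNth b (by fun_prop) contDiffOn_id))
  rw [contDiffOn_pi]
  intro j
  refine ((h1 (c.succAbove (d.succAbove j))).div
    ((h1 c).add (contDiffOn_const.mul (h1 (c.succAbove d)))) (g := fun u => form c d (point a b u)) ?_).congr ?_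
  · intro u hu
    exact (CP.ne_zero_mk_iff (form c d) _ (point_ne_zero a b u)).1 hu.2
  · intro u _
    exact CP.div_mk (form c d) _ (point_ne_zero a b u) (c.succAbove (d.succAbove j))

/-- The quadric is a complex manifold. -/
instance instIsManifoldComplex (n : ℕ) : IsManifold 𝓘(ℂ, Fin n → ℂ) ω (Q n) := by
  refine isManifold_of_contDiffOn _ _ _ ?_
  rintro _ _ ⟨i, rfl⟩ ⟨k, rfl⟩
  simpa using contDiffOn_transition i.1 k.1 i.2 k.2

/-- The quadric is a smooth real manifold, with the same charts. -/
instance instIsManifoldReal (n : ℕ) : IsManifold 𝓘(ℝ, Fin n → ℂ) ∞ (Q n) := by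
  refine isManifold_of_contDiffOn _ _ _ ?_
  rintro _ _ ⟨i, rfl⟩ ⟨k, rfl⟩
  simpa using ((contDiffOn_transition i.1 k.1 i.2 k.2).restrict_scalars ℝ).of_le le_top

theorem init_ne_zero (z : Q n) : (fun i : Fin (n + 1) => z.1.rep i.castSucc) ≠ 0 := by
  intro h
  have h0 : ∀ i : Fin (n + 1), z.1.rep i.castSucc = 0 := fun i => congrFun h i
  have hq : ∑ i, z.1.rep i ^ 2 = 0 := z.2
  rw [Fin.sum_univ_castSucc] at hq
  simp only [h0] at hq
  refine z.1.rep_nonzero (funext fun k => ?_)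
  induction k using Fin.lastCases with
  | last => simpa using hq
  | cast i => exact h0 i

/-- The projection `[z_0 : ... : z_n : z_{n+1}] ↦ [z_0 : ... : z_n]`, restricted to the quadric. -/
def proj (n : ℕ) (z : Q n) : CP n :=
  Projectivization.mk ℂ (fun i : Fin (n + 1) => z.1.rep i.castSucc) (init_ne_zero z)

end Q

/-- The cotangent bundle of the unit sphere `S^n`, identified with
`{(p, q) | |p| = 1, ⟨p, q⟩ = 0}` in `ℝ^{n+1} ⊕ ℝ^{n+1}`. -/
def cotangentSphere (n : ℕ) : Set ((Fin (n + 1) → ℝ) × (Fin (n + 1) → ℝ)) :=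
  {x | x.1 ⬝ᵥ x.1 = 1 ∧ x.1 ⬝ᵥ x.2 = 0}

/-- `T^*S^n` as a space. -/
abbrev TS (n : ℕ) : Type := cotangentSphere n

/-- The model space of `T^*S^n` and `T^*RP^n`. -/
abbrev TModel (n : ℕ) : Type := (Fin n → ℝ) × (Fin n → ℝ)

namespace TS

variable {n : ℕ}

theorem dot_insertNth (i : Fin (n + 1)) (a b : ℝ) (x y : Fin n → ℝ) :
    (i.insertNth a x : Fin (n + 1) → ℝ) ⬝ᵥ (i.insertNth b y : Fin (n + 1) → ℝ) =
      a * b + x ⬝ᵥ y := by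
  simp [dotProduct, Fin.sum_univ_succAbove _ i]

theorem dot_succAbove (i : Fin (n + 1)) (x y : Fin (n + 1) → ℝ) :
    x ⬝ᵥ y = x i * y i + (fun j => x (i.succAbove j)) ⬝ᵥ (fun j => y (i.succAbove j)) := by
  simp [dotProduct, Fin.sum_univ_succAbove _ i]

/-- The point of `ℝ^{n+1} ⊕ ℝ^{n+1}` with coordinates `(y.1, y.2)` off the index `i`, and with
`p_i` of sign `ε`, that lies on `T^*S^n`. -/
def point (i : Fin (n + 1)) (ε : ℝ) (y : TModel n) : (Fin (n + 1) → ℝ) × (Fin (n + 1) → ℝ) :=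
  (i.insertNth (ε * √(1 - y.1 ⬝ᵥ y.1)) y.1,
    i.insertNth (-(y.1 ⬝ᵥ y.2) / (ε * √(1 - y.1 ⬝ᵥ y.1))) y.2)

theorem point_mem (i : Fin (n + 1)) {ε : ℝ} (hε : ε * ε = 1) {y : TModel n}
    (hy : y.1 ⬝ᵥ y.1 < 1) : point i ε y ∈ cotangentSphere n := by
  have h0 : 0 < 1 - y.1 ⬝ᵥ y.1 := by linarith
  have hs := Real.mul_self_sqrt h0.le
  have hne : ε * √(1 - y.1 ⬝ᵥ y.1) ≠ 0 :=
    mul_ne_zero (fun h => by simp [h] at hε) (Real.sqrt_pos.2 h0).ne'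
  constructor
  · simp only [point, dot_insertNth]
    linear_combination (√(1 - y.1 ⬝ᵥ y.1) * √(1 - y.1 ⬝ᵥ y.1)) * hε + hs
  · simp only [point, dot_insertNth]
    rw [mul_div_cancel₀ _ hne]
    ring

open Classical in
/-- The inverse of the chart below (with a junk value off the unit ball). -/
def lift (i : Fin (n + 1)) {ε : ℝ} (hε : ε * ε = 1) (y : TModel n) : TS n :=
  if hy : y.1 ⬝ᵥ y.1 < 1 then ⟨point i ε y, point_mem i hε hy⟩
  else ⟨(Pi.single i 1, 0), by simp [cotangentSphere]⟩

theorem lift_val (i : Fin (n + 1)) {ε : ℝ} (hε : ε * ε = 1) {y : TModel n}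
    (hy : y.1 ⬝ᵥ y.1 < 1) : (lift i hε y).1 = point i ε y := by
  simp [lift, hy]

theorem isOpen_ball (n : ℕ) : IsOpen {y : TModel n | y.1 ⬝ᵥ y.1 < 1} :=
  isOpen_lt (by unfold dotProduct; fun_prop) continuous_const

theorem contDiffOn_point (i : Fin (n + 1)) {ε : ℝ} (hε : ε * ε = 1) :
    ContDiffOn ℝ ω (point i ε) {y : TModel n | y.1 ⬝ᵥ y.1 < 1} := by
  have hd : ContDiff ℝ ω fun y : TModel n => y.1 ⬝ᵥ y.1 := by unfold dotProduct; fun_prop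
  have hd' : ContDiff ℝ ω fun y : TModel n => y.1 ⬝ᵥ y.2 := by unfold dotProduct; fun_prop
  have hr : ContDiffOn ℝ ω (fun y : TModel n => ε * √(1 - y.1 ⬝ᵥ y.1))
      {y : TModel n | y.1 ⬝ᵥ y.1 < 1} := by
    refine contDiffOn_const.mul (ContDiffOn.sqrt (by fun_prop) ?_)
    intro y hy
    have : y.1 ⬝ᵥ y.1 < 1 := hy
    linarith
  refine (contDiffOn_insertNth i hr contDiff_fst.contDiffOn).prodMk
    (contDiffOn_insertNth i (ContDiffOn.div hd'.neg.contDiffOn hr ?_) contDiff_snd.contDiffOn)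
  intro y hy
  have h : y.1 ⬝ᵥ y.1 < 1 := hy
  exact mul_ne_zero (fun h => by simp [h] at hε) (Real.sqrt_pos.2 (by linarith)).ne'

theorem continuousOn_lift (i : Fin (n + 1)) {ε : ℝ} (hε : ε * ε = 1) :
    ContinuousOn (lift i hε) {y : TModel n | y.1 ⬝ᵥ y.1 < 1} := by
  rw [continuousOn_iff_continuous_domRestrict]
  refine continuous_induced_rng.2 ?_
  have := (contDiffOn_point i hε).continuousOn
  rw [continuousOn_iff_continuous_domRestrict] at this
  refine this.congr fun y => ?_
  exact (lift_val i hε y.2).symm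

/-- Deleting the `i`-th entries. -/
def delete (i : Fin (n + 1)) (x : (Fin (n + 1) → ℝ) × (Fin (n + 1) → ℝ)) : TModel n :=
  (fun j => x.1 (i.succAbove j), fun j => x.2 (i.succAbove j))

theorem delete_point (i : Fin (n + 1)) (ε : ℝ) (y : TModel n) : delete i (point i ε y) = y := by
  ext <;> simp [delete, point]

theorem delete_mem (i : Fin (n + 1)) (x : TS n) (hx : x.1.1 i ≠ 0) :
    (delete i x.1).1 ⬝ᵥ (delete i x.1).1 < 1 := by
  have h := x.2.1
  rw [dot_succAbove i] at h
  have : 0 < x.1.1 i * x.1.1 i := mul_self_pos.2 hx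
  simp only [delete]
  linarith

theorem point_delete (i : Fin (n + 1)) {ε : ℝ} (hε : ε * ε = 1) (x : TS n)
    (hx : 0 < ε * x.1.1 i) : point i ε (delete i x.1) = x.1 := by
  have h1 := x.2.1
  have h2 := x.2.2
  rw [dot_succAbove i] at h1 h2
  have hs : ε * √(1 - (delete i x.1).1 ⬝ᵥ (delete i x.1).1) = x.1.1 i := by
    have : 1 - (delete i x.1).1 ⬝ᵥ (delete i x.1).1 = (ε * x.1.1 i) ^ 2 := by
      simp only [delete]
      linear_combination -h1 - (x.1.1 i * x.1.1 i) * hε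
    rw [this, Real.sqrt_sq hx.le]
    linear_combination (x.1.1 i) * hε
  have hne : x.1.1 i ≠ 0 := fun h => by simp [h] at hx
  have hq : -((delete i x.1).1 ⬝ᵥ (delete i x.1).2) / x.1.1 i = x.1.2 i := by
    rw [div_eq_iff hne]
    simp only [delete]
    linear_combination -h2
  unfold point
  rw [hs, hq]
  ext k
  all_goals
    induction k using i.succAboveCases with
    | x => simp
    | p j => simp [delete]

/-- The chart of `T^*S^n` over the open hemisphere `{ε p_i > 0}`, `ε = ±1`, which forgets the
`i`-th entries of `p` and `q`. -/
def chart (i : Fin (n + 1)) {ε : ℝ} (hε : ε * ε = 1) :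
    OpenPartialHomeomorph (TS n) (TModel n) where
  toFun x := delete i x.1
  invFun := lift i hε
  source := {x | 0 < ε * x.1.1 i}
  target := {y | y.1 ⬝ᵥ y.1 < 1}
  map_source' x hx := delete_mem i x fun h => by simp [h] at hx
  map_target' y hy := by
    have h : y.1 ⬝ᵥ y.1 < 1 := hy
    have h2 : 0 < √(1 - y.1 ⬝ᵥ y.1) := Real.sqrt_pos.2 (by linarith)
    simp only [mem_ofPred_eq, lift_val i hε h, point, Fin.insertNth_apply_same]
    rw [← mul_assoc, hε, one_mul]
    exact h2
  left_inv' x hx := by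
    have h : (delete i x.1).1 ⬝ᵥ (delete i x.1).1 < 1 :=
      delete_mem i x fun h => by simp [h] at hx
    exact Subtype.ext ((lift_val i hε h).trans (point_delete i hε x hx))
  right_inv' y hy := by
    rw [lift_val i hε hy, delete_point]
  open_source := isOpen_lt continuous_const
    (continuous_const.mul ((continuous_apply i).comp (continuous_fst.comp continuous_subtype_val)))
  open_target := isOpen_ball n
  continuousOn_toFun := by
    refine Continuous.continuousOn ?_
    unfold delete
    fun_prop
  continuousOn_invFun := continuousOn_lift i hε

theorem exists_ne_zero (x : TS n) : ∃ i, x.1.1 i ≠ 0 := by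
  by_contra! h
  have h1 := x.2.1
  simp [dotProduct, h] at h1

theorem exists_chart (x : TS n) :
    ∃ e : OpenPartialHomeomorph (TS n) (TModel n),
      (∃ (i : Fin (n + 1)) (ε : ℝ) (hε : ε * ε = 1), chart i hε = e) ∧ x ∈ e.source := by
  obtain ⟨i, hi⟩ := exists_ne_zero x
  rcases lt_or_gt_of_ne hi with h | h
  · exact ⟨_, ⟨i, -1, by norm_num, rfl⟩, by simpa [chart] using h⟩
  · exact ⟨_, ⟨i, 1, by norm_num, rfl⟩, by simpa [chart] using h⟩

instance instChartedSpace (n : ℕ) : ChartedSpace (TModel n) (TS n) where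
  atlas := {e | ∃ (i : Fin (n + 1)) (ε : ℝ) (hε : ε * ε = 1), chart i hε = e}
  chartAt x := (exists_chart x).choose
  mem_chart_source x := (exists_chart x).choose_spec.2
  chart_mem_atlas x := (exists_chart x).choose_spec.1

theorem contDiff_delete (i : Fin (n + 1)) : ContDiff ℝ ω (delete i) := by
  unfold delete
  fun_prop

/-- `T^*S^n` is a smooth manifold. -/
instance instIsManifold (n : ℕ) : IsManifold 𝓘(ℝ, TModel n) ∞ (TS n) := by
  refine isManifold_of_contDiffOn _ _ _ ?_
  rintro _ _ ⟨i, ε, hε, rfl⟩ ⟨k, ε', hε', rfl⟩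
  have h : ContDiffOn ℝ ω ((chart i hε).symm ≫ₕ chart k hε')
      ((chart i hε).symm ≫ₕ chart k hε').source := by
    refine ((contDiff_delete k).comp_contDiffOn
      ((contDiffOn_point i hε).mono fun y hy => hy.1)).congr fun y hy => ?_
    change delete k (lift i hε y).1 = _
    rw [lift_val i hε hy.1]
    rfl
  simpa using h.of_le le_top

/-- The antipodal map `(p, q) ↦ (-p, -q)`. -/
def antipode (x : TS n) : TS n := ⟨-x.1, by simpa [cotangentSphere] using x.2⟩

theorem antipode_antipode (x : TS n) : antipode (antipode x) = x :=
  Subtype.ext (neg_neg _)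

theorem continuous_antipode : Continuous (antipode : TS n → TS n) :=
  (continuous_subtype_val.neg).subtype_mk _

/-- The antipodal equivalence relation. -/
instance setoid (n : ℕ) : Setoid (TS n) where
  r x y := y = x ∨ y = antipode x
  iseqv :=
    { refl := fun _ => Or.inl rfl
      symm := by
        rintro x y (rfl | rfl)
        · exact Or.inl rfl
        · exact Or.inr (antipode_antipode x).symm
      trans := by
        rintro x y z (rfl | rfl) (rfl | rfl)
        · exact Or.inl rfl
        · exact Or.inr rfl
        · exact Or.inr rfl
        · exact Or.inl (antipode_antipode x) }

/-- The Hamiltonian `H(p, q) = |q|`. -/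
def energy (x : TS n) : ℝ := √(x.1.2 ⬝ᵥ x.1.2)

theorem energy_antipode (x : TS n) : energy (antipode x) = energy x := by
  simp [energy, antipode]

theorem energy_sq (x : TS n) : energy x ^ 2 = x.1.2 ⬝ᵥ x.1.2 :=
  Real.sq_sqrt (Finset.sum_nonneg fun _ _ => mul_self_nonneg _)

open Classical in
/-- The normalized (co)geodesic flow
`(p, q) ↦ (cos t p + sin t q/|q|, cos t q - sin t |q| p)`, off the zero section. -/
def flow (t : ℝ) (x : TS n) : TS n :=
  if h : energy x = 0 then x else
    ⟨(Real.cos t • x.1.1 + (Real.sin t / energy x) • x.1.2,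
      Real.cos t • x.1.2 - (Real.sin t * energy x) • x.1.1), by
      have h1 := x.2.1
      have h2 := x.2.2
      have h3 : x.1.2 ⬝ᵥ x.1.1 = 0 := by rw [dotProduct_comm]; exact h2
      have h4 := (energy_sq x).symm
      have h5 := Real.sin_sq_add_cos_sq t
      constructor
      · simp only [add_dotProduct, dotProduct_add, smul_dotProduct, dotProduct_smul, h1, h2, h3,
          h4, smul_eq_mul]
        field_simp
        linear_combination (energy x) * h5
      · simp only [add_dotProduct, dotProduct_sub, smul_dotProduct, dotProduct_smul, h1, h2, h3,
          h4, smul_eq_mul]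
        field_simp
        ring⟩

theorem flow_antipode (t : ℝ) (x : TS n) : flow t (antipode x) = antipode (flow t x) := by
  unfold flow
  by_cases h : energy x = 0
  · simp [energy_antipode, h]
  · rw [dif_neg h, dif_neg (by rwa [energy_antipode])]
    apply Subtype.ext
    change (_, _) = (-(_, _) : (Fin (n + 1) → ℝ) × (Fin (n + 1) → ℝ))
    rw [energy_antipode]
    ext k <;> simp [antipode] <;> ring

/-- The restriction to `T^*S^n` of the form `∑ dp_i ∧ dq_i` of `ℝ^{n+1} ⊕ ℝ^{n+1}`. -/
def form (x : TS n) (u v : TangentSpace 𝓘(ℝ, TModel n) x) : ℝ :=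
  let d := mfderiv 𝓘(ℝ, TModel n) 𝓘(ℝ, (Fin (n + 1) → ℝ) × (Fin (n + 1) → ℝ))
    (Subtype.val : TS n → _) x
  (d u).1 ⬝ᵥ (d v).2 - (d u).2 ⬝ᵥ (d v).1

end TS

/-- `T^*RP^n`, the quotient of `T^*S^n` by `(p, q) ↦ (-p, -q)`. -/
def TRP (n : ℕ) : Type := Quotient (TS.setoid n)

instance TRP.instTopologicalSpace (n : ℕ) : TopologicalSpace (TRP n) :=
  inferInstanceAs (TopologicalSpace (Quotient (TS.setoid n)))

namespace TRP

variable {n : ℕ}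

/-- The double cover `T^*S^n → T^*RP^n`. -/
def cover (n : ℕ) : TS n → TRP n := Quotient.mk (TS.setoid n)

theorem isQuotientMap_cover (n : ℕ) : IsQuotientMap (cover n) := isQuotientMap_quotient_mk'

theorem cover_surjective (n : ℕ) : Function.Surjective (cover n) := Quotient.mk_surjective

theorem cover_antipode (x : TS n) : cover n (TS.antipode x) = cover n x :=
  Quotient.sound (Or.inr (TS.antipode_antipode x).symm)

/-- Descent of a function invariant under the antipodal map. -/
def descend {α : Type*} (f : TS n → α) (hf : ∀ x, f (TS.antipode x) = f x) : TRP n → α :=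
  Quotient.lift f (by rintro x y (rfl | rfl); exacts [rfl, (hf x).symm])

/-- The coordinates of the chart below, on `T^*S^n`. -/
def signedDelete (i : Fin (n + 1)) (x : TS n) : TModel n :=
  (x.1.1 i / |x.1.1 i|) • TS.delete i x.1

theorem signedDelete_antipode (i : Fin (n + 1)) (x : TS n) :
    signedDelete i (TS.antipode x) = signedDelete i x := by
  ext <;> simp [signedDelete, TS.antipode, TS.delete, neg_div]

/-- The domain of the chart below. -/
def chartSource (i : Fin (n + 1)) : Set (TRP n) := cover n '' {x | x.1.1 i ≠ 0}

theorem cover_mem_chartSource (i : Fin (n + 1)) (x : TS n) :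
    cover n x ∈ chartSource i ↔ x.1.1 i ≠ 0 := by
  constructor
  · rintro ⟨y, hy, hxy⟩
    rcases (Quotient.exact hxy : x = y ∨ x = TS.antipode y) with rfl | rfl
    · exact hy
    · simpa [TS.antipode] using hy
  · exact fun h => ⟨x, h, rfl⟩

theorem isOpen_chartSource (i : Fin (n + 1)) : IsOpen (chartSource i : Set (TRP n)) := by
  rw [← (isQuotientMap_cover n).isOpen_preimage]
  have : cover n ⁻¹' chartSource i = {x : TS n | x.1.1 i ≠ 0} := by
    ext x
    exact cover_mem_chartSource i x
  rw [this]
  exact isOpen_ne_fun ((continuous_apply i).comp (continuous_fst.comp continuous_subtype_val))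
    continuous_const

theorem exists_rep (i : Fin (n + 1)) {y : TRP n} (hy : y ∈ chartSource i) :
    ∃ x : TS n, 0 < x.1.1 i ∧ cover n x = y := by
  obtain ⟨x, hx, rfl⟩ := hy
  rcases lt_or_gt_of_ne hx with h | h
  · exact ⟨TS.antipode x, by simpa [TS.antipode] using h, cover_antipode x⟩
  · exact ⟨x, h, rfl⟩

theorem signedDelete_of_pos (i : Fin (n + 1)) (x : TS n) (hx : 0 < x.1.1 i) :
    signedDelete i x = TS.delete i x.1 := by
  simp [signedDelete, abs_of_pos hx, div_self hx.ne']

theorem continuousOn_signedDelete (i : Fin (n + 1)) :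
    ContinuousOn (signedDelete i : TS n → _) {x | x.1.1 i ≠ 0} := by
  have h : Continuous fun x : TS n => x.1.1 i :=
    (continuous_apply i).comp (continuous_fst.comp continuous_subtype_val)
  refine ContinuousOn.smul (h.continuousOn.div h.abs.continuousOn fun x hx => ?_)
    ((TS.contDiff_delete i).continuous.comp continuous_subtype_val).continuousOn
  exact abs_ne_zero.2 hx

/-- The chart of `T^*RP^n` on `{p_i ≠ 0}`: take the representative with `p_i > 0` and forget the
`i`-th entries of `p` and `q`. -/
def chart (i : Fin (n + 1)) : OpenPartialHomeomorph (TRP n) (TModel n) where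
  toFun := descend (signedDelete i) (signedDelete_antipode i)
  invFun y := cover n (TS.lift i (one_mul (1 : ℝ)) y)
  source := chartSource i
  target := {y | y.1 ⬝ᵥ y.1 < 1}
  map_source' y hy := by
    obtain ⟨x, hx, rfl⟩ := exists_rep i hy
    change (signedDelete i x).1 ⬝ᵥ (signedDelete i x).1 < 1
    rw [signedDelete_of_pos i x hx]
    exact TS.delete_mem i x hx.ne'
  map_target' y hy := by
    rw [cover_mem_chartSource]
    have : 0 < 1 * (TS.lift i (one_mul (1 : ℝ)) y).1.1 i :=
      (TS.chart i (one_mul (1 : ℝ))).map_target hy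
    exact fun h => by simp [h] at this
  left_inv' y hy := by
    obtain ⟨x, hx, rfl⟩ := exists_rep i hy
    change cover n (TS.lift i (one_mul (1 : ℝ)) (signedDelete i x)) = cover n x
    rw [signedDelete_of_pos i x hx]
    congr 1
    exact (TS.chart i (one_mul (1 : ℝ))).left_inv
      (show 0 < 1 * x.1.1 i by rwa [one_mul])
  right_inv' y hy := by
    change signedDelete i (TS.lift i (one_mul (1 : ℝ)) y) = y
    have := (TS.chart i (one_mul (1 : ℝ))).map_target hy
    rw [signedDelete_of_pos i _ (by rw [← one_mul ((TS.lift i _ y).1.1 i)]; exact this)]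
    exact (TS.chart i (one_mul (1 : ℝ))).right_inv hy
  open_source := isOpen_chartSource i
  open_target := TS.isOpen_ball n
  continuousOn_toFun := by
    rw [(isQuotientMap_cover n).continuousOn_isOpen_iff (isOpen_chartSource i)]
    exact (continuousOn_signedDelete i).mono fun x hx => (cover_mem_chartSource i x).1 hx
  continuousOn_invFun :=
    (isQuotientMap_cover n).continuous.comp_continuousOn (TS.continuousOn_lift i _)

theorem exists_mem_chartSource (y : TRP n) : ∃ i, y ∈ chartSource i := by
  obtain ⟨x, rfl⟩ := cover_surjective n y
  obtain ⟨i, hi⟩ := TS.exists_ne_zero x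
  exact ⟨i, x, hi, rfl⟩

instance instChartedSpace (n : ℕ) : ChartedSpace (TModel n) (TRP n) where
  atlas := range chart
  chartAt y := chart (exists_mem_chartSource y).choose
  mem_chart_source y := (exists_mem_chartSource y).choose_spec
  chart_mem_atlas _ := mem_range_self _

/-- `T^*RP^n` is a smooth manifold. -/
instance instIsManifold (n : ℕ) : IsManifold 𝓘(ℝ, TModel n) ∞ (TRP n) := by
  refine isManifold_of_contDiffOn _ _ _ ?_
  rintro _ _ ⟨i, rfl⟩ ⟨k, rfl⟩
  have h : ContDiffOn ℝ ∞ ((chart i).symm ≫ₕ chart k)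
      ((chart i).symm ≫ₕ chart k : OpenPartialHomeomorph (TModel n) (TModel n)).source := by
    have hp := ((TS.contDiffOn_point i (one_mul (1 : ℝ))).of_le (m := ∞) le_top).mono
      (t := ((chart i).symm ≫ₕ chart k : OpenPartialHomeomorph (TModel n) (TModel n)).source)
      fun y hy => hy.1
    have hne : ∀ y ∈ ((chart i).symm ≫ₕ chart k :
        OpenPartialHomeomorph (TModel n) (TModel n)).source, (TS.point i 1 y).1 k ≠ 0 := by
      intro y hy
      have := (cover_mem_chartSource k _).1 hy.2
      rwa [TS.lift_val i _ hy.1] at this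
    have hk : ContDiffOn ℝ ∞ (fun y => (TS.point i 1 y).1 k)
        ((chart i).symm ≫ₕ chart k : OpenPartialHomeomorph (TModel n) (TModel n)).source :=
      contDiffOn_pi.1 hp.fst k
    have ha : ContDiffOn ℝ ∞ (fun y => |(TS.point i 1 y).1 k|)
        ((chart i).symm ≫ₕ chart k : OpenPartialHomeomorph (TModel n) (TModel n)).source :=
      fun y hy => ContDiffAt.comp_contDiffWithinAt (g := fun a : ℝ => |a|) y
        (contDiffAt_abs (hne y hy)) (hk y hy)
    refine ((hk.div ha fun y hy => abs_ne_zero.2 (hne y hy)).smul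
        (((TS.contDiff_delete k).of_le le_top).comp_contDiffOn hp)).congr fun y hy => ?_
    change signedDelete k (TS.lift i (one_mul (1 : ℝ)) y) = _
    unfold signedDelete
    rw [TS.lift_val i _ hy.1]
    rfl
  simpa using h

/-- The Hamiltonian `H([p, q]) = |q|` on `T^*RP^n`. -/
def energy : TRP n → ℝ := descend TS.energy TS.energy_antipode

/-- The normalized (co)geodesic flow on `T^*RP^n`. -/
def flow (t : ℝ) : TRP n → TRP n :=
  descend (fun x => cover n (TS.flow t x)) fun x => by
    rw [TS.flow_antipode, cover_antipode]

/-- The form on `T^*RP^n` whose pullback to `T^*S^n` is `TS.form`. -/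
def form (y : TRP n) (u v : TangentSpace 𝓘(ℝ, TModel n) y) : ℝ :=
  let d : TModel n →L[ℝ] TModel n :=
    (mfderiv 𝓘(ℝ, TModel n) 𝓘(ℝ, TModel n) (cover n) (Quotient.out y)).inverse
  TS.form (Quotient.out y) (d u) (d v)

end TRP

/-! ### Symplectic cuts -/

section SymplecticCut

variable {E : Type*} [NormedAddCommGroup E] [NormedSpace ℝ E]
  {M : Type*} [TopologicalSpace M] [ChartedSpace E M]

/-- `H` is, on the open set `V`, the moment map of a circle action: `σ` is the flow on `V` of the
Hamiltonian vector field `X` of `H`, given by `Ω(X, ·) = dH`, and it is `T`-periodic, i.e. an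
action of `ℝ/Tℤ`. The level `H = s` lies in `V`, and the action is free there. Off `V` nothing is
asked of `σ`. -/
structure IsHamiltonianCircleAction
    (Ω : ∀ x : M, TangentSpace 𝓘(ℝ, E) x → TangentSpace 𝓘(ℝ, E) x → ℝ)
    (V : Set M) (H : M → ℝ) (σ : ℝ → M → M) (T s : ℝ) : Prop where
  isOpen : IsOpen V
  continuous : Continuous H
  contMDiffOn : ContMDiffOn 𝓘(ℝ, E) 𝓘(ℝ, ℝ) ∞ H V
  level_subset : ∀ x, H x = s → x ∈ V
  mapsTo : ∀ t, MapsTo (σ t) V V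
  zero : ∀ x ∈ V, σ 0 x = x
  add : ∀ x ∈ V, ∀ t t', σ (t + t') x = σ t (σ t' x)
  contMDiffOn_flow : ContMDiffOn (𝓘(ℝ, ℝ).prod 𝓘(ℝ, E)) 𝓘(ℝ, E) ∞
    (fun z : ℝ × M => σ z.1 z.2) (univ ×ˢ V)
  hamiltonian : ∀ x ∈ V, ∀ t, ∀ v : TangentSpace 𝓘(ℝ, E) (σ t x),
    Ω (σ t x) (mfderiv 𝓘(ℝ, ℝ) 𝓘(ℝ, E) (fun τ => σ τ x) t (1 : ℝ)) v =
      mfderiv 𝓘(ℝ, E) 𝓘(ℝ, ℝ) H (σ t x) v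
  period_pos : 0 < T
  period : ∀ x ∈ V, σ T x = x
  free : ∀ x, H x = s → ∀ t, σ t x = x → ∃ k : ℤ, t = k * T

/-- The space obtained from `{H ≤ s}` by collapsing each `σ`-orbit in `{H = s}` to a point. -/
def CutSpace (H : M → ℝ) (σ : ℝ → M → M) (s : ℝ) : Type _ :=
  Quot fun x y : {x : M // H x ≤ s} => H x = s ∧ H y = s ∧ ∃ t, σ t x = y

instance CutSpace.instTopologicalSpace (H : M → ℝ) (σ : ℝ → M → M) (s : ℝ) :
    TopologicalSpace (CutSpace H σ s) :=
  inferInstanceAs (TopologicalSpace (Quot _))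

/-- The projection of `{H ≤ s}` to the cut space. -/
def CutSpace.mk (H : M → ℝ) (σ : ℝ → M → M) (s : ℝ) (x : {x : M // H x ≤ s}) : CutSpace H σ s :=
  Quot.mk _ x

/-- The level set in `M × ℂ` whose quotient by the circle is the symplectic cut near `{H = s}`:
the function `H(m) + (π / T) |w| ^ 2` is the moment map of the `ℝ/Tℤ`-action
`t ↦ (σ_t m, e^{-2 π i t / T} w)` for the form `Ω ⊕ dx ∧ dy`. -/
def cutLevel (V : Set M) (H : M → ℝ) (T s : ℝ) : Set (M × ℂ) :=
  {z | z.1 ∈ V ∧ H z.1 + Real.pi / T * ‖z.2‖ ^ 2 = s}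

/-- The given charts on the cut space are those of the symplectic cut of `{H ≤ s}` along
`{H = s}`:
* the open piece `{H < s}` stays intact, i.e. maps by local diffeomorphisms to the cut space;
* near `{H = s}` the cut space is the quotient of `cutLevel V H T s` by the circle, i.e. the map
  `κ` to the cut space which is invariant under the circle and sends `(m, w)` with real `w ≥ 0`
  to the class of `m`, is a submersion (it is smooth and has smooth local sections through all
  points). -/
structure IsSymplecticCut (V : Set M) (H : M → ℝ) (σ : ℝ → M → M) (T s : ℝ)
    [ChartedSpace E (CutSpace H σ s)] : Prop where
  isManifold : IsManifold 𝓘(ℝ, E) ∞ (CutSpace H σ s)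
  interior : ∃ ψ : M → CutSpace H σ s, (∀ x : {x : M // H x ≤ s}, ψ x = CutSpace.mk H σ s x) ∧
    IsLocalDiffeomorphOn 𝓘(ℝ, E) 𝓘(ℝ, E) ∞ ψ {x | H x < s}
  reduction : ∃ κ : M × ℂ → CutSpace H σ s,
    (∀ x : {x : M // H x ≤ s}, x.1 ∈ V →
      κ (x, (√(T / Real.pi * (s - H x)) : ℝ)) = CutSpace.mk H σ s x) ∧
    (∀ z ∈ cutLevel V H T s, ∀ t : ℝ,
      κ (σ t z.1, Complex.exp (-(2 * Real.pi * t / T * Complex.I)) * z.2) = κ z) ∧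
    ContMDiffOn (𝓘(ℝ, E).prod 𝓘(ℝ, ℂ)) 𝓘(ℝ, E) ∞ κ (cutLevel V H T s) ∧
    ∀ z ∈ cutLevel V H T s, ∃ τ : CutSpace H σ s → M × ℂ,
      ContMDiffAt 𝓘(ℝ, E) (𝓘(ℝ, E).prod 𝓘(ℝ, ℂ)) ∞ τ (κ z) ∧ τ (κ z) = z ∧
      ∀ᶠ y in 𝓝 (κ z), τ y ∈ cutLevel V H T s ∧ κ (τ y) = y

end SymplecticCut

/-! ### Covers and branched covers -/

/-- `f` is a two-sheeted smooth covering and pulls back `Ω'` to `Ω`. -/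
structure IsSymplecticDoubleCover {E : Type*} [NormedAddCommGroup E] [NormedSpace ℝ E]
    {M N : Type*} [TopologicalSpace M] [ChartedSpace E M] [TopologicalSpace N] [ChartedSpace E N]
    (f : M → N)
    (Ω : ∀ x : M, TangentSpace 𝓘(ℝ, E) x → TangentSpace 𝓘(ℝ, E) x → ℝ)
    (Ω' : ∀ x : N, TangentSpace 𝓘(ℝ, E) x → TangentSpace 𝓘(ℝ, E) x → ℝ) : Prop where
  isCoveringMap : IsCoveringMap f
  ncard_fiber : ∀ y, (f ⁻¹' {y}).ncard = 2
  isLocalDiffeomorph : IsLocalDiffeomorph 𝓘(ℝ, E) 𝓘(ℝ, E) ∞ f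
  pullback : ∀ x, ∀ u v : TangentSpace 𝓘(ℝ, E) x,
    Ω' (f x) (mfderiv 𝓘(ℝ, E) 𝓘(ℝ, E) f x u) (mfderiv 𝓘(ℝ, E) 𝓘(ℝ, E) f x v) = Ω x u v

/-- `f` is a double cover of complex `n`-manifolds, branched along `B`: it is holomorphic, a
two-sheeted unramified cover off `B`, has one point over each point of `B`, and at such a point
it is `(u, w) ↦ (u, w ^ 2)` in suitable holomorphic coordinates, with `B = {w = 0}`. -/
structure IsBranchedDoubleCover (n : ℕ) {X Y : Type*} [TopologicalSpace X] [TopologicalSpace Y]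
    [ChartedSpace (Fin n → ℂ) X] [ChartedSpace (Fin n → ℂ) Y] (f : X → Y) (B : Set Y) :
    Prop where
  holomorphic : ContMDiff 𝓘(ℂ, Fin n → ℂ) 𝓘(ℂ, Fin n → ℂ) ω f
  isCoveringMapOn : IsCoveringMapOn f Bᶜ
  ncard_fiber : ∀ y ∉ B, (f ⁻¹' {y}).ncard = 2
  unramified : IsLocalDiffeomorphOn 𝓘(ℂ, Fin n → ℂ) 𝓘(ℂ, Fin n → ℂ) ω f (f ⁻¹' Bᶜ)
  existsUnique : ∀ y ∈ B, ∃! x, f x = y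
  branched : ∀ x, f x ∈ B →
    ∃ φ ∈ IsManifold.maximalAtlas 𝓘(ℂ, Fin n → ℂ) ω X,
    ∃ ψ ∈ IsManifold.maximalAtlas 𝓘(ℂ, Fin n → ℂ) ω Y, ∃ k : Fin n,
      x ∈ φ.source ∧
      (∀ x' ∈ φ.source, f x' ∈ ψ.source ∧
        ψ (f x') = Function.update (φ x') k (φ x' k ^ 2)) ∧
      ∀ y ∈ ψ.source, y ∈ B ↔ ψ y k = 0

/-! ### The cut cotangent disc bundles -/

/-- The closed unit disc bundle in `T^*S^n` with its boundary cut. -/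
abbrev CutTS (n : ℕ) : Type := CutSpace (TS.energy (n := n)) TS.flow 1

/-- The closed unit disc bundle in `T^*RP^n` with its boundary cut. -/
abbrev CutTRP (n : ℕ) : Type := CutSpace (TRP.energy (n := n)) TRP.flow 1

/-- The charts on `CutTS n` are those of the symplectic cut, for the geodesic circle action of
period `2π` off the zero section. -/
abbrev IsCutTS (n : ℕ) [ChartedSpace (TModel n) (CutTS n)] : Prop :=
  IsSymplecticCut (E := TModel n) {x : TS n | 0 < TS.energy x} TS.energy TS.flow (2 * Real.pi) 1

/-- The charts on `CutTRP n` are those of the symplectic cut, for the geodesic circle action of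
period `π` off the zero section. -/
abbrev IsCutTRP (n : ℕ) [ChartedSpace (TModel n) (CutTRP n)] : Prop :=
  IsSymplecticCut (E := TModel n) {x : TRP n | 0 < TRP.energy x} TRP.energy TRP.flow Real.pi 1

/-- The double cover of the closed unit disc bundles. -/
def discCover (n : ℕ) (x : {x : TS n // TS.energy x ≤ 1}) : {y : TRP n // TRP.energy y ≤ 1} :=
  ⟨TRP.cover n x.1, x.2⟩

/-- `Ψ` and `Φ` identify the cut disc bundles with `Q^n` and `CP^n` so that the double cover of
disc bundles becomes the projection `Q^n → CP^n`. They embed the open disc bundles smoothly as the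
complements of the branch loci, and the boundary goes to the quadric. -/
structure ExtendsDoubleCover {n : ℕ} (Ψ : CutTS n ≃ₜ Q n) (Φ : CutTRP n ≃ₜ CP n) : Prop where
  comm : ∀ x : {x : TS n // TS.energy x ≤ 1},
    Q.proj n (Ψ (CutSpace.mk _ _ _ x)) = Φ (CutSpace.mk _ _ _ (discCover n x))
  boundary : ∀ y : {y : TRP n // TRP.energy y ≤ 1},
    Φ (CutSpace.mk _ _ _ y) ∈ quadric n ↔ TRP.energy y.1 = 1
  smooth_source : ∃ i : TS n → Q n, (∀ x : {x : TS n // TS.energy x ≤ 1}, i x = Ψ (CutSpace.mk _ _ _ x)) ∧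
    IsLocalDiffeomorphOn 𝓘(ℝ, TModel n) 𝓘(ℝ, Fin n → ℂ) ∞ i {x | TS.energy x < 1}
  smooth_target : ∃ j : TRP n → CP n, (∀ y : {y : TRP n // TRP.energy y ≤ 1}, j y = Φ (CutSpace.mk _ _ _ y)) ∧
    IsLocalDiffeomorphOn 𝓘(ℝ, TModel n) 𝓘(ℝ, Fin n → ℂ) ∞ j {y | TRP.energy y < 1}

end

/-! Write Z·Z for the sum of squares of a complex vector. A point (p, q) of the closed disc bundle
gives Z = p + iq with Z·Z = 1 - |q|², so [p + iq : i√(1 - |q|²)] lies on the quadric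
(`TS.toQuadric`). Conversely, scale a point of the quadric until its last coordinate is i times a
nonnegative real: then Z·Z is real and nonnegative, Re Z ⊥ Im Z, and dividing by |Re Z| gives back
(p, q). This is a smooth inverse over |q| < 1. Where |q| = 1 the last coordinate vanishes and only
the phase of p + iq is lost; the flow multiplies p + iq by e^{-it}, so the fibres there are exactly
the orbits. The antipodal map flips the sign of the last coordinate relative to the others, which is
the deck transformation of [Z : ζ] ↦ [Z]. Compactness turns these facts into the two homeomorphisms
(`TS.IsDiscModel.exists_extendsDoubleCover`).

For the smooth structures, two models of a cut are compared by composing a local section of one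
reduction map κ with the other reduction map (`IsCutModel.contMDiff`). So both the existence of the
cut and the diffeomorphism reduce to exhibiting κ with values in CP^n or Q^n. Let h = |q| and X = p
+ iq/|q|, an isotropic vector with |X|² = 2. For RP^n take κ = [X + bX̄] with b = w/√(1 + h); for
S^n take κ = [X + d²X̄ : 2id] with d = w/√(2(1 + h)). Since the flow turns X by e^{-it}, invariance
means that b turns by e^{-2it} and d by e^{-it}, which are the circle actions of period π and 2π.
Local sections come from the decomposition, unique after a positive rescaling, of a vector that is
not a complex multiple of a real one as X + bX̄ with |b| < 1 (`comb_isotropic`, `isotropic_comb`).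

For real w ≥ 0 the second κ is `TS.toQuadric`, but the first is its projection only after the
fibrewise rescaling `TS.shrink`. This is why the two halves of the theorem use different
homeomorphisms: at a given point |b| = |d|, so the double cover itself induces d ↦ d²/|d| between
the two cuts, which is continuous but not smooth for n ≥ 1.

The branched cover rests on ζ² = -Z·Z. Off the branch locus a local square root gives the inverse.
Near it, dividing by a form z_a + i z_b yields coordinates on CP^n one of which is -Z·Z
(`Q.branchChart_proj`). -/

/-! ### Local diffeomorphisms and changes of charts -/

section LocalDiffeomorphisms

variable {𝕜 : Type*} [NontriviallyNormedField 𝕜]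
  {E F G : Type*} [NormedAddCommGroup E] [NormedSpace 𝕜 E] [NormedAddCommGroup F]
  [NormedSpace 𝕜 F] [NormedAddCommGroup G] [NormedSpace 𝕜 G]
  {M N P : Type*} [TopologicalSpace M] [ChartedSpace E M] [TopologicalSpace N] [ChartedSpace F N]
  [TopologicalSpace P] [ChartedSpace G P] {m : WithTop ℕ∞}

/-- A map is smooth at `f x` if its composition with a local diffeomorphism `f` is smooth
at `x`. -/
theorem IsLocalDiffeomorphAt.contMDiffAt_of_comp {f : M → N} {g : N → P} {x : M}
    (hf : IsLocalDiffeomorphAt 𝓘(𝕜, E) 𝓘(𝕜, F) m f x)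
    (hg : ContMDiffAt 𝓘(𝕜, E) 𝓘(𝕜, G) m (g ∘ f) x) :
    ContMDiffAt 𝓘(𝕜, F) 𝓘(𝕜, G) m g (f x) := by
  have hx : hf.localInverse (f x) = x := hf.localInverse_left_inv hf.localInverse_mem_target
  have h : ContMDiffAt 𝓘(𝕜, F) 𝓘(𝕜, G) m ((g ∘ f) ∘ hf.localInverse) (f x) :=
    ContMDiffAt.comp (f x) (by rw [hx]; exact hg) hf.localInverse_contMDiffAt
  refine h.congr_of_eventuallyEq ?_
  filter_upwards [hf.localInverse_eventuallyEq_right] with y hy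
  exact congrArg g hy.symm

theorem IsLocalDiffeomorphAt.congr_of_eventuallyEq {f g : M → N} {x : M}
    (hf : IsLocalDiffeomorphAt 𝓘(𝕜, E) 𝓘(𝕜, F) m f x) (h : g =ᶠ[𝓝 x] f) :
    IsLocalDiffeomorphAt 𝓘(𝕜, E) 𝓘(𝕜, F) m g x := by
  obtain ⟨Φ, hx, hΦ⟩ := hf
  obtain ⟨U, hU, hUo, hxU⟩ := eventually_nhds_iff.1 h
  let Ψ := Φ.toOpenPartialHomeomorph.restrOpen U hUo
  refine ⟨⟨Ψ.toPartialEquiv, Ψ.open_source, Ψ.open_target,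
    Φ.contMDiffOn_toFun.mono inter_subset_left,
    Φ.contMDiffOn_invFun.mono inter_subset_left⟩, ⟨hx, hxU⟩, fun y hy => ?_⟩
  exact (hU y hy.2).trans (hΦ hy.1)

/-- A smooth map with a smooth local inverse is a local diffeomorphism. -/
theorem isLocalDiffeomorphAt_of_inverse {f : M → N} {g : N → M} {U : Set M} {W : Set N} {x : M}
    (hU : IsOpen U) (hW : IsOpen W) (hx : x ∈ U) (hfU : MapsTo f U W)
    (hf : ContMDiffOn 𝓘(𝕜, E) 𝓘(𝕜, F) m f U) (hg : ContMDiffOn 𝓘(𝕜, F) 𝓘(𝕜, E) m g W)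
    (hgf : ∀ y ∈ U, g (f y) = y) (hfg : ∀ z ∈ W, f (g z) = z) :
    IsLocalDiffeomorphAt 𝓘(𝕜, E) 𝓘(𝕜, F) m f x := by
  refine ⟨⟨⟨f, g, U, W ∩ g ⁻¹' U, fun y hy => ⟨hfU hy, ?_⟩, fun z hz => hz.2, hgf,
    fun z hz => hfg z hz.1⟩, hU, hg.continuousOn.isOpen_inter_preimage hW hU, hf,
    hg.mono inter_subset_left⟩, hx, fun _ _ => rfl⟩
  change g (f y) ∈ U
  rwa [hgf y hy]

/-- With the double cover as `f`, a map on the quotient is a local diffeomorphism as soon as its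
lift is. -/
theorem IsLocalDiffeomorphAt.of_comp_right {f : M → N} {g : N → P} {x : M}
    (hf : IsLocalDiffeomorphAt 𝓘(𝕜, E) 𝓘(𝕜, F) m f x)
    (hg : IsLocalDiffeomorphAt 𝓘(𝕜, E) 𝓘(𝕜, G) m (g ∘ f) x) :
    IsLocalDiffeomorphAt 𝓘(𝕜, F) 𝓘(𝕜, G) m g (f x) := by
  have hx : hf.localInverse (f x) = x := hf.localInverse_left_inv hf.localInverse_mem_target
  have h : IsLocalDiffeomorphAt 𝓘(𝕜, F) 𝓘(𝕜, G) m ((g ∘ f) ∘ hf.localInverse) (f x) :=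
    hf.localInverse_isLocalDiffeomorphAt.comp 𝓘(𝕜, G) (P := P) (by rw [hx]; exact hg)
  refine h.congr_of_eventuallyEq ?_
  filter_upwards [hf.localInverse_eventuallyEq_right] with y hy
  exact congrArg g hy.symm

end LocalDiffeomorphisms

/-! ### From holomorphic to real smooth maps -/

section RestrictScalars

variable {E F : Type*} [NormedAddCommGroup E] [NormedSpace ℂ E] [NormedAddCommGroup F]
  [NormedSpace ℂ F] {M N : Type*} [TopologicalSpace M] [ChartedSpace E M]
  [TopologicalSpace N] [ChartedSpace F N] {m : WithTop ℕ∞}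

/-- The real and complex structures share their charts, so only the differentiability of the
coordinate expression has to be weakened. -/
theorem ContMDiffOn.restrict_scalars_real {f : M → N} {s : Set M}
    (hf : ContMDiffOn 𝓘(ℂ, E) 𝓘(ℂ, F) m f s) : ContMDiffOn 𝓘(ℝ, E) 𝓘(ℝ, F) m f s := by
  intro x hx
  have h := hf x hx
  rw [contMDiffWithinAt_iff] at h ⊢
  exact ⟨h.1, h.2.restrict_scalars ℝ⟩

theorem IsLocalDiffeomorphAt.restrict_scalars_real {f : M → N} {x : M}
    (hf : IsLocalDiffeomorphAt 𝓘(ℂ, E) 𝓘(ℂ, F) m f x) :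
    IsLocalDiffeomorphAt 𝓘(ℝ, E) 𝓘(ℝ, F) m f x := by
  obtain ⟨Φ, hx, hΦ⟩ := hf
  exact ⟨⟨Φ.toPartialEquiv, Φ.open_source, Φ.open_target,
    Φ.contMDiffOn_toFun.restrict_scalars_real, Φ.contMDiffOn_invFun.restrict_scalars_real⟩, hx, hΦ⟩

theorem IsLocalDiffeomorphAt.of_le {𝕜 E F M N : Type*} [NontriviallyNormedField 𝕜]
    [NormedAddCommGroup E] [NormedSpace 𝕜 E] [NormedAddCommGroup F]
    [NormedSpace 𝕜 F] [TopologicalSpace M] [ChartedSpace E M] [TopologicalSpace N]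
    [ChartedSpace F N] {m m' : WithTop ℕ∞} {f : M → N} {x : M}
    (hf : IsLocalDiffeomorphAt 𝓘(𝕜, E) 𝓘(𝕜, F) m f x) (h : m' ≤ m) :
    IsLocalDiffeomorphAt 𝓘(𝕜, E) 𝓘(𝕜, F) m' f x := by
  obtain ⟨Φ, hx, hΦ⟩ := hf
  exact ⟨⟨Φ.toPartialEquiv, Φ.open_source, Φ.open_target,
    Φ.contMDiffOn_toFun.of_le h, Φ.contMDiffOn_invFun.of_le h⟩, hx, hΦ⟩

end RestrictScalars

/-! ### Transport of a manifold structure along a homeomorphism -/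

section Transport

variable {E F : Type*} [NormedAddCommGroup E] [NormedSpace ℝ E] [NormedAddCommGroup F]
  [NormedSpace ℝ F] {C N : Type*} [TopologicalSpace C] [TopologicalSpace N] [ChartedSpace F N]

/-- The charts of `N`, pulled back by a homeomorphism and with a linear change of the model
space. -/
@[reducible]
def pullbackChartedSpace (Φ : C ≃ₜ N) (e : F ≃L[ℝ] E) : ChartedSpace E C where
  atlas := {c | ∃ d ∈ atlas F N, c = Φ.toOpenPartialHomeomorph ≫ₕ d ≫ₕ
    e.toHomeomorph.toOpenPartialHomeomorph}
  chartAt x := Φ.toOpenPartialHomeomorph ≫ₕ chartAt F (Φ x) ≫ₕ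
    e.toHomeomorph.toOpenPartialHomeomorph
  mem_chart_source x := by simp
  chart_mem_atlas x := ⟨_, chart_mem_atlas F (Φ x), rfl⟩

/-- A homeomorphism to a manifold is a diffeomorphism for a suitable manifold structure, modelled
on any space linearly isomorphic to the model space. -/
theorem exists_chartedSpace_contMDiff [IsManifold 𝓘(ℝ, F) ∞ N] (Φ : C ≃ₜ N) (e : F ≃L[ℝ] E) :
    ∃ _ : ChartedSpace E C, IsManifold 𝓘(ℝ, E) ∞ C ∧ ContMDiff 𝓘(ℝ, E) 𝓘(ℝ, F) ∞ Φ ∧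
      ContMDiff 𝓘(ℝ, F) 𝓘(ℝ, E) ∞ Φ.symm := by
  let := pullbackChartedSpace Φ e
  have hM : IsManifold 𝓘(ℝ, E) ∞ C := by
    refine isManifold_of_contDiffOn _ _ _ ?_
    rintro _ _ ⟨d, hd, rfl⟩ ⟨d', hd', rfl⟩
    have h1 := contMDiffOn_symm_of_mem_maximalAtlas
      (IsManifold.subset_maximalAtlas (I := 𝓘(ℝ, F)) (n := ∞) hd)
    have h2 := contMDiffOn_of_mem_maximalAtlas
      (IsManifold.subset_maximalAtlas (I := 𝓘(ℝ, F)) (n := ∞) hd')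
    have h3 : ContDiffOn ℝ ∞ (d' ∘ d.symm) (d.target ∩ d.symm ⁻¹' d'.source) :=
      contMDiffOn_iff_contDiffOn.1
        (h2.comp (h1.mono inter_subset_left) fun y hy => hy.2)
    have h4 : ContDiffOn ℝ ∞ (e ∘ (d' ∘ d.symm) ∘ e.symm)
        (e.symm ⁻¹' (d.target ∩ d.symm ⁻¹' d'.source)) :=
      e.contDiff.comp_contDiffOn (h3.comp e.symm.contDiff.contDiffOn fun y hy => hy)
    simp only [mfld_simps]
    refine (h4.congr fun y _ => ?_).mono fun y hy => ?_
    · simp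
    · simpa using hy
  refine ⟨inferInstance, hM, fun x => ?_, fun y => ?_⟩
  · have h1 : ContMDiffAt 𝓘(ℝ, E) 𝓘(ℝ, E) ∞ (chartAt E x) x :=
      contMDiffAt_of_mem_maximalAtlas (IsManifold.chart_mem_maximalAtlas x) (mem_chart_source E x)
    have h2 : ContMDiffAt 𝓘(ℝ, F) 𝓘(ℝ, F) ∞ (chartAt F (Φ x)).symm (chartAt F (Φ x) (Φ x)) :=
      contMDiffAt_symm_of_mem_maximalAtlas (IsManifold.chart_mem_maximalAtlas _)
        (mem_chart_target F (Φ x))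
    have h3 : ContMDiffAt 𝓘(ℝ, E) 𝓘(ℝ, F) ∞ (e.symm ∘ chartAt E x) x :=
      e.symm.contDiff.contMDiff.contMDiffAt.comp x h1
    have h4 : (e.symm ∘ chartAt E x) x = chartAt F (Φ x) (Φ x) := by
      change e.symm (e (chartAt F (Φ x) (Φ x))) = _
      simp
    refine (ContMDiffAt.comp x (by rw [h4]; exact h2) h3).congr_of_eventuallyEq ?_
    filter_upwards [Φ.continuous.continuousAt.preimage_mem_nhds
      (chart_source_mem_nhds F (Φ x))] with y hy
    change Φ y = (chartAt F (Φ x)).symm (e.symm (e (chartAt F (Φ x) (Φ y))))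
    rw [e.symm_apply_apply, (chartAt F (Φ x)).left_inv hy]
  · set x := Φ.symm y with hx
    have hy : Φ x = y := Φ.apply_symm_apply y
    have h1 : ContMDiffAt 𝓘(ℝ, F) 𝓘(ℝ, F) ∞ (chartAt F (Φ x)) (Φ x) :=
      contMDiffAt_of_mem_maximalAtlas (IsManifold.chart_mem_maximalAtlas _)
        (mem_chart_source F (Φ x))
    have h2 : ContMDiffAt 𝓘(ℝ, E) 𝓘(ℝ, E) ∞ (chartAt E x).symm (chartAt E x x) :=
      contMDiffAt_symm_of_mem_maximalAtlas (IsManifold.chart_mem_maximalAtlas _)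
        (mem_chart_target E x)
    have h3 : ContMDiffAt 𝓘(ℝ, F) 𝓘(ℝ, E) ∞ (e ∘ chartAt F (Φ x)) (Φ x) :=
      e.contDiff.contMDiff.contMDiffAt.comp _ h1
    rw [← hy]
    refine (ContMDiffAt.comp (Φ x) h2 h3).congr_of_eventuallyEq ?_
    filter_upwards [chart_source_mem_nhds F (Φ x)] with z hz
    change Φ.symm z = Φ.symm ((chartAt F (Φ x)).symm (e.symm (e (chartAt F (Φ x) z))))
    rw [e.symm_apply_apply, (chartAt F (Φ x)).left_inv hz]

end Transport

/-! ### Recognizing symplectic cuts -/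

section CutModel

variable {E F F' : Type*} [NormedAddCommGroup E] [NormedSpace ℝ E] [NormedAddCommGroup F]
  [NormedSpace ℝ F] [NormedAddCommGroup F'] [NormedSpace ℝ F']
  {M : Type*} [TopologicalSpace M] [ChartedSpace E M]
  {N N' : Type*} [TopologicalSpace N] [ChartedSpace F N] [TopologicalSpace N'] [ChartedSpace F' N']

/-- The map `μ` from `{H ≤ s}` to a manifold has the properties that characterize the projection
to the symplectic cut. -/
structure IsCutModel (V : Set M) (H : M → ℝ) (σ : ℝ → M → M) (T s : ℝ)
    (μ : {x : M // H x ≤ s} → N) : Prop where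
  interior : ∃ ψ : M → N, (∀ x : {x : M // H x ≤ s}, ψ x = μ x) ∧
    IsLocalDiffeomorphOn 𝓘(ℝ, E) 𝓘(ℝ, F) ∞ ψ {x | H x < s}
  reduction : ∃ κ : M × ℂ → N,
    (∀ x : {x : M // H x ≤ s}, x.1 ∈ V → κ (x, (√(T / Real.pi * (s - H x)) : ℝ)) = μ x) ∧
    (∀ z ∈ cutLevel V H T s, ∀ t : ℝ,
      κ (σ t z.1, Complex.exp (-(2 * Real.pi * t / T * Complex.I)) * z.2) = κ z) ∧
    ContMDiffOn (𝓘(ℝ, E).prod 𝓘(ℝ, ℂ)) 𝓘(ℝ, F) ∞ κ (cutLevel V H T s) ∧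
    ∀ z ∈ cutLevel V H T s, ∃ τ : N → M × ℂ,
      ContMDiffAt 𝓘(ℝ, F) (𝓘(ℝ, E).prod 𝓘(ℝ, ℂ)) ∞ τ (κ z) ∧ τ (κ z) = z ∧
      ∀ᶠ y in 𝓝 (κ z), τ y ∈ cutLevel V H T s ∧ κ (τ y) = y

/-- The cut space is a model of itself, so uniqueness of its smooth structure becomes a comparison
of two models. -/
theorem IsSymplecticCut.isCutModel {V : Set M} {H : M → ℝ} {σ : ℝ → M → M} {T s : ℝ}
    [ChartedSpace E (CutSpace H σ s)] (h : IsSymplecticCut (E := E) V H σ T s) :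
    IsCutModel (E := E) (F := E) V H σ T s (CutSpace.mk H σ s) :=
  ⟨h.interior, h.reduction⟩

/-- Every circle orbit in the level set meets {w ≥ 0}, where both reduction maps are prescribed by
the projections. Invariance carries the comparison from there to the whole level set. -/
theorem cutLevel_apply_eq {M : Type*} {V : Set M} {H : M → ℝ} {σ : ℝ → M → M} {T s : ℝ}
    {α β : Type*} {μ : {x : M // H x ≤ s} → α} {ν : {x : M // H x ≤ s} → β} {g : α → β}
    (hg : ∀ x, g (μ x) = ν x) {κ : M × ℂ → α} {κ' : M × ℂ → β}
    (hκ : ∀ x : {x : M // H x ≤ s}, x.1 ∈ V →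
      κ (x, (√(T / Real.pi * (s - H x)) : ℝ)) = μ x)
    (hκi : ∀ z ∈ cutLevel V H T s, ∀ t : ℝ,
      κ (σ t z.1, Complex.exp (-(2 * Real.pi * t / T * Complex.I)) * z.2) = κ z)
    (hκ' : ∀ x : {x : M // H x ≤ s}, x.1 ∈ V →
      κ' (x, (√(T / Real.pi * (s - H x)) : ℝ)) = ν x)
    (hκi' : ∀ z ∈ cutLevel V H T s, ∀ t : ℝ,
      κ' (σ t z.1, Complex.exp (-(2 * Real.pi * t / T * Complex.I)) * z.2) = κ' z)
    (hT : 0 < T) (hV : ∀ t, MapsTo (σ t) V V) (hHσ : ∀ x ∈ V, ∀ t, H (σ t x) = H x)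
    {z : M × ℂ} (hz : z ∈ cutLevel V H T s) : g (κ z) = κ' z := by
  have hπ := Real.pi_pos
  -- The time whose phase e^{-2πit/T} cancels the argument of w.
  set t : ℝ := T * z.2.arg / (2 * Real.pi) with ht
  have hH : H (σ t z.1) = H z.1 := hHσ _ hz.1 t
  have hle : H (σ t z.1) ≤ s := by
    rw [hH]
    have := hz.2
    have h0 : 0 ≤ Real.pi / T * ‖z.2‖ ^ 2 := by positivity
    linarith
  have hw : Complex.exp (-(2 * Real.pi * t / T * Complex.I)) * z.2 =
      (√(T / Real.pi * (s - H (σ t z.1))) : ℝ) := by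
    have h1 : √(T / Real.pi * (s - H (σ t z.1))) = ‖z.2‖ := by
      rw [hH, ← hz.2, show T / Real.pi * (H z.1 + Real.pi / T * ‖z.2‖ ^ 2 - H z.1) = ‖z.2‖ ^ 2 by
        field_simp; ring, Real.sqrt_sq (norm_nonneg _)]
    rw [h1]
    have h2 : (2 * Real.pi * t / T * Complex.I : ℂ) = z.2.arg * Complex.I := by
      rw [ht]
      have : (T : ℂ) ≠ 0 := by exact_mod_cast hT.ne'
      have : (Real.pi : ℂ) ≠ 0 := by exact_mod_cast hπ.ne'
      push_cast
      field_simp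
    rw [h2]
    conv_lhs => rw [← Complex.norm_mul_exp_arg_mul_I z.2]
    rw [mul_left_comm, Complex.norm_mul_exp_arg_mul_I, ← Complex.exp_add, neg_add_cancel,
      Complex.exp_zero, mul_one]
  rw [← hκi z hz t, ← hκi' z hz t, hw, hκ ⟨_, hle⟩ (hV t hz.1), hκ' ⟨_, hle⟩ (hV t hz.1), hg]

/-- Maps between models of the symplectic cut, compatible with the projections, are smooth. -/
theorem IsCutModel.contMDiff {V : Set M} {H : M → ℝ} {σ : ℝ → M → M} {T s : ℝ}
    {μ : {x : M // H x ≤ s} → N} {ν : {x : M // H x ≤ s} → N'}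
    (h : IsCutModel (E := E) (F := F) V H σ T s μ)
    (h' : IsCutModel (E := E) (F := F') V H σ T s ν) (hμ : Function.Surjective μ)
    (hH : Continuous H) (hlevel : ∀ x, H x = s → x ∈ V)
    (hT : 0 < T) (hV : ∀ t, MapsTo (σ t) V V) (hHσ : ∀ x ∈ V, ∀ t, H (σ t x) = H x)
    {g : N → N'} (hg : ∀ x, g (μ x) = ν x) : ContMDiff 𝓘(ℝ, F) 𝓘(ℝ, F') ∞ g := by
  intro y
  obtain ⟨x, rfl⟩ := hμ y
  -- Over {H < s} both projections are local diffeomorphisms. Over {H = s} the map `g` coincides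
  -- near the point with κ' ∘ τ, where τ is a local section of κ through (x, 0).
  rcases x.2.lt_or_eq with hx | hx
  · obtain ⟨ψ, hψ, hψd⟩ := h.interior
    obtain ⟨ψ', hψ', hψd'⟩ := h'.interior
    rw [← hψ]
    refine (hψd ⟨x.1, hx⟩).contMDiffAt_of_comp ?_
    refine (hψd' ⟨x.1, hx⟩).contMDiffAt.congr_of_eventuallyEq ?_
    filter_upwards [(isOpen_lt hH continuous_const).mem_nhds hx] with x' hx'
    have hx'' : H x' ≤ s := le_of_lt hx'
    exact (congrArg g (hψ ⟨x', hx''⟩)).trans ((hg _).trans (hψ' ⟨x', hx''⟩).symm)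
  · obtain ⟨κ, hκ, hκi, -, hκτ⟩ := h.reduction
    obtain ⟨κ', hκ', hκi', hκs', -⟩ := h'.reduction
    have hz : ((x.1, 0) : M × ℂ) ∈ cutLevel V H T s := ⟨hlevel _ hx, by simp [hx]⟩
    have hκx : κ (x.1, 0) = μ x := by simpa [hx] using hκ x (hlevel _ hx)
    obtain ⟨τ, hτ, hτz, hτe⟩ := hκτ _ hz
    rw [hκx] at hτ hτz hτe
    have h1 : ContMDiffWithinAt (𝓘(ℝ, E).prod 𝓘(ℝ, ℂ)) 𝓘(ℝ, F') ∞ κ' (cutLevel V H T s)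
        (τ (μ x)) := by rw [hτz]; exact hκs' _ hz
    have h2 : ContMDiffAt 𝓘(ℝ, F) 𝓘(ℝ, F') ∞ (κ' ∘ τ) (μ x) :=
      (ContMDiffWithinAt.comp' _ h1 hτ).contMDiffAt
        (Filter.inter_mem Filter.univ_mem (hτe.mono fun y hy => hy.1))
    refine h2.congr_of_eventuallyEq ?_
    filter_upwards [hτe] with y hy
    rw [Function.comp_apply, ← cutLevel_apply_eq hg hκ hκi hκ' hκi' hT hV hHσ hy.1, hy.2]

/-- The manifold structure pulled back from a model is that of the symplectic cut. -/
theorem IsCutModel.exists_isSymplecticCut [IsManifold 𝓘(ℝ, F) ∞ N] {V : Set M} {H : M → ℝ}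
    {σ : ℝ → M → M} {T s : ℝ} (Φ : CutSpace H σ s ≃ₜ N)
    (h : IsCutModel (E := E) (F := F) V H σ T s fun x => Φ (CutSpace.mk H σ s x))
    (e : F ≃L[ℝ] E) :
    ∃ _ : ChartedSpace E (CutSpace H σ s), IsSymplecticCut (E := E) V H σ T s := by
  obtain ⟨cs, hM, hΦ, hΦ'⟩ := exists_chartedSpace_contMDiff Φ e
  obtain ⟨ψ, hψ, hψd⟩ := h.interior
  obtain ⟨κ, hκ, hκi, hκs, hκτ⟩ := h.reduction
  refine ⟨cs, hM, ⟨fun x => Φ.symm (ψ x), fun x => by simp [hψ], fun x => ?_⟩,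
    ⟨fun z => Φ.symm (κ z), fun x hx => by simp [hκ x hx], fun z hz t => by simp [hκi z hz t],
      hΦ'.comp_contMDiffOn hκs, fun z hz => ?_⟩⟩
  · let D : Diffeomorph 𝓘(ℝ, F) 𝓘(ℝ, E) N (CutSpace H σ s) ∞ := ⟨Φ.symm.toEquiv, hΦ', hΦ⟩
    exact (hψd x).comp 𝓘(ℝ, E) _ (D.isLocalDiffeomorph _)
  · obtain ⟨τ, hτ, hτz, hτe⟩ := hκτ z hz
    refine ⟨fun y => τ (Φ y), ?_, by simp [hτz], ?_⟩
    · exact ContMDiffAt.comp (Φ.symm (κ z)) (by rw [Φ.apply_symm_apply]; exact hτ) hΦ.contMDiffAt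
    · have hc : Filter.Tendsto Φ (𝓝 (Φ.symm (κ z))) (𝓝 (κ z)) := by
        simpa using Φ.continuous.tendsto (Φ.symm (κ z))
      filter_upwards [hc.eventually hτe] with y hy
      exact ⟨hy.1, by rw [hy.2, Φ.symm_apply_apply]⟩

/-- Smoothness of `Φ` and of its inverse are two instances of `IsCutModel.contMDiff`, with the two
models exchanged. -/
theorem IsCutModel.exists_diffeomorph {V : Set M} {H : M → ℝ}
    {σ : ℝ → M → M} {T s : ℝ} [ChartedSpace E (CutSpace H σ s)] (Φ : CutSpace H σ s ≃ₜ N)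
    (h : IsCutModel (E := E) (F := F) V H σ T s fun x => Φ (CutSpace.mk H σ s x))
    (hc : IsSymplecticCut (E := E) V H σ T s)
    (hH : Continuous H) (hlevel : ∀ x, H x = s → x ∈ V)
    (hT : 0 < T) (hV : ∀ t, MapsTo (σ t) V V) (hHσ : ∀ x ∈ V, ∀ t, H (σ t x) = H x) :
    ∃ D : CutSpace H σ s ≃ₘ⟮𝓘(ℝ, E), 𝓘(ℝ, F)⟯ N, D.toHomeomorph = Φ := by
  have hs : Function.Surjective (CutSpace.mk H σ s) := Quot.mk_surjective
  refine ⟨⟨Φ.toEquiv, ?_, ?_⟩, by ext; rfl⟩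
  · exact IsCutModel.contMDiff hc.isCutModel h hs hH hlevel hT hV hHσ fun _ => rfl
  · exact IsCutModel.contMDiff h hc.isCutModel (Φ.surjective.comp hs) hH hlevel hT hV hHσ
      fun x => Φ.symm_apply_apply _

end CutModel

/-! ### Smooth maps to and from projective space and the quadric -/

noncomputable section

namespace CP

variable {n : ℕ}

/-- The point `[v]`, with a junk value at `v = 0`. -/
def ofVec (v : Fin (n + 1) → ℂ) : CP n :=
  open Classical in
  if h : v ≠ 0 then Projectivization.mk ℂ v h
  else Projectivization.mk ℂ (Pi.single 0 1) (by simp)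

theorem ofVec_eq {v : Fin (n + 1) → ℂ} (h : v ≠ 0) : ofVec v = Projectivization.mk ℂ v h :=
  dif_pos h

theorem ofVec_rep (z : CP n) : ofVec z.rep = z := by
  rw [ofVec_eq z.rep_nonzero, z.mk_rep]

theorem ofVec_smul {a : ℂ} (ha : a ≠ 0) {v : Fin (n + 1) → ℂ} (hv : v ≠ 0) :
    ofVec (a • v) = ofVec v := by
  rw [ofVec_eq hv, ofVec_eq (smul_ne_zero ha hv), Projectivization.mk_eq_mk_iff']
  exact ⟨a, rfl⟩

theorem ofVec_eq_iff {v w : Fin (n + 1) → ℂ} (hv : v ≠ 0) (hw : w ≠ 0) :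
    ofVec v = ofVec w ↔ ∃ a : ℂ, a • w = v := by
  rw [ofVec_eq hv, ofVec_eq hw, Projectivization.mk_eq_mk_iff']

theorem rep_ofVec {v : Fin (n + 1) → ℂ} (hv : v ≠ 0) :
    ∃ a : ℂ, a ≠ 0 ∧ (ofVec v).rep = a • v := by
  rw [ofVec_eq hv]
  exact rep_mk v hv

variable (l : (Fin (n + 1) → ℂ) →ₗ[ℂ] ℂ)

/-- The representative of `z` with `l = 1`. -/
def normalize (z : CP n) : Fin (n + 1) → ℂ := (l z.rep)⁻¹ • z.rep

theorem normalize_ofVec {v : Fin (n + 1) → ℂ} (hv : v ≠ 0) :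
    normalize l (ofVec v) = (l v)⁻¹ • v := by
  obtain ⟨a, ha, h⟩ := rep_ofVec hv
  rw [normalize, h, map_smul, smul_eq_mul, mul_inv, smul_smul]
  congr 1
  field_simp

theorem normalize_ne_zero {z : CP n} (hz : l z.rep ≠ 0) : normalize l z ≠ 0 :=
  smul_ne_zero (inv_ne_zero hz) z.rep_nonzero

theorem ofVec_normalize {z : CP n} (hz : l z.rep ≠ 0) : ofVec (normalize l z) = z := by
  rw [normalize, ofVec_smul (inv_ne_zero hz) z.rep_nonzero, ofVec_rep]

/-- If no single coordinate is nonzero at both points, a sum of two coordinates is. Hence any two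
points lie in one affine chart, where they can be separated. -/
theorem exists_form_ne_zero (y z : CP n) :
    ∃ l : (Fin (n + 1) → ℂ) →ₗ[ℂ] ℂ, l y.rep ≠ 0 ∧ l z.rep ≠ 0 := by
  obtain ⟨i, hi⟩ := exists_rep_ne_zero y
  obtain ⟨j, hj⟩ := exists_rep_ne_zero z
  by_cases h : z.rep i = 0
  · by_cases h' : y.rep j = 0
    · refine ⟨LinearMap.proj (R := ℂ) (φ := fun _ => ℂ) i + LinearMap.proj j, ?_, ?_⟩
      · simpa [h'] using hi
      · simpa [h] using hj
    · exact ⟨LinearMap.proj j, h', hj⟩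
  · exact ⟨LinearMap.proj i, hi, h⟩

theorem continuousOn_normalize : ContinuousOn (normalize l) {z | l z.rep ≠ 0} :=
  continuousOn_pi.2 fun k => (continuousOn_div l k).congr fun z _ => by
    simp [normalize, div_eq_inv_mul]

instance instT2Space (n : ℕ) : T2Space (CP n) := by
  refine ⟨fun y z hyz => ?_⟩
  obtain ⟨l, hy, hz⟩ := exists_form_ne_zero y z
  have hne : normalize l y ≠ normalize l z := fun h => hyz <| by
    rw [← ofVec_normalize l hy, h, ofVec_normalize l hz]
  obtain ⟨U, V, hU, hV, hyU, hzV, hUV⟩ := t2_separation hne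
  have hc := continuousOn_normalize l
  exact ⟨_, _, hc.isOpen_inter_preimage (isOpen_ne_zero l) hU,
    hc.isOpen_inter_preimage (isOpen_ne_zero l) hV, ⟨hy, hyU⟩, ⟨hz, hzV⟩,
    ((hUV.preimage _).mono inter_subset_right inter_subset_right)⟩

theorem continuousAt_ofVec {v : Fin (n + 1) → ℂ} (hv : v ≠ 0) : ContinuousAt ofVec v := by
  have h : Continuous ({v : Fin (n + 1) → ℂ | v ≠ 0}.domRestrict ofVec) := by
    refine (continuous_mk (fun v : {v : Fin (n + 1) → ℂ | v ≠ 0} => v.1)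
      continuous_subtype_val fun v => v.2).congr fun v => ?_
    exact (ofVec_eq v.2).symm
  exact (continuousOn_iff_continuous_domRestrict.2 h).continuousAt (isOpen_ne.mem_nhds hv)

variable {𝕜 : Type*} [NontriviallyNormedField 𝕜] [NormedAlgebra 𝕜 ℂ] {m : WithTop ℕ∞}
  [IsManifold 𝓘(𝕜, Fin n → ℂ) m (CP n)]
  {E H M : Type*} [NormedAddCommGroup E] [NormedSpace 𝕜 E] [TopologicalSpace H]
  {I : ModelWithCorners 𝕜 E H} [TopologicalSpace M] [ChartedSpace H M]

/-- The field and the order of smoothness are left free here and below: (ℂ, ω) serves the branched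
cover, (ℝ, ∞) the symplectic cuts. -/
theorem contMDiffAt_ofVec {F : M → Fin (n + 1) → ℂ} {x : M}
    (hF : ContMDiffAt I 𝓘(𝕜, Fin (n + 1) → ℂ) m F x) (h0 : F x ≠ 0) :
    ContMDiffAt I 𝓘(𝕜, Fin n → ℂ) m (fun y => ofVec (F y)) x := by
  obtain ⟨i, hi⟩ : ∃ i, F x i ≠ 0 := by
    by_contra! h
    exact h0 (funext h)
  have hD : ContDiffAt 𝕜 m
      (fun v : Fin (n + 1) → ℂ => fun j : Fin n => v (i.succAbove j) * (v i)⁻¹) (F x) := by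
    rw [contDiffAt_pi]
    intro j
    exact (contDiff_apply 𝕜 ℂ _).contDiffAt.mul ((contDiff_apply 𝕜 ℂ i).contDiffAt.inv hi)
  have hs : ContMDiff 𝓘(𝕜, Fin n → ℂ) 𝓘(𝕜, Fin n → ℂ) m (chart (n := n) i).symm :=
    contMDiffOn_univ.1 <| contMDiffOn_symm_of_mem_maximalAtlas
      (IsManifold.subset_maximalAtlas (mem_range_self i))
  refine (hs.contMDiffAt.comp x (hD.contMDiffAt.comp x hF)).congr_of_eventuallyEq ?_
  have hc : ContinuousAt (fun y => F y i) x :=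
    (continuous_apply i).continuousAt.comp hF.continuousAt
  filter_upwards [hc.eventually_ne hi] with y hy
  have hy0 : F y ≠ 0 := fun h => hy (by simp [h])
  have hsrc : ofVec (F y) ∈ (chart (n := n) i).source := by
    rw [ofVec_eq hy0]
    exact (ne_zero_mk_iff (LinearMap.proj i) _ hy0).2 hy
  rw [← (chart (n := n) i).left_inv hsrc]
  change (chart i).symm _ = (chart i).symm _
  congr 1
  ext j
  rw [ofVec_eq hy0]
  exact (div_mk (LinearMap.proj i) _ hy0 _).trans (div_eq_mul_inv _ _)

/-- `normalize l` is a section of the projectivization over {l ≠ 0}, so smooth maps out of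
projective space can be written as smooth functions of a vector composed with it. -/
theorem contMDiffAt_normalize {z : CP n} (hz : l z.rep ≠ 0) :
    ContMDiffAt 𝓘(𝕜, Fin n → ℂ) 𝓘(𝕜, Fin (n + 1) → ℂ) m (normalize l) z := by
  obtain ⟨i, hi⟩ := exists_rep_ne_zero z
  have hins : ContDiff 𝕜 m (fun u : Fin n → ℂ => (i.insertNth (1 : ℂ) u : Fin (n + 1) → ℂ)) :=
    (contDiffOn_univ.1 (contDiffOn_insertNth i contDiffOn_const contDiffOn_id)).of_le le_top
  have hl : ContDiff 𝕜 m l :=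
    ((LinearMap.toContinuousLinearMap l).restrictScalars 𝕜).contDiff
  have hch : ContMDiffAt 𝓘(𝕜, Fin n → ℂ) 𝓘(𝕜, Fin n → ℂ) m (chart (n := n) i) z :=
    contMDiffAt_of_mem_maximalAtlas (IsManifold.subset_maximalAtlas (mem_range_self i)) hi
  have key : ∀ y : CP n, y.rep i ≠ 0 →
      ofVec (i.insertNth (1 : ℂ) (chart i y) : Fin (n + 1) → ℂ) = y := fun y hy => by
    rw [ofVec_eq (insertNth_one_ne_zero i _)]
    exact (chart (n := n) i).left_inv hy
  have hne : l (i.insertNth (1 : ℂ) (chart i z) : Fin (n + 1) → ℂ) ≠ 0 := by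
    have h0 := insertNth_one_ne_zero i (chart i z)
    rw [← ne_zero_mk_iff l _ h0, ← ofVec_eq h0, key z hi]
    exact hz
  have hD : ContDiffAt 𝕜 m (fun u : Fin n → ℂ =>
      (l (i.insertNth (1 : ℂ) u : Fin (n + 1) → ℂ))⁻¹ •
        (i.insertNth (1 : ℂ) u : Fin (n + 1) → ℂ)) (chart i z) :=
    ((hl.comp hins).contDiffAt.inv hne).smul hins.contDiffAt
  refine (hD.contMDiffAt.comp z hch).congr_of_eventuallyEq ?_
  filter_upwards [(chart (n := n) i).open_source.mem_nhds hi] with y hy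
  conv_lhs => rw [← key y hy, normalize_ofVec l (insertNth_one_ne_zero i _)]
  rfl

end CP

namespace Q

variable {n : ℕ}

/-- The point `[v]` of the quadric, with a junk value where `v` is not on the cone or zero. -/
def ofVec (v : Fin (n + 2) → ℂ) : Q n :=
  open Classical in
  if h : v ≠ 0 ∧ ∑ i, v i ^ 2 = 0 then
    ⟨Projectivization.mk ℂ v h.1, (mk_mem_quadric v h.1).2 h.2⟩
  else ⟨Projectivization.mk ℂ (point 0 0 0) (point_ne_zero _ _ _), point_mem _ _ _⟩

theorem ofVec_val {v : Fin (n + 2) → ℂ} (h : v ≠ 0) (h' : ∑ i, v i ^ 2 = 0) :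
    (ofVec v).1 = CP.ofVec v := by
  rw [ofVec, dif_pos ⟨h, h'⟩, CP.ofVec_eq h]

theorem ofVec_eq_iff {v w : Fin (n + 2) → ℂ} (hv : v ≠ 0) (hv' : ∑ i, v i ^ 2 = 0)
    (hw : w ≠ 0) (hw' : ∑ i, w i ^ 2 = 0) :
    ofVec v = ofVec w ↔ ∃ a : ℂ, a • w = v := by
  rw [← CP.ofVec_eq_iff hv hw, ← ofVec_val hv hv', ← ofVec_val hw hw', Subtype.ext_iff]

theorem ofVec_rep (z : Q n) : ofVec z.1.rep = z :=
  Subtype.ext (by rw [ofVec_val z.1.rep_nonzero z.2, CP.ofVec_rep])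

variable {𝕜 : Type*} [NontriviallyNormedField 𝕜] [NormedAlgebra 𝕜 ℂ] {m : WithTop ℕ∞}
  {E H M : Type*} [NormedAddCommGroup E] [NormedSpace 𝕜 E] [TopologicalSpace H]
  {I : ModelWithCorners 𝕜 E H} [TopologicalSpace M] [ChartedSpace H M]

theorem contDiff_point (a : Fin (n + 2)) (b : Fin (n + 1)) :
    ContDiff 𝕜 m (point a b : (Fin n → ℂ) → _) := by
  have hs : ContDiff 𝕜 ω fun u : Fin n → ℂ => ∑ j, u j ^ 2 :=
    ContDiff.sum fun j _ => (contDiff_apply 𝕜 ℂ j).pow 2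
  have h1 : ContDiff 𝕜 ω fun u : Fin n → ℂ => (1 - ∑ j, u j ^ 2) / 2 := by
    simp only [div_eq_mul_inv]
    exact (contDiff_const.sub hs).mul contDiff_const
  have h2 : ContDiff 𝕜 ω fun u : Fin n → ℂ => -Complex.I * (1 + ∑ j, u j ^ 2) / 2 := by
    simp only [div_eq_mul_inv]
    exact (contDiff_const.mul (contDiff_const.add hs)).mul contDiff_const
  exact (contDiffOn_univ.1 (contDiffOn_insertNth a h1.contDiffOn
    (contDiffOn_insertNth b h2.contDiffOn contDiffOn_id))).of_le le_top

variable [IsManifold 𝓘(𝕜, Fin n → ℂ) m (Q n)]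

theorem contMDiff_val [IsManifold 𝓘(𝕜, Fin (n + 1) → ℂ) m (CP (n + 1))] :
    ContMDiff 𝓘(𝕜, Fin n → ℂ) 𝓘(𝕜, Fin (n + 1) → ℂ) m (Subtype.val : Q n → CP (n + 1)) := by
  intro z
  obtain ⟨ab, hab⟩ := exists_form_ne_zero z
  have hch : ContMDiffAt 𝓘(𝕜, Fin n → ℂ) 𝓘(𝕜, Fin n → ℂ) m (chart ab.1 ab.2) z :=
    contMDiffAt_of_mem_maximalAtlas (IsManifold.subset_maximalAtlas (mem_range_self ab)) hab
  have h := CP.contMDiffAt_ofVec (((contDiff_point ab.1 ab.2).contMDiff.contMDiffAt).comp z hch)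
    (point_ne_zero _ _ _)
  refine h.congr_of_eventuallyEq ?_
  filter_upwards [(chart ab.1 ab.2).open_source.mem_nhds hab] with y hy
  rw [Function.comp_apply, CP.ofVec_eq (point_ne_zero _ _ _)]
  exact congrArg Subtype.val ((chart ab.1 ab.2).left_inv hy).symm

/-- The chart of the quadric on {z_a + i z_b ≠ 0} reads off entries of the vector normalized by that
form, and these are smooth on the ambient projective space. Together with `contMDiff_val` this makes
the quadric an embedded submanifold. -/
theorem contMDiffAt_of_val [IsManifold 𝓘(𝕜, Fin (n + 1) → ℂ) m (CP (n + 1))] {G : M → Q n}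
    {x : M} (hG : ContMDiffAt I 𝓘(𝕜, Fin (n + 1) → ℂ) m (fun y => (G y).1) x) :
    ContMDiffAt I 𝓘(𝕜, Fin n → ℂ) m G x := by
  obtain ⟨ab, hab⟩ := exists_form_ne_zero (G x)
  have hs : ContMDiff 𝓘(𝕜, Fin n → ℂ) 𝓘(𝕜, Fin n → ℂ) m (chart ab.1 ab.2).symm :=
    contMDiffOn_univ.1 <| contMDiffOn_symm_of_mem_maximalAtlas
      (IsManifold.subset_maximalAtlas (mem_range_self ab))
  have hD : ContDiff 𝕜 m (fun v : Fin (n + 2) → ℂ =>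
      fun j : Fin n => v (ab.1.succAbove (ab.2.succAbove j))) :=
    contDiff_pi.2 fun j => contDiff_apply 𝕜 ℂ _
  have hN := (CP.contMDiffAt_normalize (𝕜 := 𝕜) (m := m) (form ab.1 ab.2) hab).comp x hG
  refine (hs.contMDiffAt.comp x (hD.contMDiff.contMDiffAt.comp x hN)).congr_of_eventuallyEq ?_
  have hc : ContinuousAt G x := IsInducing.subtypeVal.continuousAt_iff.2 hG.continuousAt
  filter_upwards [hc.preimage_mem_nhds ((chart ab.1 ab.2).open_source.mem_nhds hab)] with y hy
  rw [← (chart ab.1 ab.2).left_inv hy]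
  simp only [Function.comp_apply]
  congr 1
  ext j
  simp [chart, CP.normalize, div_eq_inv_mul]

theorem contMDiffAt_ofVec [IsManifold 𝓘(𝕜, Fin (n + 1) → ℂ) m (CP (n + 1))]
    {F : M → Fin (n + 2) → ℂ} {x : M}
    (hF : ContMDiffAt I 𝓘(𝕜, Fin (n + 2) → ℂ) m F x) (h0 : F x ≠ 0)
    (h : ∀ᶠ y in 𝓝 x, ∑ i, F y i ^ 2 = 0) :
    ContMDiffAt I 𝓘(𝕜, Fin n → ℂ) m (fun y => ofVec (F y)) x := by
  refine contMDiffAt_of_val ((CP.contMDiffAt_ofVec hF h0).congr_of_eventuallyEq ?_)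
  filter_upwards [h, hF.continuousAt.eventually_ne h0] with y hy hy0
  exact ofVec_val hy0 hy

end Q

end

/-! ### The cotangent bundles -/

noncomputable section

section ProdLocalDiffeomorph

variable {𝕜 : Type*} [NontriviallyNormedField 𝕜]
  {E F : Type*} [NormedAddCommGroup E] [NormedSpace 𝕜 E] [NormedAddCommGroup F]
  [NormedSpace 𝕜 F] {M N : Type*} [TopologicalSpace M] [ChartedSpace E M] [TopologicalSpace N]
  [ChartedSpace F N] {m : WithTop ℕ∞}
  {E₁ H₁ W : Type*} [NormedAddCommGroup E₁] [NormedSpace 𝕜 E₁] [TopologicalSpace H₁]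
  {J : ModelWithCorners 𝕜 E₁ H₁} [TopologicalSpace W] [ChartedSpace H₁ W]
  {E₂ H₂ Y : Type*} [NormedAddCommGroup E₂] [NormedSpace 𝕜 E₂] [TopologicalSpace H₂]
  {L : ModelWithCorners 𝕜 E₂ H₂} [TopologicalSpace Y] [ChartedSpace H₂ Y]

/-- Used to push down along the double cover maps that carry an extra variable: the time of the
flow, or the complex number w of the reduction map. -/
theorem IsLocalDiffeomorphAt.contMDiffAt_of_comp_prod {f : M → N} {x : M}
    (hf : IsLocalDiffeomorphAt 𝓘(𝕜, E) 𝓘(𝕜, F) m f x) {g : N × W → Y} {w : W}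
    (hg : ContMDiffAt (𝓘(𝕜, E).prod J) L m (fun z : M × W => g (f z.1, z.2)) (x, w)) :
    ContMDiffAt (𝓘(𝕜, F).prod J) L m g (f x, w) := by
  have hx : hf.localInverse (f x) = x := hf.localInverse_left_inv hf.localInverse_mem_target
  have h1 : ContMDiffAt (𝓘(𝕜, F).prod J) (𝓘(𝕜, E).prod J) m
      (fun z : N × W => (hf.localInverse z.1, z.2)) (f x, w) :=
    (hf.localInverse_contMDiffAt.comp (f x, w) contMDiffAt_fst).prodMk contMDiffAt_snd
  have h2 := ContMDiffAt.comp (f x, w) (g := fun z : M × W => g (f z.1, z.2))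
    (f := fun z : N × W => (hf.localInverse z.1, z.2)) (by rw [hx]; exact hg) h1
  refine h2.congr_of_eventuallyEq ?_
  filter_upwards [continuousAt_fst.eventually hf.localInverse_eventuallyEq_right] with z hz
  have hz' : f (hf.localInverse z.1) = z.1 := hz
  simp only [Function.comp_apply, hz']

end ProdLocalDiffeomorph

/-! ### The geodesic circle action on the cotangent bundle of the sphere -/

namespace TS

variable {n : ℕ} {E H M : Type*} [NormedAddCommGroup E] [NormedSpace ℝ E] [TopologicalSpace H]
  {I : ModelWithCorners ℝ E H} [TopologicalSpace M] [ChartedSpace H M]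

theorem exists_sign (x : TS n) : ∃ (i : Fin (n + 1)) (ε : ℝ), ε * ε = 1 ∧ 0 < ε * x.1.1 i := by
  obtain ⟨i, hi⟩ := exists_ne_zero x
  rcases lt_or_gt_of_ne hi with h | h
  · exact ⟨i, -1, by norm_num, by linarith⟩
  · exact ⟨i, 1, by norm_num, by linarith⟩

theorem chart_mem_atlas (i : Fin (n + 1)) {ε : ℝ} (hε : ε * ε = 1) :
    chart i hε ∈ IsManifold.maximalAtlas 𝓘(ℝ, TModel n) ∞ (TS n) :=
  IsManifold.subset_maximalAtlas ⟨i, ε, hε, rfl⟩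

theorem contMDiff_val : ContMDiff 𝓘(ℝ, TModel n)
    𝓘(ℝ, (Fin (n + 1) → ℝ) × (Fin (n + 1) → ℝ)) ∞ (Subtype.val : TS n → _) := by
  intro x
  obtain ⟨i, ε, hε, hx⟩ := exists_sign x
  have h1 : ContMDiffAt 𝓘(ℝ, TModel n) 𝓘(ℝ, TModel n) ∞ (chart i hε) x :=
    contMDiffAt_of_mem_maximalAtlas (chart_mem_atlas i hε) hx
  have h2 : ContDiffAt ℝ ∞ (point i ε) (chart i hε x) :=
    ((contDiffOn_point i hε).of_le le_top).contDiffAt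
      ((isOpen_ball n).mem_nhds ((chart i hε).map_source hx))
  refine (h2.contMDiffAt.comp x h1).congr_of_eventuallyEq ?_
  filter_upwards [(chart i hε).open_source.mem_nhds hx] with y hy
  exact (point_delete i hε y hy).symm

/-- The charts only forget entries of the ambient vector, so a map into T^*S^n is smooth once it is
smooth as a map into the vector space. -/
theorem contMDiffAt_of_val {G : M → TS n} {x : M}
    (hG : ContMDiffAt I 𝓘(ℝ, (Fin (n + 1) → ℝ) × (Fin (n + 1) → ℝ)) ∞ (fun y => (G y).1) x) :
    ContMDiffAt I 𝓘(ℝ, TModel n) ∞ G x := by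
  obtain ⟨i, ε, hε, hx⟩ := exists_sign (G x)
  have h1 : ContMDiffAt 𝓘(ℝ, TModel n) 𝓘(ℝ, TModel n) ∞ (chart i hε).symm (delete i (G x).1) :=
    contMDiffAt_symm_of_mem_maximalAtlas (chart_mem_atlas i hε) ((chart i hε).map_source hx)
  have h2 : ContMDiffAt I 𝓘(ℝ, TModel n) ∞ (delete i ∘ fun y => (G y).1) x :=
    ((contDiff_delete i).of_le le_top).contMDiff.contMDiffAt.comp x hG
  refine (ContMDiffAt.comp x h1 h2).congr_of_eventuallyEq ?_
  have hc : ContinuousAt G x := IsInducing.subtypeVal.continuousAt_iff.2 hG.continuousAt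
  filter_upwards [hc.preimage_mem_nhds ((chart i hε).open_source.mem_nhds hx)] with y hy
  exact ((chart i hε).left_inv hy).symm

theorem contDiff_dotProduct {N : ℕ} :
    ContDiff ℝ ∞ fun x : (Fin N → ℝ) × (Fin N → ℝ) => x.1 ⬝ᵥ x.2 := by
  unfold dotProduct
  fun_prop

theorem contDiff_snd_dot : ContDiff ℝ ∞
    fun x : (Fin (n + 1) → ℝ) × (Fin (n + 1) → ℝ) => x.2 ⬝ᵥ x.2 :=
  contDiff_dotProduct.comp (contDiff_snd.prodMk contDiff_snd)

theorem continuous_energy : Continuous (energy : TS n → ℝ) :=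
  (contDiff_snd_dot.continuous.comp continuous_subtype_val).sqrt

theorem energy_nonneg (x : TS n) : 0 ≤ energy x := Real.sqrt_nonneg _

theorem dot_pos_of_energy_pos {x : TS n} (hx : 0 < energy x) : 0 < x.1.2 ⬝ᵥ x.1.2 := by
  rw [← energy_sq]
  positivity

theorem contDiffAt_norm_snd {x : (Fin (n + 1) → ℝ) × (Fin (n + 1) → ℝ)} (hx : 0 < x.2 ⬝ᵥ x.2) :
    ContDiffAt ℝ ∞ (fun x : (Fin (n + 1) → ℝ) × (Fin (n + 1) → ℝ) => √(x.2 ⬝ᵥ x.2)) x :=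
  contDiff_snd_dot.contDiffAt.sqrt hx.ne'

theorem contMDiffAt_energy {x : TS n} (hx : 0 < energy x) :
    ContMDiffAt 𝓘(ℝ, TModel n) 𝓘(ℝ, ℝ) ∞ energy x :=
  ((contDiffAt_norm_snd (dot_pos_of_energy_pos hx)).contMDiffAt).comp x contMDiff_val.contMDiffAt

theorem flow_val (t : ℝ) {x : TS n} (hx : 0 < energy x) :
    (flow t x).1 = (Real.cos t • x.1.1 + (Real.sin t / energy x) • x.1.2,
      Real.cos t • x.1.2 - (Real.sin t * energy x) • x.1.1) := by
  rw [flow, dif_neg hx.ne']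

theorem energy_flow (t : ℝ) (x : TS n) : energy (flow t x) = energy x := by
  rcases (energy_nonneg x).eq_or_lt with h | h
  · rw [flow, dif_pos h.symm]
  · rw [energy, ← Real.sqrt_sq h.le]
    congr 1
    rw [flow_val t h]
    have h1 := x.2.1
    have h3 : x.1.2 ⬝ᵥ x.1.1 = 0 := by rw [dotProduct_comm]; exact x.2.2
    have h4 := (energy_sq x).symm
    simp only [sub_dotProduct, dotProduct_sub, smul_dotProduct, dotProduct_smul, h1, x.2.2, h3,
      h4, smul_eq_mul]
    linear_combination (energy x) ^ 2 * Real.sin_sq_add_cos_sq t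

theorem flow_pos (t : ℝ) {x : TS n} (hx : 0 < energy x) : 0 < energy (flow t x) := by
  rwa [energy_flow]

theorem flow_zero (x : TS n) : flow 0 x = x := by
  rcases (energy_nonneg x).eq_or_lt with h | h
  · rw [flow, dif_pos h.symm]
  · exact Subtype.ext (by simp [flow_val 0 h])

theorem flow_add {x : TS n} (hx : 0 < energy x) (t t' : ℝ) :
    flow (t + t') x = flow t (flow t' x) := by
  apply Subtype.ext
  rw [flow_val _ hx, flow_val _ (flow_pos t' hx), energy_flow, flow_val _ hx, Real.cos_add,
    Real.sin_add]
  have := hx.ne'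
  ext k
  · simp
    field_simp
    ring
  · simp
    field_simp
    ring

theorem flow_two_pi {x : TS n} (hx : 0 < energy x) : flow (2 * Real.pi) x = x :=
  Subtype.ext (by simp [flow_val _ hx])

/-- Half a period is the deck transformation; this is why the period on T^*RP^n is π. -/
theorem flow_pi {x : TS n} (hx : 0 < energy x) : flow Real.pi x = antipode x :=
  Subtype.ext (by simp [flow_val _ hx, antipode, Prod.ext_iff])

theorem contMDiffAt_flow (t : ℝ) {x : TS n} (hx : 0 < energy x) :
    ContMDiffAt (𝓘(ℝ, ℝ).prod 𝓘(ℝ, TModel n)) 𝓘(ℝ, TModel n) ∞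
      (fun z : ℝ × TS n => flow z.1 z.2) (t, x) := by
  let A := (Fin (n + 1) → ℝ) × (Fin (n + 1) → ℝ)
  have h1 : ContMDiffAt (𝓘(ℝ, ℝ).prod 𝓘(ℝ, TModel n)) 𝓘(ℝ, ℝ × A) ∞
      (fun z : ℝ × TS n => (z.1, z.2.1)) (t, x) :=
    contMDiffAt_fst.prodMk_space (contMDiff_val.contMDiffAt.comp (t, x) contMDiffAt_snd)
  have hq := dot_pos_of_energy_pos hx
  have he : ContDiffAt ℝ ∞ (fun z : ℝ × A => √(z.2.2 ⬝ᵥ z.2.2)) (t, x.1) :=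
    (contDiff_snd_dot.comp contDiff_snd).contDiffAt.sqrt hq.ne'
  have hs : ContDiffAt ℝ ∞ (fun z : ℝ × A => Real.sin z.1) (t, x.1) := by fun_prop
  have hc : ContDiffAt ℝ ∞ (fun z : ℝ × A => Real.cos z.1) (t, x.1) := by fun_prop
  have hp' : ContDiffAt ℝ ∞ (fun z : ℝ × A => z.2.1) (t, x.1) := contDiffAt_snd.fst
  have hq' : ContDiffAt ℝ ∞ (fun z : ℝ × A => z.2.2) (t, x.1) := contDiffAt_snd.snd
  have h2 : ContDiffAt ℝ ∞ (fun z : ℝ × A =>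
      ((Real.cos z.1 • z.2.1 + (Real.sin z.1 / √(z.2.2 ⬝ᵥ z.2.2)) • z.2.2,
        Real.cos z.1 • z.2.2 - (Real.sin z.1 * √(z.2.2 ⬝ᵥ z.2.2)) • z.2.1) : A)) (t, x.1) :=
    ((hc.smul hp').add ((hs.div he (Real.sqrt_pos.2 hq).ne').smul hq')).prodMk
      ((hc.smul hq').sub ((hs.mul he).smul hp'))
  refine contMDiffAt_of_val ((ContMDiffAt.comp (t, x) h2.contMDiffAt h1).congr_of_eventuallyEq ?_)
  filter_upwards [((isOpen_lt continuous_const continuous_energy).preimage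
    (continuous_snd (X := ℝ))).mem_nhds (show (t, x) ∈ _ from hx)] with z hz
  exact flow_val z.1 hz

theorem mdifferentiableAt_val (x : TS n) : MDifferentiableAt 𝓘(ℝ, TModel n)
    𝓘(ℝ, (Fin (n + 1) → ℝ) × (Fin (n + 1) → ℝ)) (Subtype.val : TS n → _) x :=
  contMDiff_val.contMDiffAt.mdifferentiableAt (by simp)

/-- The derivative at `x` of the inclusion of `T^*S^n` in `ℝ^{n+1} ⊕ ℝ^{n+1}`. -/
def dval (x : TS n) : TModel n →L[ℝ] (Fin (n + 1) → ℝ) × (Fin (n + 1) → ℝ) :=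
  mfderiv 𝓘(ℝ, TModel n) 𝓘(ℝ, (Fin (n + 1) → ℝ) × (Fin (n + 1) → ℝ)) (Subtype.val : TS n → _) x

theorem form_eq (x : TS n) (u v : TModel n) :
    form x u v = (dval x u).1 ⬝ᵥ (dval x v).2 - (dval x u).2 ⬝ᵥ (dval x v).1 := rfl

theorem mfderiv_comp_val {F : Type*} [NormedAddCommGroup F] [NormedSpace ℝ F]
    {f : (Fin (n + 1) → ℝ) × (Fin (n + 1) → ℝ) → F} {x : TS n} (hf : DifferentiableAt ℝ f x.1)
    (v : TModel n) :
    (mfderiv 𝓘(ℝ, TModel n) 𝓘(ℝ, F) (fun y : TS n => f y.1) x : TModel n →L[ℝ] F) v =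
      fderiv ℝ f x.1 (dval x v) := by
  have h := mfderiv_comp x (I := 𝓘(ℝ, TModel n)) (I'' := 𝓘(ℝ, F)) hf.mdifferentiableAt
    (mdifferentiableAt_val x)
  rw [mfderiv_eq_fderiv] at h
  exact congrArg (fun L : TModel n →L[ℝ] F => L v) h

theorem fderiv_dotProduct {N : ℕ} {F : Type*} [NormedAddCommGroup F] [NormedSpace ℝ F]
    (f g : F →L[ℝ] (Fin N → ℝ)) (x v : F) :
    fderiv ℝ (fun y => f y ⬝ᵥ g y) x v = f x ⬝ᵥ g v + f v ⬝ᵥ g x := by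
  have hf : ∀ i, HasFDerivAt (fun y => f y i) ((ContinuousLinearMap.proj i).comp f) x :=
    fun i => ((ContinuousLinearMap.proj (R := ℝ) (φ := fun _ : Fin N => ℝ) i).comp f).hasFDerivAt
  have hg : ∀ i, HasFDerivAt (fun y => g y i) ((ContinuousLinearMap.proj i).comp g) x :=
    fun i => ((ContinuousLinearMap.proj (R := ℝ) (φ := fun _ : Fin N => ℝ) i).comp g).hasFDerivAt
  have h : HasFDerivAt (fun y => f y ⬝ᵥ g y) _ x :=
    HasFDerivAt.fun_sum (u := Finset.univ) fun i _ => (hf i).mul (hg i)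
  rw [h.fderiv]
  simp [dotProduct, Finset.sum_add_distrib, mul_comm]

/-- Differentiate |p|² = 1. This removes the normal component from the pairing of the form with the
flow direction. -/
theorem dot_dval (x : TS n) (v : TModel n) : x.1.1 ⬝ᵥ (dval x v).1 = 0 := by
  let A := (Fin (n + 1) → ℝ) × (Fin (n + 1) → ℝ)
  have hd : DifferentiableAt ℝ (fun y : A => y.1 ⬝ᵥ y.1) x.1 :=
    (contDiff_dotProduct.comp (contDiff_fst.prodMk contDiff_fst)).contDiffAt.differentiableAt
      (by simp : (∞ : WithTop ℕ∞) ≠ 0)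
  have h1 := mfderiv_comp_val hd v
  have h2 : (fun y : TS n => y.1.1 ⬝ᵥ y.1.1) = fun _ => (1 : ℝ) := funext fun y => y.2.1
  rw [h2, mfderiv_const] at h1
  have h3 := fderiv_dotProduct (ContinuousLinearMap.fst ℝ (Fin (n + 1) → ℝ) (Fin (n + 1) → ℝ))
    (ContinuousLinearMap.fst ℝ (Fin (n + 1) → ℝ) (Fin (n + 1) → ℝ)) x.1 (dval x v)
  simp only [ContinuousLinearMap.coe_fst'] at h3
  rw [h3, dotProduct_comm (dval x v).1] at h1
  have h4 : (0 : ℝ) = x.1.1 ⬝ᵥ (dval x v).1 + x.1.1 ⬝ᵥ (dval x v).1 := h1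
  linarith

theorem mfderiv_energy {x : TS n} (hx : 0 < energy x) (v : TModel n) :
    (mfderiv 𝓘(ℝ, TModel n) 𝓘(ℝ, ℝ) energy x : TModel n →L[ℝ] ℝ) v =
      x.1.2 ⬝ᵥ (dval x v).2 / energy x := by
  let A := (Fin (n + 1) → ℝ) × (Fin (n + 1) → ℝ)
  have hq := dot_pos_of_energy_pos hx
  have hd : DifferentiableAt ℝ (fun y : A => √(y.2 ⬝ᵥ y.2)) x.1 :=
    (contDiffAt_norm_snd hq).differentiableAt (by simp)
  have hd' : DifferentiableAt ℝ (fun y : A => y.2 ⬝ᵥ y.2) x.1 :=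
    contDiff_snd_dot.contDiffAt.differentiableAt (by simp : (∞ : WithTop ℕ∞) ≠ 0)
  have h3 := fderiv_dotProduct (ContinuousLinearMap.snd ℝ (Fin (n + 1) → ℝ) (Fin (n + 1) → ℝ))
    (ContinuousLinearMap.snd ℝ (Fin (n + 1) → ℝ) (Fin (n + 1) → ℝ)) x.1 (dval x v)
  simp only [ContinuousLinearMap.coe_snd'] at h3
  refine (mfderiv_comp_val hd v).trans ?_
  rw [fderiv_sqrt hd' hq.ne']
  simp only [smul_apply, smul_eq_mul]
  rw [h3, dotProduct_comm (dval x v).2]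
  change 1 / (2 * energy x) * _ = _
  field_simp
  ring

theorem dval_mfderiv_flow {x : TS n} (hx : 0 < energy x) (t : ℝ) :
    dval (flow t x) (mfderiv 𝓘(ℝ, ℝ) 𝓘(ℝ, TModel n) (fun τ => flow τ x) t (1 : ℝ)) =
      ((1 / energy x) • (flow t x).1.2, -(energy x) • (flow t x).1.1) := by
  have hfl : MDifferentiableAt 𝓘(ℝ, ℝ) 𝓘(ℝ, TModel n) (fun τ => flow τ x) t := by
    have := (contMDiffAt_flow t hx).comp t (contMDiffAt_id.prodMk contMDiffAt_const)
    exact this.mdifferentiableAt (by simp)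
  have h := mfderiv_comp t (mdifferentiableAt_val (flow t x)) hfl
  have h' := congrArg (fun L : ℝ →L[ℝ] (Fin (n + 1) → ℝ) × (Fin (n + 1) → ℝ) => L 1) h
  refine Eq.trans h'.symm ?_
  have hcomp : (Subtype.val ∘ fun τ => flow τ x) = fun τ => ((Real.cos τ • x.1.1 +
      (Real.sin τ / energy x) • x.1.2, Real.cos τ • x.1.2 - (Real.sin τ * energy x) • x.1.1) :
      (Fin (n + 1) → ℝ) × (Fin (n + 1) → ℝ)) := funext fun τ => flow_val τ hx
  rw [mfderiv_eq_fderiv, hcomp]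
  have hder : HasDerivAt (fun τ => ((Real.cos τ • x.1.1 +
      (Real.sin τ / energy x) • x.1.2, Real.cos τ • x.1.2 - (Real.sin τ * energy x) • x.1.1) :
      (Fin (n + 1) → ℝ) × (Fin (n + 1) → ℝ)))
      ((-Real.sin t) • x.1.1 + (Real.cos t / energy x) • x.1.2,
        (-Real.sin t) • x.1.2 - (Real.cos t * energy x) • x.1.1) t := by
    have hs := Real.hasDerivAt_sin t
    have hc := Real.hasDerivAt_cos t
    exact ((hc.smul_const x.1.1).add ((hs.div_const (energy x)).smul_const x.1.2)).prodMk
      ((hc.smul_const x.1.2).sub ((hs.mul_const (energy x)).smul_const x.1.1))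
  refine (fderiv_apply_one_eq_deriv (f := fun τ => _)).trans (hder.deriv.trans ?_)
  rw [flow_val t hx]
  have := hx.ne'
  ext k
  · simp
    field_simp
    ring
  · simp
    field_simp
    ring

/-- The velocity of the flow is (q/|q|, -|q| p). Paired with v it gives q·v_q/|q| + |q| p·v_p; the
second term vanishes by `dot_dval`, and the first is the derivative of |q|. -/
theorem hamiltonian {x : TS n} (hx : 0 < energy x) (t : ℝ) (v : TModel n) :
    form (flow t x) (mfderiv 𝓘(ℝ, ℝ) 𝓘(ℝ, TModel n) (fun τ => flow τ x) t (1 : ℝ)) v =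
      (mfderiv 𝓘(ℝ, TModel n) 𝓘(ℝ, ℝ) energy (flow t x) : TModel n →L[ℝ] ℝ) v := by
  have key : ∀ w : TModel n, dval (flow t x) w =
      ((1 / energy x) • (flow t x).1.2, -(energy x) • (flow t x).1.1) →
      form (flow t x) w v = (flow t x).1.2 ⬝ᵥ (dval (flow t x) v).2 / energy x := by
    intro w hw
    have h := dot_dval (flow t x) v
    rw [form_eq, hw]
    simp only [smul_dotProduct, h, smul_eq_mul]
    ring
  rw [mfderiv_energy (flow_pos t hx), energy_flow]
  exact key _ (dval_mfderiv_flow hx t)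

/-- Pair the equation with the orthonormal vectors p and q. The case a = 1 gives freeness on T^*S^n,
and the cases a = ±1 give it on the quotient. -/
theorem sin_eq_zero_of_flow {x : TS n} (hx : energy x = 1) {t : ℝ} {a : ℝ}
    (h : (flow t x).1.1 = a • x.1.1) : Real.sin t = 0 ∧ Real.cos t = a := by
  have hpos : 0 < energy x := by rw [hx]; exact one_pos
  rw [flow_val t hpos, hx, div_one] at h
  have hq : x.1.2 ⬝ᵥ x.1.2 = 1 := by rw [← energy_sq, hx, one_pow]
  have h3 : x.1.2 ⬝ᵥ x.1.1 = 0 := by rw [dotProduct_comm]; exact x.2.2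
  have e1 := congrArg (fun v => x.1.1 ⬝ᵥ v) h
  have e2 := congrArg (fun v => x.1.2 ⬝ᵥ v) h
  simp only [dotProduct_add, dotProduct_smul, x.2.1, x.2.2, hq, h3, smul_eq_mul] at e1 e2
  constructor <;> linarith

theorem isHamiltonianCircleAction (n : ℕ) :
    IsHamiltonianCircleAction TS.form {x : TS n | 0 < TS.energy x} TS.energy TS.flow
      (2 * Real.pi) 1 where
  isOpen := isOpen_lt continuous_const continuous_energy
  continuous := continuous_energy
  contMDiffOn _ hx := (contMDiffAt_energy hx).contMDiffWithinAt
  level_subset x hx := by simp [hx]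
  mapsTo t x hx := flow_pos t hx
  zero x _ := flow_zero x
  add x hx t t' := flow_add hx t t'
  contMDiffOn_flow z hz := (contMDiffAt_flow z.1 hz.2).contMDiffWithinAt
  hamiltonian x hx t v := hamiltonian hx t v
  period_pos := by positivity
  period x hx := flow_two_pi hx
  free x hx t h := by
    have h1 := (sin_eq_zero_of_flow hx (t := t) (a := 1) (by rw [h, one_smul])).2
    obtain ⟨k, hk⟩ := (Real.cos_eq_one_iff t).1 h1
    exact ⟨k, hk.symm⟩

end TS

end

/-! ### The symplectic double cover -/

noncomputable section

namespace TRP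

variable {n : ℕ}

theorem cover_eq_iff {x y : TS n} : cover n x = cover n y ↔ y = x ∨ y = TS.antipode x :=
  ⟨fun h => Quotient.exact h, fun h => Quotient.sound h⟩

theorem energy_cover (x : TS n) : energy (cover n x) = TS.energy x := rfl

theorem flow_cover (t : ℝ) (x : TS n) : flow t (cover n x) = cover n (TS.flow t x) := rfl

theorem antipode_ne (x : TS n) : TS.antipode x ≠ x := fun h => by
  obtain ⟨i, hi⟩ := TS.exists_ne_zero x
  have h1 : -x.1.1 i = x.1.1 i := congrArg (fun y : TS n => y.1.1 i) h
  exact hi (by linarith)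

theorem signedDelete_eq (i : Fin (n + 1)) {ε : ℝ} (hε : ε * ε = 1) {x : TS n}
    (hx : 0 < ε * x.1.1 i) : signedDelete i x = ε • TS.delete i x.1 := by
  rcases mul_self_eq_one_iff.1 hε with rfl | rfl
  · rw [one_mul] at hx
    rw [signedDelete_of_pos i x hx, one_smul]
  · have hx' : x.1.1 i < 0 := by linarith
    rw [signedDelete, abs_of_neg hx', div_neg, div_self hx'.ne]

theorem exists_rep_sign (i : Fin (n + 1)) {ε : ℝ} (hε : ε * ε = 1) {y : TRP n}
    (hy : y ∈ chartSource i) : ∃ x : TS n, 0 < ε * x.1.1 i ∧ cover n x = y := by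
  obtain ⟨x, hx, rfl⟩ := exists_rep i hy
  rcases mul_self_eq_one_iff.1 hε with rfl | rfl
  · exact ⟨x, by linarith, rfl⟩
  · exact ⟨TS.antipode x, by simpa [TS.antipode] using hx, cover_antipode x⟩

theorem lift_signedDelete (i : Fin (n + 1)) {ε : ℝ} (hε : ε * ε = 1) {x : TS n}
    (hx : 0 < ε * x.1.1 i) : TS.lift i hε (ε • signedDelete i x) = x := by
  rw [signedDelete_eq i hε hx, smul_smul, hε, one_smul]
  exact (TS.chart i hε).left_inv hx

theorem chart_mem_atlas (i : Fin (n + 1)) :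
    chart i ∈ IsManifold.maximalAtlas 𝓘(ℝ, TModel n) ∞ (TRP n) :=
  IsManifold.subset_maximalAtlas (mem_range_self i)

/-- On a hemisphere of sign ε the cover is, in the charts, multiplication by ε. -/
theorem isLocalDiffeomorph_cover (n : ℕ) :
    IsLocalDiffeomorph 𝓘(ℝ, TModel n) 𝓘(ℝ, TModel n) ∞ (cover n) := by
  intro x
  obtain ⟨i, ε, hε, hx⟩ := TS.exists_sign x
  have hne : ∀ y : TS n, 0 < ε * y.1.1 i → y.1.1 i ≠ 0 := fun y hy h => by simp [h] at hy
  refine isLocalDiffeomorphAt_of_inverse (U := (TS.chart i hε).source) (W := (chart i).source)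
    (g := fun y => (TS.chart i hε).symm (ε • chart i y))
    (TS.chart i hε).open_source (chart i).open_source hx ?_ ?_ ?_ ?_ ?_
  · intro y hy
    exact (cover_mem_chartSource i y).2 (hne y hy)
  · have h1 : ContMDiffOn 𝓘(ℝ, TModel n) 𝓘(ℝ, TModel n) ∞
        (fun y => ε • TS.chart i hε y) (TS.chart i hε).source :=
      (contDiff_id.const_smul ε).contMDiff.comp_contMDiffOn
        (contMDiffOn_of_mem_maximalAtlas (TS.chart_mem_atlas i hε))
    have h2 : ∀ y ∈ (TS.chart i hε).source, chart i (cover n y) = ε • TS.chart i hε y :=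
      fun y hy => signedDelete_eq i hε hy
    refine ((contMDiffOn_symm_of_mem_maximalAtlas (chart_mem_atlas i)).comp h1
      fun y hy => ?_).congr fun y hy => ?_
    · rw [mem_preimage, ← h2 y hy]
      exact (chart i).map_source ((cover_mem_chartSource i y).2 (hne y hy))
    · rw [Function.comp_apply, ← h2 y hy]
      exact ((chart i).left_inv ((cover_mem_chartSource i y).2 (hne y hy))).symm
  · have h1 : ContMDiffOn 𝓘(ℝ, TModel n) 𝓘(ℝ, TModel n) ∞
        (fun y => ε • chart i y) (chart (n := n) i).source :=
      (contDiff_id.const_smul ε).contMDiff.comp_contMDiffOn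
        (contMDiffOn_of_mem_maximalAtlas (chart_mem_atlas i))
    refine (contMDiffOn_symm_of_mem_maximalAtlas (TS.chart_mem_atlas i hε)).comp h1 fun y hy => ?_
    obtain ⟨x', hx', rfl⟩ := exists_rep_sign i hε hy
    change ε • signedDelete i x' ∈ (TS.chart i hε).target
    rw [signedDelete_eq i hε hx', smul_smul, hε, one_smul]
    exact (TS.chart i hε).map_source hx'
  · intro y hy
    exact lift_signedDelete i hε hy
  · intro y hy
    obtain ⟨x', hx', rfl⟩ := exists_rep_sign i hε hy
    exact congrArg (cover n) (lift_signedDelete i hε hx')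

theorem preimage_cover (x : TS n) : cover n ⁻¹' {cover n x} = {x, TS.antipode x} := by
  ext y
  rw [mem_preimage, mem_singleton_iff, eq_comm, cover_eq_iff]
  rfl

/-- The saturation of a closed set is its union with its antipodal image. Closedness upgrades a
local homeomorphism with finite fibres to a covering. -/
theorem isClosedMap_cover (n : ℕ) : IsClosedMap (cover n) := by
  intro C hC
  rw [← (isQuotientMap_cover n).isClosed_preimage]
  have : cover n ⁻¹' (cover n '' C) = C ∪ TS.antipode ⁻¹' C := by
    ext x
    constructor
    · rintro ⟨y, hy, hxy⟩
      rcases cover_eq_iff.1 hxy with rfl | rfl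
      · exact Or.inl hy
      · right
        rwa [mem_preimage, TS.antipode_antipode]
    · rintro (h | h)
      · exact ⟨x, h, rfl⟩
      · exact ⟨_, h, cover_antipode x⟩
  rw [this]
  exact hC.union (hC.preimage TS.continuous_antipode)

theorem contMDiff_antipode (n : ℕ) :
    ContMDiff 𝓘(ℝ, TModel n) 𝓘(ℝ, TModel n) ∞ (TS.antipode (n := n)) := fun x =>
  TS.contMDiffAt_of_val
    (contDiff_neg.contMDiff.contMDiffAt.comp x TS.contMDiff_val.contMDiffAt)

/-- The derivative of the double cover. -/
def dcover (x : TS n) : TModel n →L[ℝ] TModel n :=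
  mfderiv 𝓘(ℝ, TModel n) 𝓘(ℝ, TModel n) (cover n) x

/-- The derivative of the antipodal map. -/
def dantipode (x : TS n) : TModel n →L[ℝ] TModel n :=
  mfderiv 𝓘(ℝ, TModel n) 𝓘(ℝ, TModel n) (TS.antipode (n := n)) x

theorem isInvertible_dcover (x : TS n) : (dcover x).IsInvertible :=
  ⟨(isLocalDiffeomorph_cover n x).mfderivToContinuousLinearEquiv (by simp), rfl⟩

theorem dcover_eq_comp (x : TS n) :
    dcover x = (dcover (TS.antipode x)).comp (dantipode x) := by
  have h := mfderiv_comp x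
    ((isLocalDiffeomorph_cover n (TS.antipode x)).mdifferentiableAt (by simp))
    ((contMDiff_antipode n).contMDiffAt.mdifferentiableAt (by simp))
  have h' : cover n ∘ TS.antipode = cover n := funext cover_antipode
  rw [h'] at h
  exact h

theorem dval_dantipode (x : TS n) (u : TModel n) :
    TS.dval (TS.antipode x) (dantipode x u) = -TS.dval x u := by
  have h := mfderiv_comp x (TS.mdifferentiableAt_val (TS.antipode x))
    ((contMDiff_antipode n).contMDiffAt.mdifferentiableAt (by simp))
  have h2 := congrArg (fun L : TModel n →L[ℝ] (Fin (n + 1) → ℝ) × (Fin (n + 1) → ℝ) => L u) h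
  refine Eq.trans h2.symm ?_
  have h3 := TS.mfderiv_comp_val (n := n) (x := x) (f := fun z => -z)
    (by fun_prop) u
  have h4 : fderiv ℝ (fun z : (Fin (n + 1) → ℝ) × (Fin (n + 1) → ℝ) => -z) x.1 (TS.dval x u) =
      -TS.dval x u := by
    have h5 := (hasFDerivAt_id (𝕜 := ℝ) x.1).neg.fderiv
    exact congrArg (fun L => L (TS.dval x u)) h5
  exact Eq.trans h3 h4

/-- The antipodal map negates both embedded tangent vectors, and the form is bilinear. -/
theorem form_antipode (x : TS n) (u v : TModel n) :
    TS.form (TS.antipode x) (dantipode x u) (dantipode x v) = TS.form x u v := by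
  rw [TS.form_eq, TS.form_eq, dval_dantipode, dval_dantipode]
  simp

theorem form_eq (y : TRP n) (u v : TModel n) :
    form y u v = TS.form (Quotient.out y) ((dcover (Quotient.out y)).inverse u)
      ((dcover (Quotient.out y)).inverse v) := rfl

/-- `TRP.form` is evaluated at a chosen representative of the class, which may be `x` or its
antipode; the second case needs the invariance of the form. -/
theorem form_cover (x : TS n) (u v : TModel n) :
    form (cover n x) (dcover x u) (dcover x v) = TS.form x u v := by
  rw [form_eq]
  have key : ∀ x' : TS n, x' = x ∨ x' = TS.antipode x →
      TS.form x' ((dcover x').inverse (dcover x u)) ((dcover x').inverse (dcover x v)) =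
        TS.form x u v := by
    rintro x' (rfl | rfl)
    · rw [(isInvertible_dcover x').inverse_apply_eq.2 rfl,
        (isInvertible_dcover x').inverse_apply_eq.2 rfl]
    · rw [(isInvertible_dcover (TS.antipode x)).inverse_apply_eq.2
          (show dcover x u = _ from congrArg (fun L => L u) (dcover_eq_comp x)),
        (isInvertible_dcover (TS.antipode x)).inverse_apply_eq.2
          (show dcover x v = _ from congrArg (fun L => L v) (dcover_eq_comp x))]
      exact form_antipode x u v
  exact key _ (cover_eq_iff.1 (Quotient.out_eq (cover n x)).symm)

theorem isSymplecticDoubleCover (n : ℕ) :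
    IsSymplecticDoubleCover (cover n) TS.form TRP.form where
  isCoveringMap := by
    rw [isCoveringMap_iff_isCoveringMapOn_univ]
    refine (isClosedMap_cover n).isCoveringMapOn_of_isLocalHomeomorphOn (fun y _ => ?_) ?_
    · obtain ⟨x, rfl⟩ := cover_surjective n y
      rw [preimage_cover]
      exact toFinite _
    · exact ((isLocalDiffeomorph_cover n).isLocalDiffeomorphOn _).isLocalHomeomorphOn
  ncard_fiber y := by
    obtain ⟨x, rfl⟩ := cover_surjective n y
    rw [preimage_cover, ncard_pair (antipode_ne x).symm]
  isLocalDiffeomorph := isLocalDiffeomorph_cover n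
  pullback x u v := form_cover x u v

theorem continuous_energy : Continuous (energy : TRP n → ℝ) :=
  (isQuotientMap_cover n).continuous_iff.2 TS.continuous_energy

theorem contMDiffAt_energy {x : TS n} (hx : 0 < TS.energy x) :
    ContMDiffAt 𝓘(ℝ, TModel n) 𝓘(ℝ, ℝ) ∞ (energy : TRP n → ℝ) (cover n x) :=
  (isLocalDiffeomorph_cover n x).contMDiffAt_of_comp (TS.contMDiffAt_energy hx)

theorem contMDiffAt_flow (t : ℝ) {x : TS n} (hx : 0 < TS.energy x) :
    ContMDiffAt (𝓘(ℝ, ℝ).prod 𝓘(ℝ, TModel n)) 𝓘(ℝ, TModel n) ∞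
      (fun z : ℝ × TRP n => flow z.1 z.2) (t, cover n x) := by
  have h1 : ContMDiffAt (𝓘(ℝ, TModel n).prod 𝓘(ℝ, ℝ)) 𝓘(ℝ, TModel n) ∞
      (fun z : TS n × ℝ => cover n (TS.flow z.2 z.1)) (x, t) :=
    (isLocalDiffeomorph_cover n).contMDiff.contMDiffAt.comp (x, t)
      ((TS.contMDiffAt_flow t hx).comp (x, t) (contMDiffAt_snd.prodMk contMDiffAt_fst))
  have h2 := (isLocalDiffeomorph_cover n x).contMDiffAt_of_comp_prod
    (g := fun z : TRP n × ℝ => flow z.2 z.1) h1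
  exact h2.comp (t, cover n x) (contMDiffAt_snd.prodMk contMDiffAt_fst)

/-- The cover intertwines the forms, the flows and the energies, and its derivative is onto, so
Hamilton's equation descends. -/
theorem hamiltonian {x : TS n} (hx : 0 < TS.energy x) (t : ℝ) (v : TModel n) :
    form (flow t (cover n x))
      (mfderiv 𝓘(ℝ, ℝ) 𝓘(ℝ, TModel n) (fun τ => flow τ (cover n x)) t (1 : ℝ)) v =
      (mfderiv 𝓘(ℝ, TModel n) 𝓘(ℝ, ℝ) energy (flow t (cover n x)) : TModel n →L[ℝ] ℝ) v := by
  obtain ⟨v', rfl⟩ : ∃ v', dcover (TS.flow t x) v' = v :=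
    ((isLocalDiffeomorph_cover n (TS.flow t x)).mfderivToContinuousLinearEquiv
      (by simp)).surjective v
  have hc := (isLocalDiffeomorph_cover n (TS.flow t x)).mdifferentiableAt
    (by simp : (∞ : WithTop ℕ∞) ≠ 0)
  have hfl : MDifferentiableAt 𝓘(ℝ, ℝ) 𝓘(ℝ, TModel n) (fun τ => TS.flow τ x) t :=
    ((TS.contMDiffAt_flow t hx).comp t
      (contMDiffAt_id.prodMk contMDiffAt_const)).mdifferentiableAt (by simp)
  have h1 := mfderiv_comp t hc hfl
  have h2 := mfderiv_comp (TS.flow t x)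
    ((contMDiffAt_energy (TS.flow_pos t hx)).mdifferentiableAt (by simp)) hc
  have h3 : (mfderiv 𝓘(ℝ, ℝ) 𝓘(ℝ, TModel n) (fun τ => flow τ (cover n x)) t : ℝ →L[ℝ] TModel n) 1 =
      dcover (TS.flow t x) ((mfderiv 𝓘(ℝ, ℝ) 𝓘(ℝ, TModel n) (fun τ => TS.flow τ x) t :
        ℝ →L[ℝ] TModel n) 1) := congrArg (fun L : ℝ →L[ℝ] TModel n => L 1) h1
  have h4 : (mfderiv 𝓘(ℝ, TModel n) 𝓘(ℝ, ℝ) TS.energy (TS.flow t x) : TModel n →L[ℝ] ℝ) v' =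
      (mfderiv 𝓘(ℝ, TModel n) 𝓘(ℝ, ℝ) energy (cover n (TS.flow t x)) : TModel n →L[ℝ] ℝ)
        (dcover (TS.flow t x) v') := congrArg (fun L : TModel n →L[ℝ] ℝ => L v') h2
  have key : ∀ w w' : TModel n, w = dcover (TS.flow t x) w' →
      form (cover n (TS.flow t x)) w (dcover (TS.flow t x) v') =
        TS.form (TS.flow t x) w' v' := by
    rintro _ w' rfl
    exact form_cover _ _ _
  exact (key _ _ h3).trans ((TS.hamiltonian hx t v').trans h4)

theorem isHamiltonianCircleAction (n : ℕ) :
    IsHamiltonianCircleAction TRP.form {x : TRP n | 0 < TRP.energy x} TRP.energy TRP.flow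
      Real.pi 1 where
  isOpen := isOpen_lt continuous_const continuous_energy
  continuous := continuous_energy
  contMDiffOn y hy := by
    obtain ⟨x, rfl⟩ := cover_surjective n y
    exact (contMDiffAt_energy hy).contMDiffWithinAt
  level_subset x hx := by simp [hx]
  mapsTo t y hy := by
    obtain ⟨x, rfl⟩ := cover_surjective n y
    exact TS.flow_pos t hy
  zero y _ := by
    obtain ⟨x, rfl⟩ := cover_surjective n y
    rw [flow_cover, TS.flow_zero]
  add y hy t t' := by
    obtain ⟨x, rfl⟩ := cover_surjective n y
    rw [flow_cover, flow_cover, flow_cover, TS.flow_add hy]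
  contMDiffOn_flow z hz := by
    obtain ⟨t, y⟩ := z
    obtain ⟨x, rfl⟩ := cover_surjective n y
    exact (contMDiffAt_flow t hz.2).contMDiffWithinAt
  hamiltonian y hy t v := by
    obtain ⟨x, rfl⟩ := cover_surjective n y
    exact hamiltonian hy t v
  period_pos := Real.pi_pos
  period y hy := by
    obtain ⟨x, rfl⟩ := cover_surjective n y
    rw [flow_cover, TS.flow_pi hy, cover_antipode]
  free y hy t h := by
    obtain ⟨x, rfl⟩ := cover_surjective n y
    rw [flow_cover, eq_comm, cover_eq_iff] at h
    have h0 : Real.sin t = 0 := by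
      rcases h with h | h
      · exact (TS.sin_eq_zero_of_flow hy (t := t) (a := 1) (by rw [h, one_smul])).1
      · exact (TS.sin_eq_zero_of_flow hy (t := t) (a := -1)
          (by rw [h]; simp [TS.antipode])).1
    obtain ⟨k, hk⟩ := Real.sin_eq_zero_iff.1 h0
    exact ⟨k, hk.symm⟩

end TRP

end

/-! ### The branched double cover of projective space by the quadric -/

noncomputable section

theorem CP.ofVec_mem_quadric {N : ℕ} {v : Fin (N + 1) → ℂ} (hv : v ≠ 0) :
    CP.ofVec v ∈ quadric N ↔ ∑ i, v i ^ 2 = 0 := by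
  rw [CP.ofVec_eq hv, Q.mk_mem_quadric]

instance CP.instCompactSpace (n : ℕ) : CompactSpace (CP n) := by
  have hs : ∀ v : Metric.sphere (0 : Fin (n + 1) → ℂ) 1, v.1 ≠ 0 := fun v h => by
    have := v.2
    simp [h] at this
  have hc : Continuous fun v : Metric.sphere (0 : Fin (n + 1) → ℂ) 1 => CP.ofVec v.1 :=
    continuous_iff_continuousAt.2 fun v =>
      (CP.continuousAt_ofVec (hs v)).comp continuous_subtype_val.continuousAt
  have hr : range (fun v : Metric.sphere (0 : Fin (n + 1) → ℂ) 1 => CP.ofVec v.1) = univ := by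
    refine eq_univ_of_forall fun z => ?_
    have h0 : (‖z.rep‖ : ℂ) ≠ 0 := by
      exact_mod_cast norm_ne_zero_iff.2 z.rep_nonzero
    refine ⟨⟨(‖z.rep‖ : ℂ)⁻¹ • z.rep, ?_⟩, ?_⟩
    · rw [mem_sphere_zero_iff_norm, norm_smul, norm_inv, Complex.norm_real, norm_norm]
      exact inv_mul_cancel₀ (norm_ne_zero_iff.2 z.rep_nonzero)
    · exact (CP.ofVec_smul (inv_ne_zero h0) z.rep_nonzero).trans (CP.ofVec_rep z)
  exact ⟨hr ▸ isCompact_range hc⟩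

theorem isClosed_quadric (N : ℕ) : IsClosed (quadric N) := by
  rw [← (CP.isQuotientMap_mk' N).isClosed_preimage]
  have : Projectivization.mk' ℂ ⁻¹' quadric N =
      {v : {v : Fin (N + 1) → ℂ // v ≠ 0} | ∑ i, v.1 i ^ 2 = 0} := by
    ext v
    exact Q.mk_mem_quadric v.1 v.2
  rw [this]
  exact isClosed_eq (continuous_finsetSum _ fun i _ =>
    ((continuous_apply i).comp continuous_subtype_val).pow 2) continuous_const

namespace Q

instance instCompactSpace (n : ℕ) : CompactSpace (Q n) :=
  isCompact_iff_compactSpace.1 (isClosed_quadric (n + 1)).isCompact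

variable {n : ℕ}

/-- The vector with last entry `ζ` and other entries `Z`. -/
def vec (Z : Fin (n + 1) → ℂ) (ζ : ℂ) : Fin (n + 2) → ℂ := Fin.snoc (α := fun _ => ℂ) Z ζ

@[simp]
theorem vec_castSucc (Z : Fin (n + 1) → ℂ) (ζ : ℂ) (i : Fin (n + 1)) :
    vec Z ζ i.castSucc = Z i := Fin.snoc_castSucc (α := fun _ => ℂ) _ _ _

@[simp]
theorem vec_last (Z : Fin (n + 1) → ℂ) (ζ : ℂ) : vec Z ζ (Fin.last (n + 1)) = ζ :=
  Fin.snoc_last (α := fun _ => ℂ) _ _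

theorem vec_init (v : Fin (n + 2) → ℂ) :
    vec (fun i => v i.castSucc) (v (Fin.last (n + 1))) = v := by
  ext k
  induction k using Fin.lastCases with
  | last => simp
  | cast i => simp

theorem sum_vec (Z : Fin (n + 1) → ℂ) (ζ : ℂ) :
    ∑ i, vec Z ζ i ^ 2 = ∑ i, Z i ^ 2 + ζ ^ 2 := by
  simp [Fin.sum_univ_castSucc]

theorem smul_vec (a : ℂ) (Z : Fin (n + 1) → ℂ) (ζ : ℂ) : a • vec Z ζ = vec (a • Z) (a * ζ) := by
  ext k
  induction k using Fin.lastCases with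
  | last => simp
  | cast i => simp

theorem vec_eq_iff {Z Z' : Fin (n + 1) → ℂ} {ζ ζ' : ℂ} :
    vec Z ζ = vec Z' ζ' ↔ Z = Z' ∧ ζ = ζ' := by
  refine ⟨fun h => ⟨funext fun i => ?_, ?_⟩, fun h => by rw [h.1, h.2]⟩
  · simpa using congrFun h i.castSucc
  · simpa using congrFun h (Fin.last (n + 1))

theorem vec_ne_zero {Z : Fin (n + 1) → ℂ} (hZ : Z ≠ 0) (ζ : ℂ) : vec Z ζ ≠ 0 := fun h =>
  hZ (funext fun i => by simpa using congrFun h i.castSucc)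

theorem contDiff_vec {𝕜 : Type*} [NontriviallyNormedField 𝕜] [NormedAlgebra 𝕜 ℂ]
    {m : WithTop ℕ∞} : ContDiff 𝕜 m fun p : (Fin (n + 1) → ℂ) × ℂ => vec p.1 p.2 := by
  rw [contDiff_pi]
  intro k
  induction k using Fin.lastCases with
  | last => simpa using contDiff_snd
  | cast i => simpa [Function.comp_def] using (contDiff_apply 𝕜 ℂ i).comp contDiff_fst

/-- The point `[Z : ζ]` of the quadric. -/
def pt (Z : Fin (n + 1) → ℂ) (ζ : ℂ) : Q n := ofVec (vec Z ζ)

theorem pt_eq_iff {Z Z' : Fin (n + 1) → ℂ} {ζ ζ' : ℂ} (hZ : Z ≠ 0) (h : ∑ i, Z i ^ 2 + ζ ^ 2 = 0)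
    (hZ' : Z' ≠ 0) (h' : ∑ i, Z' i ^ 2 + ζ' ^ 2 = 0) :
    pt Z ζ = pt Z' ζ' ↔ ∃ a : ℂ, a • Z' = Z ∧ a * ζ' = ζ := by
  rw [pt, pt, ofVec_eq_iff (vec_ne_zero hZ ζ) (by rw [sum_vec, h]) (vec_ne_zero hZ' ζ')
    (by rw [sum_vec, h'])]
  simp only [smul_vec, vec_eq_iff]

theorem proj_ofVec {v : Fin (n + 2) → ℂ} (hv : v ≠ 0) (h : ∑ i, v i ^ 2 = 0) :
    proj n (ofVec v) = CP.ofVec fun i => v i.castSucc := by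
  obtain ⟨a, ha, hr⟩ := CP.rep_ofVec hv
  rw [proj, ← CP.ofVec_eq]
  have h0 : (fun i : Fin (n + 1) => v i.castSucc) ≠ 0 := by
    have h1 := init_ne_zero (ofVec v)
    rw [ofVec_val hv h, hr] at h1
    intro h2
    refine h1 (funext fun i => ?_)
    have := congrFun h2 i
    simp only [Pi.zero_apply] at this
    simp [this]
  rw [← CP.ofVec_smul ha h0]
  congr 1
  ext i
  rw [ofVec_val hv h, hr]
  rfl

theorem proj_pt {Z : Fin (n + 1) → ℂ} {ζ : ℂ} (hZ : Z ≠ 0) (h : ∑ i, Z i ^ 2 + ζ ^ 2 = 0) :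
    proj n (pt Z ζ) = CP.ofVec Z := by
  rw [pt, proj_ofVec (vec_ne_zero hZ ζ) (by rw [sum_vec, h])]
  simp

theorem exists_pt (x : Q n) :
    ∃ (Z : Fin (n + 1) → ℂ) (ζ : ℂ), Z ≠ 0 ∧ ∑ i, Z i ^ 2 + ζ ^ 2 = 0 ∧ pt Z ζ = x := by
  refine ⟨fun i => x.1.rep i.castSucc, x.1.rep (Fin.last (n + 1)), init_ne_zero x, ?_, ?_⟩
  · rw [← sum_vec, vec_init]
    exact x.2
  · rw [pt, vec_init, ofVec_rep]

theorem pt_smul {a : ℂ} (ha : a ≠ 0) {Z : Fin (n + 1) → ℂ} {ζ : ℂ} (hZ : Z ≠ 0)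
    (h : ∑ i, Z i ^ 2 + ζ ^ 2 = 0) : pt (a • Z) (a * ζ) = pt Z ζ := by
  rw [pt_eq_iff (smul_ne_zero ha hZ) _ hZ h]
  · exact ⟨a, rfl, rfl⟩
  · simp only [Pi.smul_apply, smul_eq_mul, mul_pow, ← Finset.mul_sum]
    linear_combination a ^ 2 * h

/-- The points of the quadric over a point of projective space differ by the sign of the last
coordinate. -/
theorem proj_pt_eq_iff {Z Z' : Fin (n + 1) → ℂ} {ζ ζ' : ℂ} (hZ : Z ≠ 0)
    (h : ∑ i, Z i ^ 2 + ζ ^ 2 = 0) (hZ' : Z' ≠ 0) (h' : ∑ i, Z' i ^ 2 + ζ' ^ 2 = 0) :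
    proj n (pt Z ζ) = proj n (pt Z' ζ') ↔ pt Z ζ = pt Z' ζ' ∨ pt Z ζ = pt Z' (-ζ') := by
  have h'' : ∑ i, Z' i ^ 2 + (-ζ') ^ 2 = 0 := by rw [neg_sq, h']
  constructor
  · intro hp
    rw [proj_pt hZ h, proj_pt hZ' h', CP.ofVec_eq_iff hZ hZ'] at hp
    obtain ⟨a, rfl⟩ := hp
    have hs : ζ ^ 2 = (a * ζ') ^ 2 := by
      simp only [Pi.smul_apply, smul_eq_mul, mul_pow, ← Finset.mul_sum] at h
      linear_combination h - a ^ 2 * h'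
    rcases sq_eq_sq_iff_eq_or_eq_neg.1 hs with rfl | rfl
    · exact Or.inl ((pt_eq_iff hZ h hZ' h').2 ⟨a, rfl, rfl⟩)
    · exact Or.inr ((pt_eq_iff hZ h hZ' h'').2 ⟨a, rfl, by ring⟩)
  · rintro (hp | hp)
    · rw [hp]
    · rw [hp, proj_pt hZ' h'', proj_pt hZ' h']

theorem contMDiff_proj {𝕜 : Type*} [NontriviallyNormedField 𝕜] [NormedAlgebra 𝕜 ℂ]
    {m : WithTop ℕ∞} [IsManifold 𝓘(𝕜, Fin n → ℂ) m (Q n)] [IsManifold 𝓘(𝕜, Fin n → ℂ) m (CP n)]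
    [IsManifold 𝓘(𝕜, Fin (n + 1) → ℂ) m (CP (n + 1))] :
    ContMDiff 𝓘(𝕜, Fin n → ℂ) 𝓘(𝕜, Fin n → ℂ) m (proj n) := by
  intro z
  obtain ⟨i, hi⟩ := CP.exists_rep_ne_zero z.1
  have hN := (CP.contMDiffAt_normalize (𝕜 := 𝕜) (m := m) (LinearMap.proj i)
    (z := z.1) hi).comp z (contMDiff_val (𝕜 := 𝕜) (m := m)).contMDiffAt
  have hI : ContDiff 𝕜 m fun v : Fin (n + 2) → ℂ => fun i : Fin (n + 1) => v i.castSucc :=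
    contDiff_pi.2 fun j => contDiff_apply 𝕜 ℂ _
  have hne : ∀ y : Q n, y.1.rep i ≠ 0 →
      (fun j : Fin (n + 1) => CP.normalize (LinearMap.proj i) y.1 j.castSucc) =
        (y.1.rep i)⁻¹ • fun j : Fin (n + 1) => y.1.rep j.castSucc := fun y hy => rfl
  refine (CP.contMDiffAt_ofVec (hI.contMDiff.contMDiffAt.comp z hN) ?_).congr_of_eventuallyEq ?_
  · rw [Function.comp_apply, Function.comp_apply, hne z hi]
    exact smul_ne_zero (inv_ne_zero hi) (init_ne_zero z)
  · filter_upwards [((CP.isOpen_ne_zero (LinearMap.proj i)).preimage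
      continuous_subtype_val).mem_nhds hi] with y hy
    replace hy : y.1.rep i ≠ 0 := hy
    rw [Function.comp_apply, Function.comp_apply, hne y hy,
      CP.ofVec_smul (inv_ne_zero hy) (init_ne_zero y), CP.ofVec_eq (init_ne_zero y), proj]

/-- The projection off the branch locus has local inverses given by a square root. -/
theorem isLocalDiffeomorphAt_proj {x : Q n} (hx : proj n x ∉ quadric n) :
    IsLocalDiffeomorphAt 𝓘(ℂ, Fin n → ℂ) 𝓘(ℂ, Fin n → ℂ) ω (proj n) x := by
  obtain ⟨Z₁, ζ₁, hZ₁, h₁, rfl⟩ := exists_pt x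
  rw [proj_pt hZ₁ h₁, CP.ofVec_mem_quadric hZ₁] at hx
  obtain ⟨i, hi⟩ : ∃ i, Z₁ i ≠ 0 := by
    by_contra! h
    exact hZ₁ (funext h)
  have hζ₁ : ζ₁ ≠ 0 := fun h => hx (by simpa [h] using h₁)
  -- The last coordinate of the base point once Z_i = 1. Dividing by it moves the base value to 1,
  -- where the principal square root is the right branch.
  set ζ₀ : ℂ := (Z₁ i)⁻¹ * ζ₁ with hζ₀def
  have hζ₀ : ζ₀ ≠ 0 := mul_ne_zero (inv_ne_zero hi) hζ₁
  let l : (Fin (n + 1) → ℂ) →ₗ[ℂ] ℂ := LinearMap.proj i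
  let l' : (Fin (n + 2) → ℂ) →ₗ[ℂ] ℂ := LinearMap.proj i.castSucc
  -- By the equation of the quadric this is (ζ/ζ₀)², expressed on projective space.
  let s : CP n → ℂ := fun y => -(∑ k, CP.normalize l y k ^ 2) / ζ₀ ^ 2
  let r : ℂ → ℂ := fun a => Complex.exp (Complex.log a * 2⁻¹)
  have hr2 : ∀ a : ℂ, a ≠ 0 → r a ^ 2 = a := fun a ha => by
    simp only [r]
    rw [← Complex.exp_nat_mul]
    push_cast
    rw [show (2 : ℂ) * (Complex.log a * 2⁻¹) = Complex.log a by ring, Complex.exp_log ha]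
  have hrs : ∀ a : ℂ, 0 < a.re → r (a ^ 2) = a := fun a ha => by
    have ha0 : a ≠ 0 := fun h => by simp [h] at ha
    have := Complex.sq_cpow_two_inv ha
    rwa [Complex.cpow_def_of_ne_zero (pow_ne_zero 2 ha0)] at this
  have hslit : ∀ a : ℂ, 0 < a.re → a ^ 2 ∈ Complex.slitPlane := fun a ha => by
    rw [Complex.mem_slitPlane_iff, sq, Complex.mul_re, Complex.mul_im]
    by_cases him : a.im = 0
    · left
      rw [him]
      nlinarith
    · right
      have : a.re * a.im ≠ 0 := mul_ne_zero ha.ne' him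
      intro h
      exact this (by linarith)
  let A : Set (CP n) := {y | l y.rep ≠ 0}
  let A' : Set (Q n) := {y | l' y.1.rep ≠ 0}
  have hA : IsOpen A := CP.isOpen_ne_zero l
  have hA' : IsOpen A' := (CP.isOpen_ne_zero l').preimage continuous_subtype_val
  have hNs : ContMDiffOn 𝓘(ℂ, Fin n → ℂ) 𝓘(ℂ, Fin (n + 1) → ℂ) ω (CP.normalize l) A :=
    fun y hy => (CP.contMDiffAt_normalize l hy).contMDiffWithinAt
  have hss : ContMDiffOn 𝓘(ℂ, Fin n → ℂ) 𝓘(ℂ, ℂ) ω s A := by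
    have : ContDiff ℂ ω fun v : Fin (n + 1) → ℂ => -(∑ k, v k ^ 2) / ζ₀ ^ 2 := by fun_prop
    exact this.contMDiff.comp_contMDiffOn hNs
  have hcont : ContinuousOn (fun y : Q n => CP.normalize l' y.1 (Fin.last (n + 1)) / ζ₀) A' :=
    ((continuous_apply _).comp_continuousOn ((CP.continuousOn_normalize l').comp
      continuous_subtype_val.continuousOn fun y hy => hy)).div_const _
  -- `U` is the sheet Re(ζ/ζ₀) > 0 and `W` its image: squaring maps the right half-plane bijectively
  -- onto the slit plane.
  let W : Set (CP n) := A ∩ s ⁻¹' Complex.slitPlane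
  let U : Set (Q n) := A' ∩
    (fun y : Q n => CP.normalize l' y.1 (Fin.last (n + 1)) / ζ₀) ⁻¹' {a : ℂ | 0 < a.re}
  have hre : IsOpen {a : ℂ | 0 < a.re} := isOpen_lt continuous_const Complex.continuous_re
  have hU : IsOpen U := hcont.isOpen_inter_preimage hA' hre
  have hW : IsOpen W := hss.continuousOn.isOpen_inter_preimage hA Complex.isOpen_slitPlane
  have key : ∀ y ∈ U, ∃ (Z : Fin (n + 1) → ℂ) (ζ : ℂ), Z ≠ 0 ∧ ∑ k, Z k ^ 2 + ζ ^ 2 = 0 ∧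
      pt Z ζ = y ∧ 0 < (ζ / ζ₀).re ∧ CP.normalize l (proj n y) = Z ∧ l Z ≠ 0 := by
    intro y hy
    obtain ⟨Z, ζ, hZ, h, rfl⟩ := exists_pt y
    have hv : (pt Z ζ).1 = CP.ofVec (vec Z ζ) := ofVec_val (vec_ne_zero hZ ζ) (by rw [sum_vec, h])
    have h1 : l' (vec Z ζ) ≠ 0 := by
      have := hy.1
      simp only [A', mem_ofPred_eq, hv] at this
      rwa [CP.ofVec_eq (vec_ne_zero hZ ζ), CP.ne_zero_mk_iff] at this
    have hZi : Z i ≠ 0 := by simpa [l'] using h1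
    have h2 := hy.2
    simp only [mem_preimage, mem_ofPred_eq, hv, CP.normalize_ofVec l' (vec_ne_zero hZ ζ)] at h2
    have h3 : 0 < ((Z i)⁻¹ * ζ / ζ₀).re := by simpa [l'] using h2
    have hs := smul_ne_zero (inv_ne_zero hZi) hZ
    refine ⟨(Z i)⁻¹ • Z, (Z i)⁻¹ * ζ, hs, ?_, pt_smul (inv_ne_zero hZi) hZ h, h3, ?_, ?_⟩
    · simp only [Pi.smul_apply, smul_eq_mul, mul_pow, ← Finset.mul_sum]
      linear_combination (Z i)⁻¹ ^ 2 * h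
    · rw [proj_pt hZ h, CP.normalize_ofVec l hZ]
      rfl
    · change (Z i)⁻¹ * Z i ≠ 0
      rw [inv_mul_cancel₀ hZi]
      exact one_ne_zero
  have hsU : ∀ (Z : Fin (n + 1) → ℂ) (ζ : ℂ), ∑ k, Z k ^ 2 + ζ ^ 2 = 0 →
      -(∑ k, Z k ^ 2) / ζ₀ ^ 2 = (ζ / ζ₀) ^ 2 := fun Z ζ h => by
    rw [div_pow]
    congr 1
    linear_combination -h
  refine isLocalDiffeomorphAt_of_inverse (U := U) (W := W)
    (g := fun y => pt (CP.normalize l y) (ζ₀ * r (s y))) hU hW ?_ ?_ ?_ ?_ ?_ ?_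
  · have hv : (pt Z₁ ζ₁).1 = CP.ofVec (vec Z₁ ζ₁) :=
      ofVec_val (vec_ne_zero hZ₁ ζ₁) (by rw [sum_vec, h₁])
    constructor
    · simp only [A', mem_ofPred_eq, hv]
      rw [CP.ofVec_eq (vec_ne_zero hZ₁ ζ₁), CP.ne_zero_mk_iff]
      simpa [l'] using hi
    · simp only [mem_preimage, mem_ofPred_eq, hv, CP.normalize_ofVec l' (vec_ne_zero hZ₁ ζ₁)]
      have : ((l' (vec Z₁ ζ₁))⁻¹ • vec Z₁ ζ₁) (Fin.last (n + 1)) = ζ₀ := by simp [l', ζ₀]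
      rw [this, div_self hζ₀]
      simp
  · intro y hy
    obtain ⟨Z, ζ, hZ, h, rfl, hpos, hN, hl⟩ := key y hy
    refine ⟨?_, ?_⟩
    · simp only [A, mem_ofPred_eq]
      rwa [proj_pt hZ h, CP.ofVec_eq hZ, CP.ne_zero_mk_iff]
    · simp only [mem_preimage, s, hN]
      rw [hsU Z ζ h]
      exact hslit _ hpos
  · exact contMDiff_proj.contMDiffOn
  · intro y hy
    refine ContMDiffAt.contMDiffWithinAt ?_
    have h1 : ContMDiffAt 𝓘(ℂ, Fin n → ℂ) 𝓘(ℂ, Fin (n + 1) → ℂ) ω (CP.normalize l) y :=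
      CP.contMDiffAt_normalize l hy.1
    have h2 : ContMDiffAt 𝓘(ℂ, Fin n → ℂ) 𝓘(ℂ, ℂ) ω s y :=
      (hss y hy.1).contMDiffAt (hA.mem_nhds hy.1)
    have h3 : ContDiffAt ℂ ω (fun a => ζ₀ * r a) (s y) :=
      contDiffAt_const.mul (((Complex.contDiffAt_log hy.2).mul contDiffAt_const).cexp)
    have h4 := h1.prodMk_space (h3.contMDiffAt.comp y h2)
    refine contMDiffAt_ofVec (contDiff_vec.contMDiff.contMDiffAt.comp y h4)
      (vec_ne_zero (CP.normalize_ne_zero l hy.1) _) ?_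
    filter_upwards [hW.mem_nhds hy] with z hz
    have hz0 : s z ≠ 0 := Complex.slitPlane_ne_zero hz.2
    change ∑ i, vec (CP.normalize l z) (ζ₀ * r (s z)) i ^ 2 = 0
    rw [sum_vec, mul_pow, hr2 _ hz0]
    simp only [s]
    field_simp
    ring
  · intro y hy
    obtain ⟨Z, ζ, hZ, h, rfl, hpos, hN, hl⟩ := key y hy
    simp only [s, hN]
    rw [hsU Z ζ h, hrs _ hpos, mul_div_cancel₀ _ hζ₀]
  · intro y hy
    have hy0 : s y ≠ 0 := Complex.slitPlane_ne_zero hy.2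
    rw [proj_pt (CP.normalize_ne_zero l hy.1), CP.ofVec_normalize l hy.1]
    rw [mul_pow, hr2 _ hy0]
    simp only [s]
    field_simp
    ring

end Q

end

/-! ### Coordinates adapted to the branch locus -/

noncomputable section

namespace Q

variable {n m : ℕ}

/-- The vector `v` with `v_a + i v_b = 1`, with `- ∑ v_j ^ 2` equal to the last entry of `u`, and
with the other entries of `u` as its entries off `a` and `b`. -/
def branchPoint (a : Fin (m + 2)) (b : Fin (m + 1)) (u : Fin (m + 1) → ℂ) : Fin (m + 2) → ℂ :=
  a.insertNth ((1 - (u (Fin.last m) + ∑ j : Fin m, u j.castSucc ^ 2)) / 2)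
    (b.insertNth (-Complex.I * (1 + (u (Fin.last m) + ∑ j : Fin m, u j.castSucc ^ 2)) / 2)
      (fun j : Fin m => u j.castSucc) : Fin (m + 1) → ℂ)

/-- The inverse of `branchPoint`. -/
def branchCoord (a : Fin (m + 2)) (b : Fin (m + 1)) (v : Fin (m + 2) → ℂ) : Fin (m + 1) → ℂ :=
  Fin.snoc (α := fun _ => ℂ) (fun j : Fin m => v (a.succAbove (b.succAbove j))) (-∑ i, v i ^ 2)

theorem form_branchPoint (a : Fin (m + 2)) (b : Fin (m + 1)) (u : Fin (m + 1) → ℂ) :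
    form a b (branchPoint a b u) = 1 := by
  simp only [form_apply, branchPoint, Fin.insertNth_apply_same, Fin.insertNth_apply_succAbove]
  linear_combination
    (-(1 + (u (Fin.last m) + ∑ j : Fin m, u j.castSucc ^ 2)) / 2) * Complex.I_sq

theorem branchPoint_ne_zero (a : Fin (m + 2)) (b : Fin (m + 1)) (u : Fin (m + 1) → ℂ) :
    branchPoint a b u ≠ 0 := fun h => by
  simpa [h] using form_branchPoint a b u

/-- With v_a + i v_b = 1, the sum of squares is v_a - i v_b plus the squares of the other entries.
Prescribing it therefore determines v_a - i v_b, and it can serve as a coordinate. -/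
theorem sum_branchPoint (a : Fin (m + 2)) (b : Fin (m + 1)) (u : Fin (m + 1) → ℂ) :
    ∑ i, branchPoint a b u i ^ 2 = -u (Fin.last m) := by
  rw [sum_split a b]
  simp only [branchPoint, Fin.insertNth_apply_same, Fin.insertNth_apply_succAbove]
  linear_combination
    ((1 + (u (Fin.last m) + ∑ j : Fin m, u j.castSucc ^ 2)) ^ 2 / 4) * Complex.I_sq

theorem branchCoord_branchPoint (a : Fin (m + 2)) (b : Fin (m + 1)) (u : Fin (m + 1) → ℂ) :
    branchCoord a b (branchPoint a b u) = u := by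
  ext k
  induction k using Fin.lastCases with
  | last => simp [branchCoord, sum_branchPoint]
  | cast j => simp [branchCoord, branchPoint]

theorem branchPoint_branchCoord (a : Fin (m + 2)) (b : Fin (m + 1)) {v : Fin (m + 2) → ℂ}
    (hv : form a b v = 1) : branchPoint a b (branchCoord a b v) = v := by
  have ht : branchCoord a b v (Fin.last m) + ∑ j : Fin m, branchCoord a b v j.castSucc ^ 2 =
      -(v a - Complex.I * v (a.succAbove b)) := by
    simp only [branchCoord, Fin.snoc_last, Fin.snoc_castSucc]
    rw [sum_split a b]
    rw [form_apply] at hv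
    linear_combination (-(v a - Complex.I * v (a.succAbove b))) * hv -
      v (a.succAbove b) ^ 2 * Complex.I_sq
  rw [form_apply] at hv
  unfold branchPoint
  rw [ht]
  ext k
  induction k using a.succAboveCases with
  | x =>
    simp only [Fin.insertNth_apply_same]
    linear_combination (-1 / 2 : ℂ) * hv
  | p k =>
    induction k using b.succAboveCases with
    | x =>
      simp only [Fin.insertNth_apply_same, Fin.insertNth_apply_succAbove]
      linear_combination (Complex.I / 2) * hv - v (a.succAbove b) * Complex.I_sq
    | p j => simp [branchCoord]

theorem contDiff_branchPoint (a : Fin (m + 2)) (b : Fin (m + 1)) :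
    ContDiff ℂ ω (branchPoint a b) :=
  contDiffOn_univ.1 (contDiffOn_insertNth a (by fun_prop)
    (contDiffOn_insertNth b (by fun_prop) (by fun_prop)))

theorem contDiff_branchCoord (a : Fin (m + 2)) (b : Fin (m + 1)) :
    ContDiff ℂ ω (branchCoord a b) := by
  rw [contDiff_pi]
  intro k
  induction k using Fin.lastCases with
  | last =>
    simp only [branchCoord, Fin.snoc_last]
    fun_prop
  | cast j =>
    simp only [branchCoord, Fin.snoc_castSucc]
    fun_prop

theorem form_normalize (a : Fin (m + 2)) (b : Fin (m + 1)) {y : CP (m + 1)}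
    (hy : form a b y.rep ≠ 0) : form a b (CP.normalize (form a b) y) = 1 := by
  rw [CP.normalize, map_smul, smul_eq_mul, inv_mul_cancel₀ hy]

theorem normalize_branchPoint (a : Fin (m + 2)) (b : Fin (m + 1)) (u : Fin (m + 1) → ℂ) :
    CP.normalize (form a b) (CP.ofVec (branchPoint a b u)) = branchPoint a b u := by
  rw [CP.normalize_ofVec _ (branchPoint_ne_zero a b u), form_branchPoint, inv_one, one_smul]

theorem contMDiffOn_branchCoord (a : Fin (m + 2)) (b : Fin (m + 1)) :
    ContMDiffOn 𝓘(ℂ, Fin (m + 1) → ℂ) 𝓘(ℂ, Fin (m + 1) → ℂ) ω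
      (fun y => branchCoord a b (CP.normalize (form a b) y)) {y | form a b y.rep ≠ 0} :=
  (contDiff_branchCoord a b).contMDiff.comp_contMDiffOn
    fun _ hy => (CP.contMDiffAt_normalize (form a b) hy).contMDiffWithinAt

theorem contMDiff_branchPoint (a : Fin (m + 2)) (b : Fin (m + 1)) :
    ContMDiff 𝓘(ℂ, Fin (m + 1) → ℂ) 𝓘(ℂ, Fin (m + 1) → ℂ) ω
      (fun u => CP.ofVec (branchPoint a b u)) :=
  fun _ => CP.contMDiffAt_ofVec (contDiff_branchPoint a b).contMDiff.contMDiffAt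
    (branchPoint_ne_zero a b _)

/-- The chart of projective space on `{z_a + i z_b ≠ 0}` whose last coordinate is
`- ∑ z_j ^ 2 / (z_a + i z_b) ^ 2`. -/
def branchChart (a : Fin (m + 2)) (b : Fin (m + 1)) :
    OpenPartialHomeomorph (CP (m + 1)) (Fin (m + 1) → ℂ) where
  toFun y := branchCoord a b (CP.normalize (form a b) y)
  invFun u := CP.ofVec (branchPoint a b u)
  source := {y | form a b y.rep ≠ 0}
  target := univ
  map_source' _ _ := mem_univ _
  map_target' u _ := by
    rw [mem_ofPred_eq, CP.ofVec_eq (branchPoint_ne_zero a b u), CP.ne_zero_mk_iff,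
      form_branchPoint]
    exact one_ne_zero
  left_inv' y hy := by
    rw [branchPoint_branchCoord a b (form_normalize a b hy), CP.ofVec_normalize _ hy]
  right_inv' u _ := by rw [normalize_branchPoint, branchCoord_branchPoint]
  open_source := CP.isOpen_ne_zero _
  open_target := isOpen_univ
  continuousOn_toFun := (contMDiffOn_branchCoord a b).continuousOn
  continuousOn_invFun := (contMDiff_branchPoint a b).continuous.continuousOn

theorem branchChart_mem_maximalAtlas (a : Fin (m + 2)) (b : Fin (m + 1)) :
    branchChart a b ∈ IsManifold.maximalAtlas 𝓘(ℂ, Fin (m + 1) → ℂ) ω (CP (m + 1)) :=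
  (branchChart a b).mem_maximalAtlas_of_contMDiffOn (contMDiffOn_branchCoord a b)
    (contMDiff_branchPoint a b).contMDiffOn

theorem mem_quadric_iff_branchChart (a : Fin (m + 2)) (b : Fin (m + 1)) {y : CP (m + 1)}
    (hy : y ∈ (branchChart a b).source) :
    y ∈ quadric (m + 1) ↔ branchChart a b y (Fin.last m) = 0 := by
  change _ ↔ branchCoord a b (CP.normalize (form a b) y) (Fin.last m) = 0
  conv_lhs => rw [← CP.ofVec_normalize (form a b) hy,
    CP.ofVec_mem_quadric (CP.normalize_ne_zero _ hy)]
  simp [branchCoord]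

theorem form_castSucc (a : Fin (m + 2)) (b : Fin (m + 1)) (v : Fin (m + 3) → ℂ) :
    form a.castSucc b.castSucc v = form a b fun i => v i.castSucc := by
  rw [form_apply, form_apply, Fin.castSucc_succAbove_castSucc]

theorem form_rep_proj (a : Fin (m + 2)) (b : Fin (m + 1)) (x : Q (m + 1)) :
    form a b (proj (m + 1) x).rep ≠ 0 ↔ form a.castSucc b.castSucc x.1.rep ≠ 0 := by
  rw [form_castSucc, proj, CP.ne_zero_mk_iff]

/-- Since a and b avoid the last index, the last coordinate in the chart of the quadric is ζ/(z_a +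
i z_b). Its square is -Z·Z/(z_a + i z_b)² by the equation of the quadric, while the other
coordinates are the same upstairs and downstairs. -/
theorem branchChart_proj (a : Fin (m + 2)) (b : Fin (m + 1)) {x : Q (m + 1)}
    (hx : x ∈ (chart a.castSucc b.castSucc).source) :
    branchChart a b (proj (m + 1) x) = Function.update (chart a.castSucc b.castSucc x)
      (Fin.last m) (chart a.castSucc b.castSucc x (Fin.last m) ^ 2) := by
  have hf : form a.castSucc b.castSucc x.1.rep ≠ 0 := hx
  have hN : CP.normalize (form a b) (proj (m + 1) x) =
      (form a.castSucc b.castSucc x.1.rep)⁻¹ • fun i => x.1.rep i.castSucc := by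
    rw [proj, ← CP.ofVec_eq, CP.normalize_ofVec _ (init_ne_zero x), form_castSucc]
  change branchCoord a b (CP.normalize (form a b) (proj (m + 1) x)) = _
  rw [hN]
  have hlast : a.castSucc.succAbove (b.castSucc.succAbove (Fin.last m)) = Fin.last (m + 2) := by
    rw [Fin.succAbove_ne_last_last (Fin.castSucc_lt_last b).ne,
      Fin.succAbove_ne_last_last (Fin.castSucc_lt_last a).ne]
  have hchart : ∀ k, chart a.castSucc b.castSucc x k =
      x.1.rep (a.castSucc.succAbove (b.castSucc.succAbove k)) /
        form a.castSucc b.castSucc x.1.rep := fun _ => rfl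
  ext k
  induction k using Fin.lastCases with
  | last =>
    have hq : ∑ i, x.1.rep i ^ 2 = 0 := x.2
    rw [Fin.sum_univ_castSucc] at hq
    rw [Function.update_self, hchart, hlast]
    simp only [branchCoord, Fin.snoc_last, Pi.smul_apply, smul_eq_mul, mul_pow,
      ← Finset.mul_sum, div_pow]
    field_simp
    linear_combination -hq
  | cast j =>
    rw [Function.update_of_ne (Fin.castSucc_lt_last j).ne, hchart,
      Fin.castSucc_succAbove_castSucc, Fin.castSucc_succAbove_castSucc]
    simp only [branchCoord, Fin.snoc_castSucc, Pi.smul_apply, smul_eq_mul, div_eq_inv_mul]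

theorem isLocalDiffeomorphOn_proj (n : ℕ) :
    IsLocalDiffeomorphOn 𝓘(ℂ, Fin n → ℂ) 𝓘(ℂ, Fin n → ℂ) ω (proj n)
      (proj n ⁻¹' (quadric n)ᶜ) :=
  fun x => isLocalDiffeomorphAt_proj x.2

theorem isBranchedDoubleCover (n : ℕ) : IsBranchedDoubleCover n (proj n) (quadric n) where
  holomorphic := contMDiff_proj
  isCoveringMapOn := IsCoveringMapOn.of_isLocalHomeomorphOn
    (contMDiff_proj (𝕜 := ℂ) (m := ω)).continuous
    (isLocalDiffeomorphOn_proj n).isLocalHomeomorphOn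
  ncard_fiber y hy := by
    have hy0 := y.rep_nonzero
    rw [← CP.ofVec_rep y, CP.ofVec_mem_quadric hy0] at hy
    obtain ⟨ζ, hζ⟩ := IsAlgClosed.exists_pow_nat_eq (-∑ i, y.rep i ^ 2) two_pos
    have h : ∑ i, y.rep i ^ 2 + ζ ^ 2 = 0 := by rw [hζ]; ring
    have h' : ∑ i, y.rep i ^ 2 + (-ζ) ^ 2 = 0 := by rw [neg_sq, h]
    have hζ0 : ζ ≠ 0 := fun h0 => hy (by simpa [h0] using h)
    have hpre : proj n ⁻¹' {y} = {pt y.rep ζ, pt y.rep (-ζ)} := by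
      ext x
      obtain ⟨Z, ξ, hZ, hc, rfl⟩ := exists_pt x
      rw [mem_preimage, mem_singleton_iff, mem_insert_iff, mem_singleton_iff,
        ← proj_pt_eq_iff hZ hc hy0 h, proj_pt hy0 h, CP.ofVec_rep]
    rw [hpre, ncard_pair]
    intro he
    obtain ⟨a, ha, ha'⟩ := (pt_eq_iff hy0 h hy0 h').1 he
    have ha1 : a = 1 := by
      by_contra hne
      exact smul_ne_zero (sub_ne_zero.2 hne) hy0 (by rw [sub_smul, ha, one_smul, sub_self])
    rw [ha1, one_mul] at ha'
    exact hζ0 (by linear_combination (-1 / 2 : ℂ) * ha')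
  unramified := isLocalDiffeomorphOn_proj n
  existsUnique y hy := by
    have hy0 := y.rep_nonzero
    rw [← CP.ofVec_rep y, CP.ofVec_mem_quadric hy0] at hy
    have h : ∑ i, y.rep i ^ 2 + 0 ^ 2 = 0 := by rw [hy]; ring
    refine ⟨pt y.rep 0, (proj_pt hy0 h).trans (CP.ofVec_rep y), fun x hx => ?_⟩
    obtain ⟨Z, ξ, hZ, hc, rfl⟩ := exists_pt x
    have hx' : proj n (pt Z ξ) = proj n (pt y.rep 0) := by
      rw [hx, proj_pt hy0 h, CP.ofVec_rep]
    simpa using (proj_pt_eq_iff hZ hc hy0 h).1 hx'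
  branched x hx := by
    cases n with
    -- The branch locus is empty here, because z_0² = 0 has no solution in projective space.
    | zero =>
      have h0 := (proj 0 x).rep_nonzero
      refine absurd (funext fun i => ?_) h0
      have hq : ∑ i, (proj 0 x).rep i ^ 2 = 0 := hx
      rw [Fin.sum_univ_one] at hq
      rw [Fin.fin_one_eq_zero i]
      exact pow_eq_zero_iff two_ne_zero |>.1 hq
    | succ m =>
      -- The image point lies on the quadric one dimension lower, and a form z_a + i z_b that does
      -- not vanish there involves only the first coordinates.
      obtain ⟨⟨a, b⟩, hab⟩ := exists_form_ne_zero (⟨proj (m + 1) x, hx⟩ : Q m)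
      refine ⟨chart a.castSucc b.castSucc,
        IsManifold.subset_maximalAtlas (mem_range_self (a.castSucc, b.castSucc)),
        branchChart a b, branchChart_mem_maximalAtlas a b, Fin.last m,
        (form_rep_proj a b x).1 hab, fun x' hx' => ⟨?_, branchChart_proj a b hx'⟩,
        fun y hy => mem_quadric_iff_branchChart a b hy⟩
      exact (form_rep_proj a b x').2 hx'

end Q

end

/-! ### Complex vectors as pairs of real vectors -/

noncomputable section

section Complexify

variable {N : ℕ}

/-- The vector `p + i q`. -/
def cplx (x : (Fin N → ℝ) × (Fin N → ℝ)) : Fin N → ℂ := fun k => x.1 k + x.2 k * Complex.I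

/-- The real and imaginary parts of a complex vector. -/
def reIm (Z : Fin N → ℂ) : (Fin N → ℝ) × (Fin N → ℝ) := (fun k => (Z k).re, fun k => (Z k).im)

theorem cplx_reIm (Z : Fin N → ℂ) : cplx (reIm Z) = Z :=
  funext fun k => Complex.re_add_im (Z k)

theorem reIm_cplx (x : (Fin N → ℝ) × (Fin N → ℝ)) : reIm (cplx x) = x := by
  ext k <;> simp [reIm, cplx]

theorem cplx_injective : Function.Injective (cplx (N := N)) :=
  Function.LeftInverse.injective reIm_cplx

theorem cplx_smul (r : ℝ) (x : (Fin N → ℝ) × (Fin N → ℝ)) :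
    cplx (r • x) = (r : ℂ) • cplx x := by
  ext k
  simp [cplx]
  ring

theorem contDiff_cplx : ContDiff ℝ ∞ (cplx (N := N)) := by
  rw [contDiff_pi]
  intro k
  have h1 : ContDiff ℝ ∞ fun x : (Fin N → ℝ) × (Fin N → ℝ) => x.1 k := by fun_prop
  have h2 : ContDiff ℝ ∞ fun x : (Fin N → ℝ) × (Fin N → ℝ) => x.2 k := by fun_prop
  exact (Complex.ofRealCLM.contDiff.comp h1).add
    ((Complex.ofRealCLM.contDiff.comp h2).mul contDiff_const)

theorem contDiff_reIm : ContDiff ℝ ∞ (reIm (N := N)) :=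
  (contDiff_pi.2 fun k => Complex.reCLM.contDiff.comp (contDiff_apply ℝ ℂ k)).prodMk
    (contDiff_pi.2 fun k => Complex.imCLM.contDiff.comp (contDiff_apply ℝ ℂ k))

theorem sum_cplx_sq (x : (Fin N → ℝ) × (Fin N → ℝ)) :
    ∑ k, cplx x k ^ 2 = ((x.1 ⬝ᵥ x.1 - x.2 ⬝ᵥ x.2 : ℝ) : ℂ) +
      ((2 * (x.1 ⬝ᵥ x.2) : ℝ) : ℂ) * Complex.I := by
  simp only [cplx, dotProduct]
  push_cast
  rw [Finset.mul_sum, Finset.sum_mul, ← Finset.sum_sub_distrib, ← Finset.sum_add_distrib]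
  refine Finset.sum_congr rfl fun k _ => ?_
  linear_combination (x.2 k : ℂ) ^ 2 * Complex.I_sq

theorem sum_cplx_sq_eq_ofReal_iff (x : (Fin N → ℝ) × (Fin N → ℝ)) (r : ℝ) :
    ∑ k, cplx x k ^ 2 = (r : ℂ) ↔ x.1 ⬝ᵥ x.1 - x.2 ⬝ᵥ x.2 = r ∧ x.1 ⬝ᵥ x.2 = 0 := by
  rw [sum_cplx_sq, Complex.ext_iff]
  simp

theorem dotProduct_self_eq_zero' {v : Fin N → ℝ} (h : v ⬝ᵥ v ≤ 0) : v = 0 :=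
  dotProduct_self_eq_zero.1 (le_antisymm h (Finset.sum_nonneg fun _ _ => mul_self_nonneg _))

end Complexify

/-! ### The affine quadric and the disc bundle -/

namespace TS

variable {n : ℕ}

/-- The point of `T^*S^n` given by a pair of vectors, with a junk value elsewhere. -/
def ofPair (x : (Fin (n + 1) → ℝ) × (Fin (n + 1) → ℝ)) : TS n :=
  open Classical in
  if h : x ∈ cotangentSphere n then ⟨x, h⟩ else ⟨(Pi.single 0 1, 0), by simp [cotangentSphere]⟩

theorem ofPair_val {x : (Fin (n + 1) → ℝ) × (Fin (n + 1) → ℝ)} (h : x ∈ cotangentSphere n) :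
    (ofPair x).1 = x := by
  rw [ofPair, dif_pos h]

theorem energy_le_one {x : TS n} : energy x ≤ 1 ↔ x.1.2 ⬝ᵥ x.1.2 ≤ 1 := by
  rw [energy, Real.sqrt_le_one]

theorem energy_lt_one {x : TS n} : energy x < 1 ↔ x.1.2 ⬝ᵥ x.1.2 < 1 := by
  rw [energy, Real.sqrt_lt' one_pos, one_pow]

theorem energy_eq_one {x : TS n} : energy x = 1 ↔ x.1.2 ⬝ᵥ x.1.2 = 1 := by
  rw [energy, Real.sqrt_eq_one]

theorem cplx_ne_zero (x : TS n) : cplx x.1 ≠ 0 := fun h => by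
  obtain ⟨i, hi⟩ := exists_ne_zero x
  have := congrArg (fun v => (reIm v).1 i) h
  simp only [reIm_cplx] at this
  exact hi (by simpa [reIm] using this)

/-- The map `(p, q) ↦ [p + i q : i √(1 - |q|²)]` of the disc bundle to the quadric. -/
def toQuadric (x : TS n) : Q n :=
  Q.pt (cplx x.1) (Complex.I * (√(1 - x.1.2 ⬝ᵥ x.1.2) : ℝ))

theorem sum_cplx (x : TS n) : ∑ k, cplx x.1 k ^ 2 = ((1 - x.1.2 ⬝ᵥ x.1.2 : ℝ) : ℂ) :=
  (sum_cplx_sq_eq_ofReal_iff _ _).2 ⟨by rw [x.2.1], x.2.2⟩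

theorem toQuadric_cone {x : TS n} (hx : energy x ≤ 1) :
    ∑ k, cplx x.1 k ^ 2 + (Complex.I * (√(1 - x.1.2 ⬝ᵥ x.1.2) : ℝ)) ^ 2 = 0 := by
  have h : 0 ≤ 1 - x.1.2 ⬝ᵥ x.1.2 := by linarith [energy_le_one.1 hx]
  rw [sum_cplx, mul_pow, Complex.I_sq, ← Complex.ofReal_pow, Real.sq_sqrt h]
  ring

theorem proj_toQuadric {x : TS n} (hx : energy x ≤ 1) :
    Q.proj n (toQuadric x) = CP.ofVec (cplx x.1) :=
  Q.proj_pt (cplx_ne_zero x) (toQuadric_cone hx)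

theorem cplx_antipode (x : TS n) : cplx (antipode x).1 = (-1 : ℂ) • cplx x.1 := by
  have := cplx_smul (-1) x.1
  rw [neg_one_smul] at this
  rw [antipode, this]
  simp

theorem toQuadric_antipode {x : TS n} (hx : energy x ≤ 1) :
    toQuadric (antipode x) =
      Q.pt (cplx x.1) (-(Complex.I * (√(1 - x.1.2 ⬝ᵥ x.1.2) : ℝ))) := by
  rw [← Q.pt_smul (neg_ne_zero.2 one_ne_zero) (cplx_ne_zero x)
    (by rw [neg_sq, toQuadric_cone hx]), toQuadric, cplx_antipode]
  congr 1
  simp [antipode]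

theorem cplx_flow (t : ℝ) {x : TS n} (hx : energy x = 1) :
    cplx (flow t x).1 = Complex.exp (-(t * Complex.I)) • cplx x.1 := by
  rw [flow_val t (by rw [hx]; exact one_pos), hx, ← neg_mul, Complex.exp_mul_I, Complex.cos_neg,
    Complex.sin_neg]
  ext k
  simp [cplx]
  linear_combination ((Complex.sin t) * (x.1.2 k)) * Complex.I_sq

/-- The point of the disc bundle over `[Z : i w]`, `w ≥ 0`. -/
def ofQuadric (Z : Fin (n + 1) → ℂ) : TS n :=
  ofPair ((√((reIm Z).1 ⬝ᵥ (reIm Z).1))⁻¹ • reIm Z)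

/-- If Re Z vanished, then Z·Z = -|Im Z|² would have to be nonnegative, forcing Z = 0. -/
theorem re_dot_pos {Z : Fin (n + 1) → ℂ} {w : ℝ} (hZ : Z ≠ 0)
    (h : ∑ k, Z k ^ 2 = ((w ^ 2 : ℝ) : ℂ)) : 0 < (reIm Z).1 ⬝ᵥ (reIm Z).1 := by
  rw [← cplx_reIm Z, sum_cplx_sq_eq_ofReal_iff] at h
  by_contra! hle
  have h1 := dotProduct_self_eq_zero' hle
  have h2 : (reIm Z).2 = 0 := dotProduct_self_eq_zero' (by
    have := h.1
    nlinarith [sq_nonneg w])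
  exact hZ (by rw [← cplx_reIm Z, show reIm Z = (0, 0) from Prod.ext h1 h2]; ext; simp [cplx])

theorem ofQuadric_val {Z : Fin (n + 1) → ℂ} {w : ℝ} (hZ : Z ≠ 0)
    (h : ∑ k, Z k ^ 2 = ((w ^ 2 : ℝ) : ℂ)) :
    (ofQuadric Z).1 = (√((reIm Z).1 ⬝ᵥ (reIm Z).1))⁻¹ • reIm Z := by
  have hpos := re_dot_pos hZ h
  rw [← cplx_reIm Z, sum_cplx_sq_eq_ofReal_iff] at h
  refine ofPair_val ⟨?_, ?_⟩
  · simp only [Prod.smul_fst, smul_dotProduct, dotProduct_smul, smul_eq_mul]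
    rw [← mul_assoc, ← mul_inv, Real.mul_self_sqrt hpos.le, inv_mul_cancel₀ hpos.ne']
  · simp only [Prod.smul_fst, Prod.smul_snd, smul_dotProduct, dotProduct_smul, h.2, smul_zero]

theorem dot_ofQuadric {Z : Fin (n + 1) → ℂ} {w : ℝ} (hZ : Z ≠ 0)
    (h : ∑ k, Z k ^ 2 = ((w ^ 2 : ℝ) : ℂ)) :
    1 - (ofQuadric Z).1.2 ⬝ᵥ (ofQuadric Z).1.2 = (w / √((reIm Z).1 ⬝ᵥ (reIm Z).1)) ^ 2 := by
  have hpos := re_dot_pos hZ h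
  rw [ofQuadric_val hZ h]
  rw [← cplx_reIm Z, sum_cplx_sq_eq_ofReal_iff] at h
  simp only [Prod.smul_snd, smul_dotProduct, dotProduct_smul, smul_eq_mul]
  rw [div_pow, Real.sq_sqrt hpos.le, ← mul_assoc, ← mul_inv, Real.mul_self_sqrt hpos.le, ← h.1]
  field_simp

theorem toQuadric_ofQuadric {Z : Fin (n + 1) → ℂ} {w : ℝ} (hw : 0 ≤ w) (hZ : Z ≠ 0)
    (h : ∑ k, Z k ^ 2 = ((w ^ 2 : ℝ) : ℂ)) :
    energy (ofQuadric Z) ≤ 1 ∧ toQuadric (ofQuadric Z) = Q.pt Z (Complex.I * w) := by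
  have hpos := re_dot_pos hZ h
  have hs : 0 < √((reIm Z).1 ⬝ᵥ (reIm Z).1) := Real.sqrt_pos.2 hpos
  have hd := dot_ofQuadric hZ h
  refine ⟨energy_le_one.2 (by nlinarith [sq_nonneg (w / √((reIm Z).1 ⬝ᵥ (reIm Z).1))]), ?_⟩
  rw [toQuadric, hd, Real.sqrt_sq (by positivity), ofQuadric_val hZ h, cplx_smul, cplx_reIm,
    ← Q.pt_smul (a := ((√((reIm Z).1 ⬝ᵥ (reIm Z).1))⁻¹ : ℝ)) _ hZ]
  · congr 1
    push_cast
    ring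
  · rw [h, mul_pow, Complex.I_sq]
    push_cast
    ring
  · exact_mod_cast inv_ne_zero hs.ne'

theorem exists_toQuadric_eq (z : Q n) : ∃ x : TS n, energy x ≤ 1 ∧ toQuadric x = z := by
  obtain ⟨Z, ζ, hZ, h, rfl⟩ := Q.exists_pt z
  -- Rotate the phase until the last coordinate is i|ζ|; the sum of squares of the rescaled vector
  -- is then |ζ|², as `ofQuadric` requires.
  obtain ⟨a, ha, hζ⟩ : ∃ a : ℂ, a ≠ 0 ∧ a * ζ = Complex.I * (‖ζ‖ : ℝ) := by
    by_cases h0 : ζ = 0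
    · exact ⟨1, one_ne_zero, by simp [h0]⟩
    · have : (‖ζ‖ : ℂ) ≠ 0 := by exact_mod_cast norm_ne_zero_iff.2 h0
      exact ⟨Complex.I * ‖ζ‖ / ζ, div_ne_zero (mul_ne_zero Complex.I_ne_zero this) h0,
        div_mul_cancel₀ _ h0⟩
  have h' : ∑ k, (a • Z) k ^ 2 = ((‖ζ‖ ^ 2 : ℝ) : ℂ) := by
    simp only [Pi.smul_apply, smul_eq_mul, mul_pow, ← Finset.mul_sum]
    push_cast
    linear_combination a ^ 2 * h - (a * ζ + Complex.I * ‖ζ‖) * hζ - (‖ζ‖ : ℂ) ^ 2 * Complex.I_sq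
  obtain ⟨h1, h2⟩ := toQuadric_ofQuadric (norm_nonneg ζ) (smul_ne_zero ha hZ) h'
  exact ⟨_, h1, by rw [h2, ← hζ, Q.pt_smul ha hZ h]⟩

/-- Two representatives differ by a scalar a. A nonzero last coordinate makes a real and
nonnegative, and |p| = 1 on both sides gives a = 1. If the last coordinates vanish, a is a phase,
which the flow realizes. -/
theorem toQuadric_eq_iff {x y : TS n} (hx : energy x ≤ 1) (hy : energy y ≤ 1) :
    toQuadric x = toQuadric y ↔ x = y ∨ (energy x = 1 ∧ energy y = 1 ∧ ∃ t, flow t x = y) := by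
  rw [toQuadric, toQuadric, Q.pt_eq_iff (cplx_ne_zero x) (toQuadric_cone hx) (cplx_ne_zero y)
    (toQuadric_cone hy)]
  have hx1 : 0 ≤ 1 - x.1.2 ⬝ᵥ x.1.2 := by linarith [energy_le_one.1 hx]
  have hy1 : 0 ≤ 1 - y.1.2 ⬝ᵥ y.1.2 := by linarith [energy_le_one.1 hy]
  constructor
  · rintro ⟨a, ha, ha'⟩
    set u := √(1 - x.1.2 ⬝ᵥ x.1.2) with hu
    set v := √(1 - y.1.2 ⬝ᵥ y.1.2) with hv
    have hav : a * v = u := mul_left_cancel₀ Complex.I_ne_zero (by linear_combination ha')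
    by_cases hv0 : v = 0
    · right
      have hu0 : u = 0 := by
        rw [hv0, Complex.ofReal_zero, mul_zero] at hav
        exact_mod_cast hav.symm
      have ex : energy x = 1 := energy_eq_one.2 (by
        have := (Real.sqrt_eq_zero hx1).1 hu0
        linarith)
      have ey : energy y = 1 := energy_eq_one.2 (by
        have := (Real.sqrt_eq_zero hy1).1 hv0
        linarith)
      refine ⟨ex, ey, a.arg, ?_⟩
      -- On the unit level both vectors have |p + iq|² = 2.
      have hnorm : ‖a‖ = 1 := by
        have e1 : ∀ z : TS n, energy z = 1 → ∑ k, ‖cplx z.1 k‖ ^ 2 = 2 := fun z hz => by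
          have : ∑ k, ‖cplx z.1 k‖ ^ 2 = z.1.1 ⬝ᵥ z.1.1 + z.1.2 ⬝ᵥ z.1.2 := by
            simp only [dotProduct, ← Finset.sum_add_distrib]
            refine Finset.sum_congr rfl fun k _ => ?_
            rw [← Complex.normSq_eq_norm_sq, cplx, Complex.normSq_add_mul_I]
            ring
          rw [this, z.2.1, energy_eq_one.1 hz]
          norm_num
        have e2 := e1 x ex
        rw [← ha] at e2
        simp only [Pi.smul_apply, smul_eq_mul, norm_mul, mul_pow, ← Finset.mul_sum, e1 y ey] at e2
        have : ‖a‖ ^ 2 = 1 := by linarith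
        exact (pow_eq_one_iff_of_nonneg (norm_nonneg a) two_ne_zero).1 this
      have harg : Complex.exp (a.arg * Complex.I) = a := by
        have := Complex.norm_mul_exp_arg_mul_I a
        rwa [hnorm, Complex.ofReal_one, one_mul] at this
      apply Subtype.ext
      apply cplx_injective
      have hexp : Complex.exp (-(a.arg * Complex.I)) * a = 1 := by
        nth_rewrite 2 [← harg]
        rw [← Complex.exp_add, neg_add_cancel, Complex.exp_zero]
      rw [cplx_flow _ ex, ← ha, smul_smul, hexp, one_smul]
    · left
      have hv0' : (v : ℂ) ≠ 0 := by exact_mod_cast hv0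
      have ha2 : a = ((u / v : ℝ) : ℂ) := by
        push_cast
        rw [eq_div_iff hv0', hav]
      have hr : 0 ≤ u / v := div_nonneg (Real.sqrt_nonneg _) (Real.sqrt_nonneg _)
      rw [ha2, ← cplx_smul] at ha
      have hxy := cplx_injective ha
      have hp := x.2.1
      rw [← hxy] at hp
      simp only [Prod.smul_fst, smul_dotProduct, dotProduct_smul, y.2.1, smul_eq_mul,
        mul_one] at hp
      have hr1 : u / v = 1 := (pow_eq_one_iff_of_nonneg hr two_ne_zero).1 (by rw [sq, hp])
      rw [hr1, one_smul] at hxy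
      exact Subtype.ext hxy.symm
  · rintro (rfl | ⟨ex, ey, t, rfl⟩)
    · exact ⟨1, one_smul _ _, one_mul _⟩
    · refine ⟨Complex.exp (t * Complex.I), ?_, ?_⟩
      · rw [cplx_flow _ ex, smul_smul, ← Complex.exp_add, add_neg_cancel, Complex.exp_zero,
          one_smul]
      · rw [energy_eq_one.1 ex, energy_eq_one.1 ey]
        simp

/-- The sign change of the last coordinate, which permutes the fibres of the projection, corresponds
to the antipodal map. -/
theorem proj_toQuadric_eq_iff {x y : TS n} (hx : energy x ≤ 1) (hy : energy y ≤ 1) :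
    Q.proj n (toQuadric x) = Q.proj n (toQuadric y) ↔
      toQuadric x = toQuadric y ∨ toQuadric x = toQuadric (antipode y) := by
  rw [toQuadric_antipode hy]
  exact Q.proj_pt_eq_iff (cplx_ne_zero x) (toQuadric_cone hx) (cplx_ne_zero y) (toQuadric_cone hy)

theorem proj_toQuadric_mem_iff {x : TS n} (hx : energy x ≤ 1) :
    Q.proj n (toQuadric x) ∈ quadric n ↔ energy x = 1 := by
  rw [proj_toQuadric hx, CP.ofVec_mem_quadric (cplx_ne_zero x), sum_cplx, energy_eq_one]
  norm_cast
  rw [sub_eq_zero, eq_comm]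

/-- Only the closed disc bundle is considered: for |q| > 1 the vector leaves the cone and `Q.ofVec`
takes its default value. -/
theorem continuousOn_toQuadric : ContinuousOn (toQuadric : TS n → Q n) {x | energy x ≤ 1} := by
  intro x hx
  rw [ContinuousWithinAt, IsInducing.subtypeVal.tendsto_nhds_iff]
  have hc : Continuous fun x : TS n =>
      Q.vec (cplx x.1) (Complex.I * (√(1 - x.1.2 ⬝ᵥ x.1.2) : ℝ)) := by
    refine (Q.contDiff_vec (𝕜 := ℝ) (m := 0)).continuous.comp
      ((contDiff_cplx.continuous.comp continuous_subtype_val).prodMk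
        (continuous_const.mul (Complex.continuous_ofReal.comp ?_)))
    exact (continuous_const.sub (contDiff_snd_dot.continuous.comp continuous_subtype_val)).sqrt
  have h : ContinuousAt (fun x : TS n =>
      CP.ofVec (Q.vec (cplx x.1) (Complex.I * (√(1 - x.1.2 ⬝ᵥ x.1.2) : ℝ)))) x :=
    (CP.continuousAt_ofVec (Q.vec_ne_zero (cplx_ne_zero x) _)).comp_of_eq hc.continuousAt rfl
  have hval : ∀ y : TS n, energy y ≤ 1 → (toQuadric y).1 =
      CP.ofVec (Q.vec (cplx y.1) (Complex.I * (√(1 - y.1.2 ⬝ᵥ y.1.2) : ℝ))) := fun y hy =>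
    Q.ofVec_val (Q.vec_ne_zero (cplx_ne_zero y) _) (by rw [Q.sum_vec, toQuadric_cone hy])
  have := h.continuousWithinAt (s := {x | energy x ≤ 1})
  rw [ContinuousWithinAt, ← hval x hx] at this
  refine this.congr' ?_
  filter_upwards [self_mem_nhdsWithin] with y hy
  exact (hval y hy).symm

/-- The local inverse of `toQuadric` off the hyperplane at infinity. -/
def fromQuadric (z : Q n) : TS n :=
  ofQuadric fun k => Complex.I *
    CP.normalize (LinearMap.proj (Fin.last (n + 1))) z.1 k.castSucc

theorem fromQuadric_pt {Z : Fin (n + 1) → ℂ} {ζ : ℂ} (hZ : Z ≠ 0) (h : ∑ k, Z k ^ 2 + ζ ^ 2 = 0) :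
    fromQuadric (Q.pt Z ζ) = ofQuadric ((Complex.I * ζ⁻¹) • Z) := by
  rw [fromQuadric, Q.pt, Q.ofVec_val (Q.vec_ne_zero hZ ζ) (by rw [Q.sum_vec, h]),
    CP.normalize_ofVec _ (Q.vec_ne_zero hZ ζ)]
  congr 1
  ext k
  simp
  ring

theorem energy_antipode_le {x : TS n} (hx : energy x ≤ 1) : energy (antipode x) ≤ 1 := by
  rwa [energy_antipode]

/-- Off the hyperplane ζ = 0 the representative with last coordinate i has Z·Z = 1. So Re Z does not
vanish there, and division by |Re Z| is smooth; this gives the inverse on all of {ζ ≠ 0}. -/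
theorem isLocalDiffeomorphAt_toQuadric {x : TS n} (hx : energy x < 1) :
    IsLocalDiffeomorphAt 𝓘(ℝ, TModel n) 𝓘(ℝ, Fin n → ℂ) ∞ (toQuadric (n := n)) x := by
  let l : (Fin (n + 2) → ℂ) →ₗ[ℂ] ℂ := LinearMap.proj (Fin.last (n + 1))
  have hmem : ∀ (Z : Fin (n + 1) → ℂ) (ζ : ℂ), Z ≠ 0 → ∑ k, Z k ^ 2 + ζ ^ 2 = 0 →
      (l (Q.pt Z ζ).1.rep ≠ 0 ↔ ζ ≠ 0) := fun Z ζ hZ h => by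
    rw [Q.pt, Q.ofVec_val (Q.vec_ne_zero hZ ζ) (by rw [Q.sum_vec, h]),
      CP.ofVec_eq (Q.vec_ne_zero hZ ζ), CP.ne_zero_mk_iff]
    simp [l]
  have hpos : ∀ y : TS n, energy y < 1 → 0 < 1 - y.1.2 ⬝ᵥ y.1.2 := fun y hy => by
    linarith [energy_lt_one.1 hy]
  have hU : IsOpen {y : TS n | energy y < 1} := isOpen_lt continuous_energy continuous_const
  have hone : ∀ (Z : Fin (n + 1) → ℂ) (ζ : ℂ), ζ ≠ 0 → ∑ k, Z k ^ 2 + ζ ^ 2 = 0 →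
      ∑ k, ((Complex.I * ζ⁻¹) • Z) k ^ 2 = ((1 ^ 2 : ℝ) : ℂ) := fun Z ζ h0 h => by
    simp only [Pi.smul_apply, smul_eq_mul, mul_pow, ← Finset.mul_sum, Complex.I_sq]
    push_cast
    field_simp
    linear_combination -h
  refine isLocalDiffeomorphAt_of_inverse (U := {y : TS n | energy y < 1})
    (W := {z : Q n | l z.1.rep ≠ 0}) (g := fromQuadric) hU
    ((CP.isOpen_ne_zero l).preimage continuous_subtype_val) hx ?_ ?_ ?_ ?_ ?_
  · intro y hy
    refine (hmem _ _ (cplx_ne_zero y) (toQuadric_cone hy.le)).2 (mul_ne_zero Complex.I_ne_zero ?_)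
    exact_mod_cast (Real.sqrt_pos.2 (hpos y hy)).ne'
  · intro y hy
    refine ContMDiffAt.contMDiffWithinAt ?_
    have hs : ContDiffAt ℝ ∞ (fun z : (Fin (n + 1) → ℝ) × (Fin (n + 1) → ℝ) =>
        Q.vec (cplx z) (Complex.I * (√(1 - z.2 ⬝ᵥ z.2) : ℝ))) y.1 := by
      have h1 : ContDiffAt ℝ ∞ (fun z : (Fin (n + 1) → ℝ) × (Fin (n + 1) → ℝ) =>
          √(1 - z.2 ⬝ᵥ z.2)) y.1 :=
        (contDiffAt_const.sub contDiff_snd_dot.contDiffAt).sqrt (hpos y hy).ne'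
      exact (Q.contDiff_vec (𝕜 := ℝ)).contDiffAt.comp y.1 (contDiff_cplx.contDiffAt.prodMk
        (contDiffAt_const.mul (Complex.ofRealCLM.contDiff.contDiffAt.comp y.1 h1)))
    refine Q.contMDiffAt_ofVec (hs.contMDiffAt.comp y contMDiff_val.contMDiffAt)
      (Q.vec_ne_zero (cplx_ne_zero y) _) ?_
    filter_upwards [hU.mem_nhds hy] with z hz
    exact (Q.sum_vec _ _).trans (toQuadric_cone hz.le)
  · intro z hz
    refine ContMDiffAt.contMDiffWithinAt (contMDiffAt_of_val ?_)
    have hN : ContMDiffAt 𝓘(ℝ, Fin n → ℂ) 𝓘(ℝ, Fin (n + 2) → ℂ) ∞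
        (fun y : Q n => CP.normalize l y.1) z :=
      (CP.contMDiffAt_normalize (𝕜 := ℝ) (m := ∞) l hz).comp z Q.contMDiff_val.contMDiffAt
    let Y : (Fin (n + 2) → ℂ) → Fin (n + 1) → ℂ := fun v k => Complex.I * v k.castSucc
    have hY : ContDiff ℝ ∞ Y :=
      contDiff_pi.2 fun k => contDiff_const.mul (contDiff_apply ℝ ℂ _)
    have hval : ∀ y : Q n, l y.1.rep ≠ 0 → Y (CP.normalize l y.1) ≠ 0 ∧
        ∑ k, Y (CP.normalize l y.1) k ^ 2 = ((1 ^ 2 : ℝ) : ℂ) := by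
      intro y hy
      obtain ⟨Z, ζ, hZ, h, rfl⟩ := Q.exists_pt y
      have hζ := (hmem Z ζ hZ h).1 hy
      have : Y (CP.normalize l (Q.pt Z ζ).1) = (Complex.I * ζ⁻¹) • Z := by
        rw [Q.pt, Q.ofVec_val (Q.vec_ne_zero hZ ζ) (by rw [Q.sum_vec, h]),
          CP.normalize_ofVec _ (Q.vec_ne_zero hZ ζ)]
        ext k
        simp [Y, l]
        ring
      rw [this]
      exact ⟨smul_ne_zero (mul_ne_zero Complex.I_ne_zero (inv_ne_zero hζ)) hZ, hone Z ζ hζ h⟩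
    have hd : ContDiffAt ℝ ∞ (fun v : Fin (n + 2) → ℂ =>
        (√((reIm (Y v)).1 ⬝ᵥ (reIm (Y v)).1))⁻¹ • reIm (Y v)) (CP.normalize l z.1) := by
      have h1 : ContDiff ℝ ∞ fun v => reIm (Y v) := contDiff_reIm.comp hY
      have h2 : ContDiff ℝ ∞ fun v => (reIm (Y v)).1 ⬝ᵥ (reIm (Y v)).1 :=
        contDiff_dotProduct.comp (h1.fst.prodMk h1.fst)
      have hp := re_dot_pos (hval z hz).1 (hval z hz).2
      exact ((h2.contDiffAt.sqrt hp.ne').inv (Real.sqrt_pos.2 hp).ne').smul h1.contDiffAt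
    refine (hd.contMDiffAt.comp z hN).congr_of_eventuallyEq ?_
    filter_upwards [((CP.isOpen_ne_zero l).preimage continuous_subtype_val).mem_nhds hz] with y hy
    exact ofQuadric_val (hval y hy).1 (hval y hy).2
  · intro y hy
    have hu := Real.sqrt_pos.2 (hpos y hy)
    have hu' : (√(1 - y.1.2 ⬝ᵥ y.1.2) : ℂ) ≠ 0 := by exact_mod_cast hu.ne'
    have hζ := mul_ne_zero Complex.I_ne_zero hu'
    rw [toQuadric, fromQuadric_pt (cplx_ne_zero y) (toQuadric_cone hy.le)]
    apply Subtype.ext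
    rw [ofQuadric_val (w := 1)
      (smul_ne_zero (mul_ne_zero Complex.I_ne_zero (inv_ne_zero hζ)) (cplx_ne_zero y))
      (hone _ _ hζ (toQuadric_cone hy.le))]
    have he : (Complex.I * (Complex.I * (√(1 - y.1.2 ⬝ᵥ y.1.2) : ℝ))⁻¹) • cplx y.1 =
        cplx ((√(1 - y.1.2 ⬝ᵥ y.1.2))⁻¹ • y.1) := by
      rw [cplx_smul]
      congr 1
      push_cast
      field_simp [Complex.I_ne_zero]
    rw [he, reIm_cplx]
    simp only [Prod.smul_fst, smul_dotProduct, dotProduct_smul, y.2.1, smul_eq_mul, mul_one]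
    rw [Real.sqrt_mul_self (inv_pos.2 hu).le, inv_inv, smul_smul, mul_inv_cancel₀ hu.ne', one_smul]
  · intro z hz
    obtain ⟨Z, ζ, hZ, h, rfl⟩ := Q.exists_pt z
    have hζ := (hmem Z ζ hZ h).1 hz
    have ha : Complex.I * ζ⁻¹ ≠ 0 := mul_ne_zero Complex.I_ne_zero (inv_ne_zero hζ)
    rw [fromQuadric_pt hZ h,
      (toQuadric_ofQuadric zero_le_one (smul_ne_zero ha hZ) (hone Z ζ hζ h)).2,
      ← Q.pt_smul ha hZ h]
    congr 1
    rw [mul_assoc, inv_mul_cancel₀ hζ, Complex.ofReal_one]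

end TS

end

/-! ### The homeomorphisms of the cut disc bundles -/

noncomputable section

namespace TS

variable {n : ℕ}

theorem isCompact_energy_le_one (n : ℕ) : IsCompact {x : TS n | energy x ≤ 1} := by
  rw [IsInducing.subtypeVal.isCompact_iff]
  have himg : (Subtype.val '' {x : TS n | energy x ≤ 1}) =
      {x : (Fin (n + 1) → ℝ) × (Fin (n + 1) → ℝ) |
        x.1 ⬝ᵥ x.1 = 1 ∧ x.1 ⬝ᵥ x.2 = 0 ∧ x.2 ⬝ᵥ x.2 ≤ 1} := by
    ext x
    constructor
    · rintro ⟨y, hy, rfl⟩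
      exact ⟨y.2.1, y.2.2, energy_le_one.1 hy⟩
    · rintro ⟨h1, h2, h3⟩
      exact ⟨⟨x, h1, h2⟩, energy_le_one.2 h3, rfl⟩
  rw [himg]
  have hb : ∀ v : Fin (n + 1) → ℝ, v ⬝ᵥ v ≤ 1 → ‖v‖ ≤ 1 := fun v hv => by
    refine (pi_norm_le_iff_of_nonneg zero_le_one).2 fun i => ?_
    have h1 : v i * v i ≤ v ⬝ᵥ v :=
      Finset.single_le_sum (f := fun i => v i * v i) (fun _ _ => mul_self_nonneg _)
        (Finset.mem_univ i)
    rw [Real.norm_eq_abs]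
    exact abs_le_one_iff_mul_self_le_one.2 (h1.trans hv)
  refine Metric.isCompact_of_isClosed_isBounded ?_ ?_
  · have hc : Continuous fun x : (Fin (n + 1) → ℝ) × (Fin (n + 1) → ℝ) => x.1 ⬝ᵥ x.1 := by
      unfold dotProduct; fun_prop
    exact (isClosed_eq hc continuous_const).inter
      ((isClosed_eq contDiff_dotProduct.continuous continuous_const).inter
        (isClosed_le contDiff_snd_dot.continuous continuous_const))
  · refine (Metric.isBounded_closedBall (x := 0) (r := 1)).subset fun x hx => ?_
    rw [mem_closedBall_zero_iff, Prod.norm_def]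
    exact max_le (hb _ hx.1.le) (hb _ hx.2.2)

/-- The map `f` from `T^*S^n` to the quadric identifies the cut disc bundle with the quadric,
compatibly with the double covers. -/
structure IsDiscModel (f : TS n → Q n) : Prop where
  continuousOn : ContinuousOn f {x | energy x ≤ 1}
  surj : ∀ z, ∃ x, energy x ≤ 1 ∧ f x = z
  eq_iff : ∀ x y, energy x ≤ 1 → energy y ≤ 1 →
    (f x = f y ↔ x = y ∨ (energy x = 1 ∧ energy y = 1 ∧ ∃ t, flow t x = y))
  proj_eq_iff : ∀ x y, energy x ≤ 1 → energy y ≤ 1 →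
    (Q.proj n (f x) = Q.proj n (f y) ↔ f x = f y ∨ f x = f (antipode y))
  proj_mem_iff : ∀ x, energy x ≤ 1 → (Q.proj n (f x) ∈ quadric n ↔ energy x = 1)
  isLocalDiffeomorphAt : ∀ x, energy x < 1 →
    IsLocalDiffeomorphAt 𝓘(ℝ, TModel n) 𝓘(ℝ, Fin n → ℂ) ∞ f x

theorem isDiscModel_toQuadric (n : ℕ) : IsDiscModel (toQuadric (n := n)) where
  continuousOn := continuousOn_toQuadric
  surj := exists_toQuadric_eq
  eq_iff _ _ := toQuadric_eq_iff
  proj_eq_iff _ _ := proj_toQuadric_eq_iff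
  proj_mem_iff _ := proj_toQuadric_mem_iff
  isLocalDiffeomorphAt _ := isLocalDiffeomorphAt_toQuadric

instance instCompactSpaceDisc (n : ℕ) : CompactSpace {x : TS n // energy x ≤ 1} :=
  isCompact_iff_compactSpace.1 (isCompact_energy_le_one n)

end TS

section Homeomorphisms

variable {n : ℕ}

theorem continuous_discCover (n : ℕ) : Continuous (discCover n) :=
  ((TRP.isQuotientMap_cover n).continuous.comp continuous_subtype_val).subtype_mk _

theorem discCover_surjective (n : ℕ) : Function.Surjective (discCover n) := by
  rintro ⟨y, hy⟩
  obtain ⟨x, rfl⟩ := TRP.cover_surjective n y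
  exact ⟨⟨x, hy⟩, rfl⟩

theorem isQuotientMap_discCover (n : ℕ) : IsQuotientMap (discCover n) := by
  have h : IsClosedMap ({y : TRP n | TRP.energy y ≤ 1}.restrictPreimage (TRP.cover n)) :=
    (TRP.isClosedMap_cover n).restrictPreimage _
  exact IsClosedMap.isQuotientMap h (continuous_discCover n) (discCover_surjective n)

instance TRP.instCompactSpaceDisc (n : ℕ) : CompactSpace {y : TRP n // TRP.energy y ≤ 1} :=
  ⟨by
    rw [← (discCover_surjective n).range_eq]
    exact isCompact_range (continuous_discCover n)⟩

instance CutSpace.instCompactSpace {M : Type*} [TopologicalSpace M] (H : M → ℝ) (σ : ℝ → M → M)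
    (s : ℝ) [CompactSpace {x : M // H x ≤ s}] : CompactSpace (CutSpace H σ s) :=
  inferInstanceAs (CompactSpace (Quot _))

/-- A continuous map on `{H ≤ s}` whose fibres are the points of `{H < s}` and the orbits in
`{H = s}` induces a homeomorphism of the cut space. -/
theorem CutSpace.exists_homeomorph {M N : Type*} [TopologicalSpace M] [TopologicalSpace N]
    [T2Space N] {H : M → ℝ} {σ : ℝ → M → M} {s : ℝ} [CompactSpace {x : M // H x ≤ s}]
    {g : {x : M // H x ≤ s} → N} (hg : Continuous g) (hs : Function.Surjective g)
    (hr : ∀ x y, g x = g y ↔ x = y ∨ (H x = s ∧ H y = s ∧ ∃ t, σ t x = y)) :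
    ∃ Φ : CutSpace H σ s ≃ₜ N, ∀ x, Φ (CutSpace.mk H σ s x) = g x := by
  let G : CutSpace H σ s → N := Quot.lift g fun x y h => (hr x y).2 (Or.inr h)
  have hG : Continuous G := continuous_quot_lift _ hg
  have hb : Function.Bijective G := by
    constructor
    · rintro ⟨x⟩ ⟨y⟩ h
      rcases (hr x y).1 h with rfl | h
      · rfl
      · exact Quot.sound h
    · intro z
      obtain ⟨x, rfl⟩ := hs z
      exact ⟨CutSpace.mk H σ s x, rfl⟩
  exact ⟨Continuous.homeoOfEquivCompactToT2 (f := Equiv.ofBijective G hb) hG, fun x => rfl⟩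

namespace TS.IsDiscModel

variable {f : TS n → Q n}

/-- The map of `T^*RP^n` covered by `f`. -/
def descend (f : TS n → Q n) (y : TRP n) : CP n := Q.proj n (f (Quotient.out y))

theorem descend_cover (hf : IsDiscModel f) {x : TS n} (hx : energy x ≤ 1) :
    descend f (TRP.cover n x) = Q.proj n (f x) := by
  have h : Quotient.out (TRP.cover n x) = x ∨ Quotient.out (TRP.cover n x) = antipode x :=
    TRP.cover_eq_iff.1 (Quotient.out_eq (TRP.cover n x)).symm
  rw [descend]
  rcases h with h | h
  · rw [h]
  · rw [h]
    exact (hf.proj_eq_iff _ _ (energy_antipode_le hx) hx).2 (Or.inr rfl)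

/-- A fibre of the composite consists of a fibre of f and its antipodal image, which is precisely an
orbit of the flow, or a single point, in the quotient. -/
theorem descend_eq_iff (hf : IsDiscModel f) {x y : TS n} (hx : energy x ≤ 1) (hy : energy y ≤ 1) :
    descend f (TRP.cover n x) = descend f (TRP.cover n y) ↔
      TRP.cover n x = TRP.cover n y ∨ (energy x = 1 ∧ energy y = 1 ∧
        ∃ t, TRP.flow t (TRP.cover n x) = TRP.cover n y) := by
  rw [hf.descend_cover hx, hf.descend_cover hy, hf.proj_eq_iff _ _ hx hy, hf.eq_iff _ _ hx hy,
    hf.eq_iff _ _ hx (energy_antipode_le hy), energy_antipode]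
  have hc : TRP.cover n x = TRP.cover n y ↔ x = y ∨ x = antipode y := by
    rw [eq_comm, TRP.cover_eq_iff]
  have hfl : ∀ t, TRP.flow t (TRP.cover n x) = TRP.cover n y ↔
      flow t x = y ∨ flow t x = antipode y := fun t => by
    rw [TRP.flow_cover, eq_comm, TRP.cover_eq_iff]
  simp only [hc, hfl, exists_or]
  tauto

theorem exists_extendsDoubleCover (hf : IsDiscModel f) :
    ∃ (Ψ : CutTS n ≃ₜ Q n) (Φ : CutTRP n ≃ₜ CP n), ExtendsDoubleCover Ψ Φ ∧
      (∀ x : {x : TS n // energy x ≤ 1}, Ψ (CutSpace.mk _ _ _ x) = f x) ∧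
      ∀ y : {y : TRP n // TRP.energy y ≤ 1}, Φ (CutSpace.mk _ _ _ y) = descend f y := by
  obtain ⟨Ψ, hΨ⟩ := CutSpace.exists_homeomorph (H := energy (n := n)) (σ := flow) (s := 1)
    (g := fun x => f x) (continuousOn_iff_continuous_domRestrict.1 hf.continuousOn)
    (fun z => by
      obtain ⟨x, hx, hz⟩ := hf.surj z
      exact ⟨⟨x, hx⟩, hz⟩)
    (fun x y => (hf.eq_iff _ _ x.2 y.2).trans (or_congr_left Subtype.ext_iff.symm))
  have hpc : Continuous (Q.proj n) := (Q.contMDiff_proj (𝕜 := ℂ) (m := ω)).continuous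
  obtain ⟨Φ, hΦ⟩ := CutSpace.exists_homeomorph (H := TRP.energy (n := n)) (σ := TRP.flow) (s := 1)
    (g := fun y => descend f y)
    (by
      rw [(isQuotientMap_discCover n).continuous_iff]
      refine (hpc.comp (continuousOn_iff_continuous_domRestrict.1 hf.continuousOn)).congr ?_
      intro x
      exact (hf.descend_cover x.2).symm)
    (fun z => by
      -- Surjectivity of the projection is read off from the fibres of the branched cover: one point
      -- over the branch locus, two elsewhere.
      obtain ⟨w, hw⟩ : ∃ w, Q.proj n w = z := by
        by_cases hz : z ∈ quadric n
        · exact ((Q.isBranchedDoubleCover n).existsUnique z hz).exists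
        · have h2 := (Q.isBranchedDoubleCover n).ncard_fiber z hz
          obtain ⟨w, hw⟩ : (Q.proj n ⁻¹' {z}).Nonempty :=
            nonempty_of_ncard_ne_zero (by rw [h2]; exact two_ne_zero)
          exact ⟨w, hw⟩
      obtain ⟨x, hx, rfl⟩ := hf.surj w
      exact ⟨discCover n ⟨x, hx⟩, (hf.descend_cover hx).trans hw⟩)
    (fun y₁ y₂ => by
      obtain ⟨x₁, rfl⟩ := discCover_surjective n y₁
      obtain ⟨x₂, rfl⟩ := discCover_surjective n y₂
      rw [Subtype.ext_iff]
      exact hf.descend_eq_iff x₁.2 x₂.2)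
  refine ⟨Ψ, Φ, ⟨fun x => ?_, fun y => ?_, ⟨f, fun x => (hΨ x).symm, fun x => ?_⟩,
    ⟨descend f, fun y => (hΦ y).symm, fun y => ?_⟩⟩, hΨ, hΦ⟩
  · rw [hΨ, hΦ]
    exact (hf.descend_cover x.2).symm
  · obtain ⟨x, rfl⟩ := discCover_surjective n y
    rw [hΦ]
    exact (iff_of_eq (congrArg (· ∈ quadric n) (hf.descend_cover x.2))).trans
      (hf.proj_mem_iff _ x.2)
  · exact hf.isLocalDiffeomorphAt _ x.2
  · obtain ⟨y, hy⟩ := y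
    obtain ⟨x, rfl⟩ := TRP.cover_surjective n y
    have hx : energy x < 1 := hy
    -- Pulled back to T^*S^n the map is the projection after `f`, and over the open disc bundle the
    -- projection is unramified.
    refine (TRP.isLocalDiffeomorph_cover n x).of_comp_right ?_
    have hp : Q.proj n (f x) ∉ quadric n := fun h =>
      hx.ne ((hf.proj_mem_iff _ hx.le).1 h)
    have h1 : IsLocalDiffeomorphAt 𝓘(ℝ, Fin n → ℂ) 𝓘(ℝ, Fin n → ℂ) ∞ (Q.proj n) (f x) :=
      ((Q.isLocalDiffeomorphAt_proj hp).restrict_scalars_real).of_le le_top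
    refine ((hf.isLocalDiffeomorphAt _ hx).comp 𝓘(ℝ, Fin n → ℂ) (CP n)
      h1).congr_of_eventuallyEq ?_
    filter_upwards [(isOpen_lt continuous_energy continuous_const).mem_nhds hx] with z hz
    exact hf.descend_cover (le_of_lt hz)

end TS.IsDiscModel

end Homeomorphisms

/-! ### Radial reparametrization of the disc bundle -/

namespace TS

variable {n : ℕ}

/-- Multiplication of the covector by `c`. -/
def scale (c : ℝ) (x : TS n) : TS n :=
  ⟨(x.1.1, c • x.1.2), x.2.1, by
    change x.1.1 ⬝ᵥ (c • x.1.2) = 0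
    rw [dotProduct_smul, x.2.2, smul_zero]⟩

theorem scale_val (c : ℝ) (x : TS n) : (scale c x).1 = (x.1.1, c • x.1.2) := rfl

theorem scale_one (x : TS n) : scale 1 x = x := Subtype.ext (by rw [scale_val, one_smul])

theorem scale_scale (c d : ℝ) (x : TS n) : scale c (scale d x) = scale (c * d) x :=
  Subtype.ext (by simp only [scale_val, smul_smul])

theorem scale_antipode (c : ℝ) (x : TS n) : scale c (antipode x) = antipode (scale c x) :=
  Subtype.ext (by ext <;> simp [scale_val, antipode])

theorem dot_scale (c : ℝ) (x : TS n) :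
    (scale c x).1.2 ⬝ᵥ (scale c x).1.2 = c ^ 2 * (x.1.2 ⬝ᵥ x.1.2) := by
  simp only [scale_val, smul_dotProduct, dotProduct_smul, smul_eq_mul]
  ring

/-- The factor `1 / (1 + √(1 - |q|²))`. -/
def shrinkFactor (x : TS n) : ℝ := (1 + √(1 - x.1.2 ⬝ᵥ x.1.2))⁻¹

/-- The factor `2 / (1 + |q|²)`. -/
def expandFactor (x : TS n) : ℝ := 2 / (1 + x.1.2 ⬝ᵥ x.1.2)

/-- The map `(p, q) ↦ (p, q / (1 + √(1 - |q|²)))`. -/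
def shrink (x : TS n) : TS n := scale (shrinkFactor x) x

/-- The map `(p, q) ↦ (p, 2 q / (1 + |q|²))`, inverse to `shrink` on the disc bundle. -/
def expand (x : TS n) : TS n := scale (expandFactor x) x

theorem dot_snd_nonneg (x : TS n) : 0 ≤ x.1.2 ⬝ᵥ x.1.2 :=
  Finset.sum_nonneg fun _ _ => mul_self_nonneg _

/-- If |q| = sin θ with 0 ≤ θ ≤ π/2, the new norm is tan(θ/2); the inverse is the formula sin θ =
2t/(1 + t²) with t = tan(θ/2). -/
theorem dot_shrink {x : TS n} (hx : energy x ≤ 1) :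
    (shrink x).1.2 ⬝ᵥ (shrink x).1.2 =
      (1 - √(1 - x.1.2 ⬝ᵥ x.1.2)) / (1 + √(1 - x.1.2 ⬝ᵥ x.1.2)) := by
  have h0 : 0 ≤ 1 - x.1.2 ⬝ᵥ x.1.2 := by linarith [energy_le_one.1 hx]
  have hs := Real.sq_sqrt h0
  have hu := Real.sqrt_nonneg (1 - x.1.2 ⬝ᵥ x.1.2)
  rw [shrink, dot_scale, shrinkFactor]
  field_simp
  linear_combination hs

theorem dot_expand (x : TS n) :
    1 - (expand x).1.2 ⬝ᵥ (expand x).1.2 =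
      ((1 - x.1.2 ⬝ᵥ x.1.2) / (1 + x.1.2 ⬝ᵥ x.1.2)) ^ 2 := by
  have h0 := dot_snd_nonneg x
  rw [expand, dot_scale, expandFactor]
  field_simp
  ring

theorem energy_shrink_le {x : TS n} (hx : energy x ≤ 1) : energy (shrink x) ≤ 1 := by
  have hu := Real.sqrt_nonneg (1 - x.1.2 ⬝ᵥ x.1.2)
  rw [energy_le_one, dot_shrink hx, div_le_one (by linarith)]
  linarith

theorem energy_shrink_lt {x : TS n} (hx : energy x < 1) : energy (shrink x) < 1 := by
  have hu : 0 < √(1 - x.1.2 ⬝ᵥ x.1.2) := Real.sqrt_pos.2 (by linarith [energy_lt_one.1 hx])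
  rw [energy_lt_one, dot_shrink hx.le, div_lt_one (by linarith)]
  linarith

theorem energy_expand_le (x : TS n) : energy (expand x) ≤ 1 := by
  rw [energy_le_one]
  nlinarith [dot_expand x, sq_nonneg ((1 - x.1.2 ⬝ᵥ x.1.2) / (1 + x.1.2 ⬝ᵥ x.1.2))]

theorem shrink_of_energy_eq_one {x : TS n} (hx : energy x = 1) : shrink x = x := by
  rw [shrink, shrinkFactor, energy_eq_one.1 hx]
  simp [scale_one]

theorem expand_shrink {x : TS n} (hx : energy x ≤ 1) : expand (shrink x) = x := by
  have hu := Real.sqrt_nonneg (1 - x.1.2 ⬝ᵥ x.1.2)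
  rw [expand, expandFactor, dot_shrink hx, shrink, scale_scale, shrinkFactor]
  convert scale_one x using 2
  field_simp
  ring

theorem shrink_expand {x : TS n} (hx : energy x ≤ 1) : shrink (expand x) = x := by
  have h0 := dot_snd_nonneg x
  have h1 : 0 ≤ 1 - x.1.2 ⬝ᵥ x.1.2 := by linarith [energy_le_one.1 hx]
  rw [shrink, shrinkFactor, dot_expand x, Real.sqrt_sq (by positivity), expand, scale_scale,
    expandFactor]
  convert scale_one x using 2
  field_simp
  ring

theorem energy_shrink_eq_one_iff {x : TS n} (hx : energy x ≤ 1) :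
    energy (shrink x) = 1 ↔ energy x = 1 := by
  refine ⟨fun h => ?_, fun h => by rw [shrink_of_energy_eq_one h, h]⟩
  by_contra hne
  exact (energy_shrink_lt (lt_of_le_of_ne hx hne)).ne h

theorem shrink_antipode (x : TS n) : shrink (antipode x) = antipode (shrink x) := by
  rw [shrink, scale_antipode, shrink]
  simp [shrinkFactor, antipode]

theorem continuous_shrink : Continuous (shrink : TS n → TS n) := by
  have hd : Continuous fun x : TS n => x.1.2 ⬝ᵥ x.1.2 :=
    contDiff_snd_dot.continuous.comp continuous_subtype_val
  have h1 : Continuous (shrinkFactor : TS n → ℝ) :=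
    (continuous_const.add (continuous_const.sub hd).sqrt).inv₀ fun x =>
      (add_pos_of_pos_of_nonneg one_pos (Real.sqrt_nonneg _)).ne'
  exact (continuous_subtype_val.fst.prodMk (h1.smul continuous_subtype_val.snd)).subtype_mk _

theorem isLocalDiffeomorphAt_shrink {x : TS n} (hx : energy x < 1) :
    IsLocalDiffeomorphAt 𝓘(ℝ, TModel n) 𝓘(ℝ, TModel n) ∞ (shrink (n := n)) x := by
  let A := (Fin (n + 1) → ℝ) × (Fin (n + 1) → ℝ)
  have hU : IsOpen {y : TS n | energy y < 1} := isOpen_lt continuous_energy continuous_const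
  refine isLocalDiffeomorphAt_of_inverse (U := {y : TS n | energy y < 1})
    (W := {y : TS n | energy y < 1}) (g := expand) hU hU hx (fun y hy => energy_shrink_lt hy)
    (fun y hy => (contMDiffAt_of_val ?_).contMDiffWithinAt)
    (fun y hy => (contMDiffAt_of_val ?_).contMDiffWithinAt)
    (fun y hy => expand_shrink (le_of_lt hy)) (fun y hy => shrink_expand (le_of_lt hy))
  · have hy' : 0 < 1 - y.1.2 ⬝ᵥ y.1.2 := by linarith [energy_lt_one.1 hy]
    have h1 : ContDiffAt ℝ ∞ (fun z : A => (z.1, (1 + √(1 - z.2 ⬝ᵥ z.2))⁻¹ • z.2)) y.1 :=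
      contDiffAt_fst.prodMk (((contDiffAt_const.add
        ((contDiffAt_const.sub contDiff_snd_dot.contDiffAt).sqrt hy'.ne')).inv
        (by positivity)).smul contDiffAt_snd)
    exact h1.contMDiffAt.comp y contMDiff_val.contMDiffAt
  · have h0 := dot_snd_nonneg y
    have h1 : ContDiffAt ℝ ∞ (fun z : A => (z.1, (2 / (1 + z.2 ⬝ᵥ z.2)) • z.2)) y.1 :=
      contDiffAt_fst.prodMk ((contDiffAt_const.div
        (contDiffAt_const.add contDiff_snd_dot.contDiffAt) (by positivity)).smul contDiffAt_snd)
    exact h1.contMDiffAt.comp y contMDiff_val.contMDiffAt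

/-- `shrink` is a diffeomorphism of the open disc bundle, commutes with the antipodal map and fixes
the boundary pointwise, so every clause survives. Its square root is not smooth at |q| = 1, which is
how it adapts the model to the other cut. -/
theorem IsDiscModel.comp_shrink {f : TS n → Q n} (hf : IsDiscModel f) :
    IsDiscModel fun x => f (shrink x) where
  continuousOn := hf.continuousOn.comp continuous_shrink.continuousOn fun _ => energy_shrink_le
  surj z := by
    obtain ⟨x, hx, rfl⟩ := hf.surj z
    exact ⟨expand x, energy_expand_le x, by rw [shrink_expand hx]⟩
  eq_iff x y hx hy := by
    rw [hf.eq_iff _ _ (energy_shrink_le hx) (energy_shrink_le hy), energy_shrink_eq_one_iff hx,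
      energy_shrink_eq_one_iff hy]
    have h1 : shrink x = shrink y ↔ x = y :=
      ⟨fun h => by rw [← expand_shrink hx, h, expand_shrink hy], fun h => by rw [h]⟩
    rw [h1]
    refine or_congr_right (and_congr_right fun ex => and_congr_right fun ey => ?_)
    rw [shrink_of_energy_eq_one ex, shrink_of_energy_eq_one ey]
  proj_eq_iff x y hx hy := by
    rw [hf.proj_eq_iff _ _ (energy_shrink_le hx) (energy_shrink_le hy), shrink_antipode]
  proj_mem_iff x hx := by
    rw [hf.proj_mem_iff _ (energy_shrink_le hx), energy_shrink_eq_one_iff hx]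
  isLocalDiffeomorphAt x hx := (isLocalDiffeomorphAt_shrink hx).comp 𝓘(ℝ, Fin n → ℂ) (Q n)
    (hf.isLocalDiffeomorphAt _ (energy_shrink_lt hx))

end TS

end

/-! ### Decomposition of complex vectors into isotropic vectors -/

noncomputable section

section Isotropic

variable {N : ℕ}

/-- The sum of the squares of the entries. -/
def sumSq (Z : Fin N → ℂ) : ℂ := ∑ k, Z k ^ 2

/-- The square of the Hermitian norm. -/
def hermSq (Z : Fin N → ℂ) : ℝ := ∑ k, Complex.normSq (Z k)

/-- The vector `X + b X̄`. -/
def comb (X : Fin N → ℂ) (b : ℂ) : Fin N → ℂ := fun k => X k + b * starRingEnd ℂ (X k)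

theorem hermSq_eq (Z : Fin N → ℂ) : (hermSq Z : ℂ) = ∑ k, Z k * starRingEnd ℂ (Z k) := by
  simp [hermSq, Complex.mul_conj]

/-- All invariants of combinations of Z and Z̄ reduce to Z·Z, |Z|² and the conjugate of Z·Z; the
computations below are instances of this expansion. -/
theorem sum_mul_conj (Z : Fin N → ℂ) (α β γ δ : ℂ) :
    ∑ k, (α * Z k + β * starRingEnd ℂ (Z k)) * (γ * Z k + δ * starRingEnd ℂ (Z k)) =
      α * γ * sumSq Z + (α * δ + β * γ) * hermSq Z + β * δ * starRingEnd ℂ (sumSq Z) := by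
  rw [hermSq_eq, sumSq, map_sum, Finset.mul_sum, Finset.mul_sum, Finset.mul_sum,
    ← Finset.sum_add_distrib, ← Finset.sum_add_distrib]
  refine Finset.sum_congr rfl fun k _ => ?_
  rw [map_pow]
  ring

theorem sumSq_comb {X : Fin N → ℂ} (h : sumSq X = 0) (h' : hermSq X = 2) (b : ℂ) :
    sumSq (comb X b) = 4 * b := by
  have := sum_mul_conj X 1 b 1 b
  rw [h, h', map_zero] at this
  rw [sumSq]
  simp only [comb, sq]
  simp only [one_mul] at this
  rw [this]
  push_cast
  ring

theorem hermSq_comb {X : Fin N → ℂ} (h : sumSq X = 0) (h' : hermSq X = 2) (b : ℂ) :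
    hermSq (comb X b) = 2 * (1 + Complex.normSq b) := by
  have := sum_mul_conj X 1 b (starRingEnd ℂ b) 1
  rw [h, h', map_zero] at this
  apply Complex.ofReal_injective
  rw [hermSq_eq]
  push_cast
  rw [← Complex.mul_conj]
  simp only [comb, map_add, map_mul, Complex.conj_conj]
  simp only [one_mul] at this
  simp only [add_comm (starRingEnd ℂ (X _))]
  rw [this]
  push_cast
  ring

theorem comb_ne_zero {X : Fin N → ℂ} (h : sumSq X = 0) (h' : hermSq X = 2) (b : ℂ) :
    comb X b ≠ 0 := fun h0 => by
  have h1 := hermSq_comb h h' b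
  rw [h0] at h1
  have h2 : hermSq (0 : Fin N → ℂ) = 0 := by simp [hermSq]
  nlinarith [Complex.normSq_nonneg b]

/-- Turning X by a phase a turns X̄ by a⁻¹, so the coefficient must turn by a². This matches the
action on w in the reduction maps. -/
theorem comb_phase {a : ℂ} (ha : a * starRingEnd ℂ a = 1) (X : Fin N → ℂ) (b : ℂ) :
    comb (a • X) (a ^ 2 * b) = a • comb X b := by
  ext k
  simp only [comb, Pi.smul_apply, smul_eq_mul, map_mul]
  linear_combination (a * b * starRingEnd ℂ (X k)) * ha

/-- The vectors that are not complex multiples of real ones. -/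
def generic (N : ℕ) : Set (Fin N → ℂ) := {Z | Complex.normSq (sumSq Z) < hermSq Z ^ 2}

/-- The quantity `√(|Z|⁴ - |Z · Z|²) / |Z|²`. -/
def height (Z : Fin N → ℂ) : ℝ := √(hermSq Z ^ 2 - Complex.normSq (sumSq Z)) / hermSq Z

/-- The factor that brings `Z` to the form `X + b X̄` with `X` isotropic and `|X|² = 2`. -/
def factor (Z : Fin N → ℂ) : ℝ := 2 / √((1 + height Z) * hermSq Z)

/-- The coefficient `b` in this form of `Z`. -/
def coeff (Z : Fin N → ℂ) : ℂ := (factor Z : ℂ) ^ 2 * sumSq Z / 4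

/-- The vector `X` in this form of `Z`. -/
def isotropic (Z : Fin N → ℂ) : Fin N → ℂ := fun k =>
  ((1 - Complex.normSq (coeff Z))⁻¹ : ℝ) *
    (factor Z * Z k - coeff Z * (factor Z * starRingEnd ℂ (Z k)))

theorem hermSq_pos {Z : Fin N → ℂ} (hZ : Z ∈ generic N) : 0 < hermSq Z := by
  have h0 : 0 ≤ hermSq Z := Finset.sum_nonneg fun _ _ => Complex.normSq_nonneg _
  have h1 : 0 < hermSq Z ^ 2 := (Complex.normSq_nonneg _).trans_lt hZ
  exact lt_of_le_of_ne h0 fun h => by simp [← h] at h1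

theorem height_pos {Z : Fin N → ℂ} (hZ : Z ∈ generic N) : 0 < height Z :=
  div_pos (Real.sqrt_pos.2 (sub_pos.2 hZ)) (hermSq_pos hZ)

theorem height_sq {Z : Fin N → ℂ} (hZ : Z ∈ generic N) :
    height Z ^ 2 * hermSq Z ^ 2 = hermSq Z ^ 2 - Complex.normSq (sumSq Z) := by
  have h := hermSq_pos hZ
  rw [height, div_pow, Real.sq_sqrt (sub_pos.2 hZ).le, div_mul_cancel₀ _ (by positivity)]

theorem factor_pos {Z : Fin N → ℂ} (hZ : Z ∈ generic N) : 0 < factor Z := by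
  have h := hermSq_pos hZ
  have h' := height_pos hZ
  rw [factor]
  positivity

theorem factor_sq {Z : Fin N → ℂ} (hZ : Z ∈ generic N) :
    factor Z ^ 2 * ((1 + height Z) * hermSq Z) = 4 := by
  have h := hermSq_pos hZ
  have h' := height_pos hZ
  have h0 : 0 < (1 + height Z) * hermSq Z := by positivity
  rw [factor, div_pow, Real.sq_sqrt h0.le, div_mul_cancel₀ _ h0.ne']
  norm_num

/-- The same relation links the energy h to the coefficient b in the reduction map to CP^n, so there
`height` recovers the energy. -/
theorem normSq_coeff {Z : Fin N → ℂ} (hZ : Z ∈ generic N) :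
    Complex.normSq (coeff Z) = (1 - height Z) / (1 + height Z) := by
  have h := hermSq_pos hZ
  have h' := height_pos hZ
  have h1 := factor_sq hZ
  have h2 := height_sq hZ
  have e : Complex.normSq (coeff Z) = factor Z ^ 4 * Complex.normSq (sumSq Z) / 16 := by
    rw [coeff, Complex.normSq_div, Complex.normSq_mul, map_pow, Complex.normSq_ofReal]
    rw [show Complex.normSq (4 : ℂ) = 16 by
      rw [show (4 : ℂ) = ((4 : ℝ) : ℂ) by norm_num, Complex.normSq_ofReal]; norm_num]
    ring
  rw [e, eq_div_iff (by positivity)]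
  have hs : Complex.normSq (sumSq Z) = (1 - height Z) * ((1 + height Z) * hermSq Z ^ 2) := by
    linear_combination h2
  rw [hs]
  linear_combination ((1 - height Z) * (factor Z ^ 2 * ((1 + height Z) * hermSq Z) + 4) / 16) * h1

theorem factor_sq_mul_hermSq {Z : Fin N → ℂ} (hZ : Z ∈ generic N) :
    factor Z ^ 2 * hermSq Z = 2 * (1 + Complex.normSq (coeff Z)) := by
  have h' := height_pos hZ
  rw [normSq_coeff hZ]
  field_simp
  linear_combination factor_sq hZ

theorem one_sub_normSq_coeff_pos {Z : Fin N → ℂ} (hZ : Z ∈ generic N) :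
    0 < 1 - Complex.normSq (coeff Z) := by
  have h' := height_pos hZ
  rw [normSq_coeff hZ, sub_pos, div_lt_one (by positivity)]
  linarith

/-- `isotropic Z` solves the real-linear equation X + bX̄ = rZ, which is invertible because |b| < 1.
-/
theorem comb_isotropic {Z : Fin N → ℂ} (hZ : Z ∈ generic N) :
    comb (isotropic Z) (coeff Z) = (factor Z : ℂ) • Z := by
  have h : ((1 - Complex.normSq (coeff Z) : ℝ) : ℂ) ≠ 0 := by
    exact_mod_cast (one_sub_normSq_coeff_pos hZ).ne'
  ext k
  simp only [comb, isotropic, map_mul, map_sub, Complex.conj_conj, Complex.conj_ofReal,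
    Pi.smul_apply, smul_eq_mul]
  have e : ((1 - Complex.normSq (coeff Z) : ℝ) : ℂ) =
      1 - coeff Z * starRingEnd ℂ (coeff Z) := by
    rw [Complex.mul_conj]
    push_cast
    rfl
  rw [Complex.ofReal_inv]
  field_simp
  rw [e]
  ring

theorem isotropic_eq (Z : Fin N → ℂ) (k : Fin N) :
    isotropic Z k = (((1 - Complex.normSq (coeff Z))⁻¹ : ℝ) : ℂ) *
      ((factor Z : ℂ) * Z k + (-(coeff Z * factor Z)) * starRingEnd ℂ (Z k)) := by
  rw [isotropic]
  ring

/-- With r²(Z·Z) = 4b and r²|Z|² = 2(1 + |b|²), the square of rZ - b rZ̄ is 4b - 4b(1 + |b|²) +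
4b|b|² = 0. -/
theorem sumSq_isotropic {Z : Fin N → ℂ} (hZ : Z ∈ generic N) : sumSq (isotropic Z) = 0 := by
  have h1 := sum_mul_conj Z (factor Z) (-(coeff Z * factor Z)) (factor Z)
    (-(coeff Z * factor Z))
  have h2 : (factor Z : ℂ) ^ 2 * hermSq Z = 2 * (1 + coeff Z * starRingEnd ℂ (coeff Z)) := by
    rw [Complex.mul_conj]
    exact_mod_cast factor_sq_mul_hermSq hZ
  have h3 : (factor Z : ℂ) ^ 2 * sumSq Z = 4 * coeff Z := by rw [coeff]; ring
  have h4 : (factor Z : ℂ) ^ 2 * starRingEnd ℂ (sumSq Z) = 4 * starRingEnd ℂ (coeff Z) := by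
    simpa [map_ofNat] using congrArg (starRingEnd ℂ) h3
  rw [sumSq]
  simp only [isotropic_eq, mul_pow, ← Finset.mul_sum]
  simp only [sq (_ + _)]
  rw [h1]
  refine mul_eq_zero_of_right _ ?_
  linear_combination h3 - 2 * coeff Z * h2 + coeff Z ^ 2 * h4

/-- The squared norm of rZ - b rZ̄ is 2(1 + |b|²)² - 8|b|² = 2(1 - |b|²)², and the prefactor divides
by (1 - |b|²)². -/
theorem hermSq_isotropic {Z : Fin N → ℂ} (hZ : Z ∈ generic N) : hermSq (isotropic Z) = 2 := by
  have h1 := sum_mul_conj Z (factor Z) (-(coeff Z * factor Z))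
    (-(starRingEnd ℂ (coeff Z) * factor Z)) (factor Z)
  have h2 : (factor Z : ℂ) ^ 2 * hermSq Z = 2 * (1 + coeff Z * starRingEnd ℂ (coeff Z)) := by
    rw [Complex.mul_conj]
    exact_mod_cast factor_sq_mul_hermSq hZ
  have h3 : (factor Z : ℂ) ^ 2 * sumSq Z = 4 * coeff Z := by rw [coeff]; ring
  have h4 : (factor Z : ℂ) ^ 2 * starRingEnd ℂ (sumSq Z) = 4 * starRingEnd ℂ (coeff Z) := by
    simpa [map_ofNat] using congrArg (starRingEnd ℂ) h3
  have h5 : ((1 - Complex.normSq (coeff Z) : ℝ) : ℂ) ≠ 0 := by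
    exact_mod_cast (one_sub_normSq_coeff_pos hZ).ne'
  have e : ((1 - Complex.normSq (coeff Z) : ℝ) : ℂ) =
      1 - coeff Z * starRingEnd ℂ (coeff Z) := by
    rw [Complex.mul_conj]
    push_cast
    rfl
  apply Complex.ofReal_injective
  rw [hermSq_eq]
  have h6 : ∀ k, isotropic Z k * starRingEnd ℂ (isotropic Z k) =
      (((1 - Complex.normSq (coeff Z))⁻¹ : ℝ) : ℂ) ^ 2 *
      ((factor Z * Z k + -(coeff Z * factor Z) * starRingEnd ℂ (Z k)) *
      (-(starRingEnd ℂ (coeff Z) * factor Z) * Z k + factor Z * starRingEnd ℂ (Z k))) := by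
    intro k
    simp only [isotropic_eq, map_mul, map_add, map_neg, Complex.conj_conj, Complex.conj_ofReal]
    ring
  simp only [h6, ← Finset.mul_sum]
  rw [h1, Complex.ofReal_inv, inv_pow, inv_mul_eq_iff_eq_mul₀ (pow_ne_zero 2 h5), e]
  push_cast
  linear_combination -(starRingEnd ℂ (coeff Z)) * h3 +
    (1 + coeff Z * starRingEnd ℂ (coeff Z)) * h2 - coeff Z * h4

/-- The defining inequality amounts to 4(1 + |b|²)² - 16|b|² = 4(1 - |b|²)² > 0. -/
theorem comb_mem_generic {X : Fin N → ℂ} (h : sumSq X = 0) (h' : hermSq X = 2) {b : ℂ}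
    (hb : Complex.normSq b < 1) : comb X b ∈ generic N := by
  have h0 := Complex.normSq_nonneg b
  rw [generic, mem_ofPred_eq, sumSq_comb h h', hermSq_comb h h', Complex.normSq_mul,
    show Complex.normSq (4 : ℂ) = 16 by
      rw [show (4 : ℂ) = ((4 : ℝ) : ℂ) by norm_num, Complex.normSq_ofReal]; norm_num]
  nlinarith [sq_pos_of_pos (sub_pos.2 hb)]

theorem height_comb {X : Fin N → ℂ} (h : sumSq X = 0) (h' : hermSq X = 2) {b : ℂ}
    (hb : Complex.normSq b < 1) :
    height (comb X b) = (1 - Complex.normSq b) / (1 + Complex.normSq b) := by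
  have h0 := Complex.normSq_nonneg b
  rw [height, sumSq_comb h h', hermSq_comb h h', Complex.normSq_mul,
    show Complex.normSq (4 : ℂ) = 16 by
      rw [show (4 : ℂ) = ((4 : ℝ) : ℂ) by norm_num, Complex.normSq_ofReal]; norm_num,
    show (2 * (1 + Complex.normSq b)) ^ 2 - 16 * Complex.normSq b =
      (2 * (1 - Complex.normSq b)) ^ 2 by ring, Real.sqrt_sq (by linarith)]
  field_simp

theorem factor_comb {X : Fin N → ℂ} (h : sumSq X = 0) (h' : hermSq X = 2) {b : ℂ}
    (hb : Complex.normSq b < 1) : factor (comb X b) = 1 := by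
  have h0 := Complex.normSq_nonneg b
  rw [factor, height_comb h h' hb, hermSq_comb h h',
    show (1 + (1 - Complex.normSq b) / (1 + Complex.normSq b)) * (2 * (1 + Complex.normSq b)) =
      2 ^ 2 by field_simp; ring, Real.sqrt_sq two_pos.le, div_self two_ne_zero]

theorem coeff_comb {X : Fin N → ℂ} (h : sumSq X = 0) (h' : hermSq X = 2) {b : ℂ}
    (hb : Complex.normSq b < 1) : coeff (comb X b) = b := by
  rw [coeff, factor_comb h h' hb, sumSq_comb h h']
  push_cast
  ring

/-- With `factor_comb` and `coeff_comb` this is the uniqueness of the decomposition; it makes the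
sections below pass through the prescribed point. -/
theorem isotropic_comb {X : Fin N → ℂ} (h : sumSq X = 0) (h' : hermSq X = 2) {b : ℂ}
    (hb : Complex.normSq b < 1) : isotropic (comb X b) = X := by
  have h5 : ((1 - Complex.normSq b : ℝ) : ℂ) ≠ 0 := by
    exact_mod_cast (sub_pos.2 hb).ne'
  have e : ((1 - Complex.normSq b : ℝ) : ℂ) = 1 - b * starRingEnd ℂ b := by
    rw [Complex.mul_conj]
    push_cast
    rfl
  ext k
  rw [isotropic, coeff_comb h h' hb, factor_comb h h' hb, Complex.ofReal_inv,
    inv_mul_eq_iff_eq_mul₀ h5, e]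
  simp only [comb, map_add, map_mul, Complex.conj_conj]
  push_cast
  ring

theorem contDiff_sumSq : ContDiff ℝ ∞ (sumSq (N := N)) :=
  ContDiff.sum fun k _ => (contDiff_apply ℝ ℂ k).pow 2

theorem contDiff_normSq : ContDiff ℝ ∞ (fun z : ℂ => Complex.normSq z) := by
  simp only [Complex.normSq_apply]
  exact (Complex.reCLM.contDiff.mul Complex.reCLM.contDiff).add
    (Complex.imCLM.contDiff.mul Complex.imCLM.contDiff)

theorem contDiff_hermSq : ContDiff ℝ ∞ (hermSq (N := N)) :=
  ContDiff.sum fun k _ => contDiff_normSq.comp (contDiff_apply ℝ ℂ k)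

theorem isOpen_generic (N : ℕ) : IsOpen (generic N) :=
  isOpen_lt (contDiff_normSq.continuous.comp contDiff_sumSq.continuous)
    (contDiff_hermSq.continuous.pow 2)

theorem contDiffAt_height {Z : Fin N → ℂ} (hZ : Z ∈ generic N) : ContDiffAt ℝ ∞ height Z :=
  (((contDiff_hermSq.pow 2).sub (contDiff_normSq.comp contDiff_sumSq)).contDiffAt.sqrt
    (sub_pos.2 hZ).ne').div contDiff_hermSq.contDiffAt (hermSq_pos hZ).ne'

theorem contDiffAt_factor {Z : Fin N → ℂ} (hZ : Z ∈ generic N) : ContDiffAt ℝ ∞ factor Z := by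
  have h := hermSq_pos hZ
  have h' := height_pos hZ
  have h0 : 0 < (1 + height Z) * hermSq Z := by positivity
  exact contDiffAt_const.div (((contDiffAt_const.add (contDiffAt_height hZ)).mul
    contDiff_hermSq.contDiffAt).sqrt h0.ne') (Real.sqrt_pos.2 h0).ne'

theorem contDiffAt_ofReal_factor {Z : Fin N → ℂ} (hZ : Z ∈ generic N) :
    ContDiffAt ℝ ∞ (fun Z => (factor Z : ℂ)) Z :=
  Complex.ofRealCLM.contDiff.contDiffAt.comp Z (contDiffAt_factor hZ)

theorem contDiffAt_coeff {Z : Fin N → ℂ} (hZ : Z ∈ generic N) : ContDiffAt ℝ ∞ coeff Z := by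
  have h1 : ContDiffAt ℝ ∞ (fun Z : Fin N → ℂ => (factor Z : ℂ) ^ 2 * sumSq Z * 4⁻¹) Z :=
    (((contDiffAt_ofReal_factor hZ).pow 2).mul contDiff_sumSq.contDiffAt).mul contDiffAt_const
  exact h1.congr_of_eventuallyEq (.of_forall fun Z => div_eq_mul_inv _ _)

theorem contDiffAt_isotropic {Z : Fin N → ℂ} (hZ : Z ∈ generic N) :
    ContDiffAt ℝ ∞ isotropic Z := by
  rw [contDiffAt_pi]
  intro k
  have hc := contDiffAt_coeff hZ
  have hf := contDiffAt_ofReal_factor hZ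
  have hk : ContDiffAt ℝ ∞ (fun Z : Fin N → ℂ => Z k) Z := (contDiff_apply ℝ ℂ k).contDiffAt
  have hk' : ContDiffAt ℝ ∞ (fun Z : Fin N → ℂ => starRingEnd ℂ (Z k)) Z :=
    Complex.conjCLE.contDiff.contDiffAt.comp Z hk
  have hi : ContDiffAt ℝ ∞ (fun Z : Fin N → ℂ => (1 - Complex.normSq (coeff Z))⁻¹) Z :=
    (contDiffAt_const.sub (contDiff_normSq.contDiffAt.comp Z hc)).inv
      (one_sub_normSq_coeff_pos hZ).ne'
  exact (Complex.ofRealCLM.contDiff.contDiffAt.comp Z hi).mul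
    ((hf.mul hk).sub (hc.mul (hf.mul hk')))

end Isotropic

end

/-! ### Points of the cotangent bundle as isotropic vectors -/

noncomputable section

theorem contDiff_comb {N : ℕ} :
    ContDiff ℝ ∞ fun p : (Fin N → ℂ) × ℂ => comb p.1 p.2 := by
  rw [contDiff_pi]
  intro k
  have h : ContDiff ℝ ∞ fun p : (Fin N → ℂ) × ℂ => p.1 k :=
    (contDiff_apply ℝ ℂ k).comp contDiff_fst
  exact h.add (contDiff_snd.mul (Complex.conjCLE.contDiff.comp h))

theorem hermSq_cplx {N : ℕ} (x : (Fin N → ℝ) × (Fin N → ℝ)) :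
    hermSq (cplx x) = x.1 ⬝ᵥ x.1 + x.2 ⬝ᵥ x.2 := by
  simp only [hermSq, dotProduct, ← Finset.sum_add_distrib]
  refine Finset.sum_congr rfl fun k _ => ?_
  rw [cplx, Complex.normSq_add_mul_I]
  ring

theorem CP.ofVec_neg {n : ℕ} (v : Fin (n + 1) → ℂ) : CP.ofVec (-v) = CP.ofVec v := by
  by_cases h : v = 0
  · rw [h, neg_zero]
  · rw [← neg_one_smul ℂ v, CP.ofVec_smul (neg_ne_zero.2 one_ne_zero) h]

/-- Smooth local sections of the projection to projective space. -/
theorem CP.exists_lift {n : ℕ} {v : Fin (n + 1) → ℂ} (hv : v ≠ 0) :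
    ∃ L : CP n → Fin (n + 1) → ℂ,
      ContMDiffAt 𝓘(ℝ, Fin n → ℂ) 𝓘(ℝ, Fin (n + 1) → ℂ) ∞ L (CP.ofVec v) ∧
      L (CP.ofVec v) = v ∧ ∀ᶠ y in 𝓝 (CP.ofVec v), L y ≠ 0 ∧ CP.ofVec (L y) = y := by
  obtain ⟨i, hi⟩ : ∃ i, v i ≠ 0 := by
    by_contra! h
    exact hv (funext h)
  let l : (Fin (n + 1) → ℂ) →ₗ[ℂ] ℂ := LinearMap.proj i
  have hl : l (CP.ofVec v).rep ≠ 0 := by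
    rw [CP.ofVec_eq hv, CP.ne_zero_mk_iff]
    exact hi
  -- The factor v_i makes the section pass through v itself and not merely through a multiple of it.
  refine ⟨fun y => v i • CP.normalize l y, ?_, ?_, ?_⟩
  · have hs : ContDiff ℝ ∞ fun z : Fin (n + 1) → ℂ => v i • z := contDiff_const_smul (v i)
    exact hs.contMDiff.contMDiffAt.comp _ (CP.contMDiffAt_normalize l hl)
  · change v i • CP.normalize l (CP.ofVec v) = v
    rw [CP.normalize_ofVec l hv, smul_smul]
    have : v i * (l v)⁻¹ = 1 := mul_inv_cancel₀ hi
    rw [this, one_smul]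
  · filter_upwards [(CP.isOpen_ne_zero l).mem_nhds hl] with y hy
    have h0 := CP.normalize_ne_zero l hy
    exact ⟨smul_ne_zero hi h0, by rw [CP.ofVec_smul hi h0, CP.ofVec_normalize l hy]⟩

/-- Smooth local sections of the projection of the cone to the quadric. -/
theorem Q.exists_lift {n : ℕ} {Z : Fin (n + 1) → ℂ} {ζ : ℂ} (hZ : Z ≠ 0)
    (h : ∑ k, Z k ^ 2 + ζ ^ 2 = 0) :
    ∃ L : Q n → (Fin (n + 1) → ℂ) × ℂ,
      ContMDiffAt 𝓘(ℝ, Fin n → ℂ) 𝓘(ℝ, (Fin (n + 1) → ℂ) × ℂ) ∞ L (Q.pt Z ζ) ∧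
      L (Q.pt Z ζ) = (Z, ζ) ∧
      ∀ᶠ y in 𝓝 (Q.pt Z ζ), (L y).1 ≠ 0 ∧ ∑ k, (L y).1 k ^ 2 + (L y).2 ^ 2 = 0 ∧
        Q.pt (L y).1 (L y).2 = y := by
  have hv := Q.vec_ne_zero hZ ζ
  have hval : (Q.pt Z ζ).1 = CP.ofVec (Q.vec Z ζ) := Q.ofVec_val hv (by rw [Q.sum_vec, h])
  obtain ⟨L, hL, hLv, hLe⟩ := CP.exists_lift hv
  rw [← hval] at hL hLv hLe
  have hsm : ContDiff ℝ ∞ fun v : Fin (n + 2) → ℂ =>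
      ((fun k : Fin (n + 1) => v k.castSucc), v (Fin.last (n + 1))) :=
    (contDiff_pi.2 fun k : Fin (n + 1) => contDiff_apply ℝ ℂ k.castSucc).prodMk (contDiff_apply ℝ ℂ _)
  have hLs : ContMDiffAt 𝓘(ℝ, Fin n → ℂ) 𝓘(ℝ, (Fin (n + 1) → ℂ) × ℂ) ∞
      (fun y : Q n => ((fun k : Fin (n + 1) => L y.1 k.castSucc), L y.1 (Fin.last (n + 1))))
      (Q.pt Z ζ) :=
    hsm.contMDiff.contMDiffAt.comp _ (hL.comp _ Q.contMDiff_val.contMDiffAt)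
  have hL0 : ((fun k : Fin (n + 1) => L (Q.pt Z ζ).1 k.castSucc),
      L (Q.pt Z ζ).1 (Fin.last (n + 1))) = (Z, ζ) := by
    rw [hLv]
    simp
  refine ⟨_, hLs, hL0, ?_⟩
  have hne := (continuous_fst.continuousAt.comp hLs.continuousAt).eventually_ne
    (y := (0 : Fin (n + 1) → ℂ)) (fun h0 => hZ ((congrArg Prod.fst hL0).symm.trans h0))
  filter_upwards [continuous_subtype_val.continuousAt.eventually hLe, hne] with y hy hy0
  have hs : ∑ k, L y.1 k ^ 2 = 0 := by
    have := y.2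
    rw [← hy.2, CP.ofVec_mem_quadric hy.1] at this
    exact this
  refine ⟨hy0, ?_, ?_⟩
  · rw [← Q.sum_vec, Q.vec_init, hs]
  · rw [Q.pt, Q.vec_init]
    exact Subtype.ext (by rw [Q.ofVec_val hy.1 hs, hy.2])

namespace TS

variable {n : ℕ} {E H M : Type*} [NormedAddCommGroup E] [NormedSpace ℝ E] [TopologicalSpace H]
  {I : ModelWithCorners ℝ E H} [TopologicalSpace M] [ChartedSpace H M]

/-- The isotropic vector `p + i q / |q|`. -/
def unit (x : TS n) : Fin (n + 1) → ℂ := cplx (x.1.1, (energy x)⁻¹ • x.1.2)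

theorem sumSq_unit {x : TS n} (hx : 0 < energy x) : sumSq (unit x) = 0 := by
  rw [sumSq, unit, ← Complex.ofReal_zero, sum_cplx_sq_eq_ofReal_iff]
  simp only [smul_dotProduct, dotProduct_smul, x.2.1, x.2.2, ← energy_sq, smul_eq_mul]
  refine ⟨?_, mul_zero _⟩
  field_simp
  ring

theorem hermSq_unit {x : TS n} (hx : 0 < energy x) : hermSq (unit x) = 2 := by
  rw [unit, hermSq_cplx]
  simp only [smul_dotProduct, dotProduct_smul, x.2.1, ← energy_sq, smul_eq_mul]
  field_simp
  ring

theorem unit_antipode (x : TS n) : unit (antipode x) = -unit x := by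
  rw [unit, energy_antipode]
  ext k
  simp [unit, cplx, antipode]
  ring

/-- The flow rotates the orthonormal pair p, q/|q|. Unlike `cplx_flow`, this holds on every positive
level, as required near the boundary. -/
theorem unit_flow (t : ℝ) {x : TS n} (hx : 0 < energy x) :
    unit (flow t x) = Complex.exp (-(t * Complex.I)) • unit x := by
  have h0 : (energy x : ℂ) ≠ 0 := by exact_mod_cast hx.ne'
  rw [unit, energy_flow, flow_val t hx, ← neg_mul, Complex.exp_mul_I, Complex.cos_neg,
    Complex.sin_neg]
  ext k
  simp [unit, cplx]
  field_simp
  linear_combination ((Complex.sin t) * (x.1.2 k)) * Complex.I_sq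

/-- The point of `T^*S^n` given by an isotropic vector and the norm of the covector. -/
def ofUnit (X : Fin (n + 1) → ℂ) (h : ℝ) : TS n := ofPair ((reIm X).1, h • (reIm X).2)

theorem re_im_of_isotropic {X : Fin (n + 1) → ℂ} (h : sumSq X = 0) (h' : hermSq X = 2) :
    (reIm X).1 ⬝ᵥ (reIm X).1 = 1 ∧ (reIm X).2 ⬝ᵥ (reIm X).2 = 1 ∧
      (reIm X).1 ⬝ᵥ (reIm X).2 = 0 := by
  rw [sumSq, ← cplx_reIm X, ← Complex.ofReal_zero, sum_cplx_sq_eq_ofReal_iff] at h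
  rw [← cplx_reIm X, hermSq_cplx] at h'
  exact ⟨by linarith [h.1], by linarith [h.1], h.2⟩

theorem ofUnit_val {X : Fin (n + 1) → ℂ} (h : sumSq X = 0) (h' : hermSq X = 2) (r : ℝ) :
    (ofUnit X r).1 = ((reIm X).1, r • (reIm X).2) := by
  obtain ⟨h1, -, h3⟩ := re_im_of_isotropic h h'
  refine ofPair_val ⟨h1, ?_⟩
  rw [dotProduct_smul, h3, smul_zero]

theorem energy_ofUnit {X : Fin (n + 1) → ℂ} (h : sumSq X = 0) (h' : hermSq X = 2) {r : ℝ}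
    (hr : 0 ≤ r) : energy (ofUnit X r) = r := by
  rw [energy, ofUnit_val h h', smul_dotProduct, dotProduct_smul, (re_im_of_isotropic h h').2.1,
    smul_eq_mul, smul_eq_mul, mul_one, Real.sqrt_mul_self hr]

theorem unit_ofUnit {X : Fin (n + 1) → ℂ} (h : sumSq X = 0) (h' : hermSq X = 2) {r : ℝ}
    (hr : 0 < r) : unit (ofUnit X r) = X := by
  rw [unit, energy_ofUnit h h' hr.le, ofUnit_val h h', smul_smul, inv_mul_cancel₀ hr.ne',
    one_smul, cplx_reIm]

theorem ofUnit_unit {x : TS n} (hx : 0 < energy x) : ofUnit (unit x) (energy x) = x := by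
  apply Subtype.ext
  rw [ofUnit_val (sumSq_unit hx) (hermSq_unit hx), unit, reIm_cplx, smul_smul,
    mul_inv_cancel₀ hx.ne', one_smul]

theorem contMDiffAt_unit {x : TS n} (hx : 0 < energy x) :
    ContMDiffAt 𝓘(ℝ, TModel n) 𝓘(ℝ, Fin (n + 1) → ℂ) ∞ unit x := by
  have hd := dot_pos_of_energy_pos hx
  have h : ContDiffAt ℝ ∞ (fun a : (Fin (n + 1) → ℝ) × (Fin (n + 1) → ℝ) =>
      cplx (a.1, (√(a.2 ⬝ᵥ a.2))⁻¹ • a.2)) x.1 :=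
    contDiff_cplx.contDiffAt.comp _ (contDiffAt_fst.prodMk
      (((contDiffAt_norm_snd hd).inv (Real.sqrt_pos.2 hd).ne').smul contDiffAt_snd))
  exact h.contMDiffAt.comp x contMDiff_val.contMDiffAt

theorem contMDiffAt_ofUnit {G : M → Fin (n + 1) → ℂ} {η : M → ℝ} {x : M}
    (hG : ContMDiffAt I 𝓘(ℝ, Fin (n + 1) → ℂ) ∞ G x) (hη : ContMDiffAt I 𝓘(ℝ, ℝ) ∞ η x)
    (h : ∀ᶠ y in 𝓝 x, sumSq (G y) = 0 ∧ hermSq (G y) = 2) :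
    ContMDiffAt I 𝓘(ℝ, TModel n) ∞ (fun y => ofUnit (G y) (η y)) x := by
  have h1 : ContDiff ℝ ∞ fun p : (Fin (n + 1) → ℂ) × ℝ =>
      ((reIm p.1).1, p.2 • (reIm p.1).2) :=
    ((contDiff_reIm.comp contDiff_fst).fst).prodMk
      (contDiff_snd.smul (contDiff_reIm.comp contDiff_fst).snd)
  refine contMDiffAt_of_val
    ((h1.contMDiff.contMDiffAt.comp x (hG.prodMk_space hη)).congr_of_eventuallyEq ?_)
  filter_upwards [h] with y hy
  exact ofUnit_val hy.1 hy.2 _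

end TS

/-! ### The reduction maps -/

/-- The coordinate `w / √(c (1 + h))`, of absolute value `√((1 - h) / (1 + h))` if
`|w|² = c (1 - h)`. -/
def rescale (c h : ℝ) (w : ℂ) : ℂ := ((√(c * (1 + h)))⁻¹ : ℝ) * w

theorem normSq_rescale {c h : ℝ} {w : ℂ} (hc : 0 < c) (hh : 0 < h) (hw : h + c⁻¹ * ‖w‖ ^ 2 = 1) :
    Complex.normSq (rescale c h w) = (1 - h) / (1 + h) := by
  have h1 : ‖w‖ ^ 2 = c * (1 - h) := by
    field_simp at hw
    linarith
  rw [rescale, Complex.normSq_mul, Complex.normSq_ofReal, Complex.normSq_eq_norm_sq, h1, ← mul_inv,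
    Real.mul_self_sqrt (by positivity)]
  field_simp

theorem rescale_mul_sqrt {c h : ℝ} (hc : 0 < c) (hh : 0 < h) (d : ℂ) :
    rescale c h (d * (√(c * (1 + h)) : ℝ)) = d := by
  have h1 : 0 < √(c * (1 + h)) := Real.sqrt_pos.2 (by positivity)
  have h2 : ((√(c * (1 + h)) : ℝ) : ℂ) ≠ 0 := by exact_mod_cast h1.ne'
  rw [rescale, Complex.ofReal_inv]
  field_simp

theorem sqrt_mul_rescale {c h : ℝ} (hc : 0 < c) (hh : 0 < h) (w : ℂ) :
    rescale c h w * (√(c * (1 + h)) : ℝ) = w := by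
  have h1 : 0 < √(c * (1 + h)) := Real.sqrt_pos.2 (by positivity)
  have h2 : ((√(c * (1 + h)) : ℝ) : ℂ) ≠ 0 := by exact_mod_cast h1.ne'
  rw [rescale, Complex.ofReal_inv]
  field_simp

theorem height_rescale {c h : ℝ} {w : ℂ} (hc : 0 < c) (hh : 0 < h)
    (hw : h + c⁻¹ * ‖w‖ ^ 2 = 1) :
    (1 - Complex.normSq (rescale c h w)) / (1 + Complex.normSq (rescale c h w)) = h := by
  rw [normSq_rescale hc hh hw]
  field_simp
  ring

theorem normSq_rescale_lt_one {c h : ℝ} {w : ℂ} (hc : 0 < c) (hh : 0 < h)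
    (hw : h + c⁻¹ * ‖w‖ ^ 2 = 1) : Complex.normSq (rescale c h w) < 1 := by
  rw [normSq_rescale hc hh hw, div_lt_one (by positivity)]
  linarith

/-- The converse of `normSq_rescale`, with c = T/π; it places the constructed sections on the level
set. -/
theorem level_of_normSq {c h : ℝ} {d : ℂ} (hc : 0 < c) (hh : 0 < h)
    (hd : Complex.normSq d = (1 - h) / (1 + h)) :
    h + c⁻¹ * ‖d * (√(c * (1 + h)) : ℝ)‖ ^ 2 = 1 := by
  rw [norm_mul, mul_pow, ← Complex.normSq_eq_norm_sq, hd, Complex.norm_real, Real.norm_eq_abs,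
    sq_abs, Real.sq_sqrt (by positivity)]
  field_simp
  ring

theorem contDiffAt_rescale {c h : ℝ} (hc : 0 < c) (hh : 0 < h) (w : ℂ) :
    ContDiffAt ℝ ∞ (fun p : ℝ × ℂ => rescale c p.1 p.2) (h, w) := by
  have h1 : 0 < c * (1 + h) := by positivity
  have h2 : ContDiffAt ℝ ∞ (fun p : ℝ × ℂ => (√(c * (1 + p.1)))⁻¹) (h, w) :=
    ((contDiffAt_const.mul (contDiffAt_const.add contDiffAt_fst)).sqrt h1.ne').inv
      (Real.sqrt_pos.2 h1).ne'
  exact (Complex.ofRealCLM.contDiff.contDiffAt.comp _ h2).mul contDiffAt_snd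

theorem contDiffAt_mul_sqrt {c h : ℝ} (hc : 0 < c) (hh : 0 < h) (d : ℂ) :
    ContDiffAt ℝ ∞ (fun p : ℝ × ℂ => p.2 * ((√(c * (1 + p.1)) : ℝ) : ℂ)) (h, d) := by
  have h1 : 0 < c * (1 + h) := by positivity
  have h2 : ContDiffAt ℝ ∞ (fun p : ℝ × ℂ => √(c * (1 + p.1))) (h, d) :=
    (contDiffAt_const.mul (contDiffAt_const.add contDiffAt_fst)).sqrt h1.ne'
  exact contDiffAt_snd.mul (Complex.ofRealCLM.contDiff.contDiffAt.comp _ h2)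

end

/-! ### The symplectic cuts -/

noncomputable section

theorem exp_neg_mul_conj (t : ℝ) : Complex.exp (-(t * Complex.I)) *
    starRingEnd ℂ (Complex.exp (-(t * Complex.I))) = 1 := by
  rw [Complex.mul_conj, Complex.normSq_eq_norm_sq,
    show -((t : ℂ) * Complex.I) = ((-t : ℝ) : ℂ) * Complex.I by push_cast; ring,
    Complex.norm_exp_ofReal_mul_I]
  norm_num

theorem rescale_mul (c h : ℝ) (a w : ℂ) : rescale c h (a * w) = a * rescale c h w := by
  rw [rescale, rescale]
  ring

theorem eq_div_of_height {s h : ℝ} (hs : 0 ≤ s) (hh : h = (1 - s) / (1 + s)) :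
    s = (1 - h) / (1 + h) := by
  rw [hh]
  field_simp
  ring

/-- The model isomorphism `ℂ^n ≃ ℝ^n ⊕ ℝ^n`. -/
def modelEquiv (n : ℕ) : (Fin n → ℂ) ≃L[ℝ] TModel n :=
  LinearEquiv.toContinuousLinearEquiv
    { toFun := reIm
      invFun := cplx
      map_add' := fun _ _ => rfl
      map_smul' := fun r Z => by ext <;> simp [reIm]
      left_inv := cplx_reIm
      right_inv := reIm_cplx }

namespace TS

variable {n : ℕ}

theorem contMDiffAt_rescale {c : ℝ} (hc : 0 < c) {x : TS n} (hx : 0 < energy x) (w : ℂ) :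
    ContMDiffAt (𝓘(ℝ, TModel n).prod 𝓘(ℝ, ℂ)) 𝓘(ℝ, ℂ) ∞
      (fun z : TS n × ℂ => rescale c (energy z.1) z.2) (x, w) := by
  have h : ContMDiffAt (𝓘(ℝ, TModel n).prod 𝓘(ℝ, ℂ)) 𝓘(ℝ, ℝ × ℂ) ∞
      (fun z : TS n × ℂ => (energy z.1, z.2)) (x, w) :=
    ((contMDiffAt_energy hx).comp (x, w) contMDiffAt_fst).prodMk_space contMDiffAt_snd
  exact (contDiffAt_rescale hc hx w).contMDiffAt.comp (x, w) h

theorem contMDiffAt_comb {β : TS n × ℂ → ℂ} {x : TS n} (hx : 0 < energy x) {w : ℂ}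
    (hβ : ContMDiffAt (𝓘(ℝ, TModel n).prod 𝓘(ℝ, ℂ)) 𝓘(ℝ, ℂ) ∞ β (x, w)) :
    ContMDiffAt (𝓘(ℝ, TModel n).prod 𝓘(ℝ, ℂ)) 𝓘(ℝ, Fin (n + 1) → ℂ) ∞
      (fun z : TS n × ℂ => comb (unit z.1) (β z)) (x, w) := by
  have h : ContMDiffAt (𝓘(ℝ, TModel n).prod 𝓘(ℝ, ℂ)) 𝓘(ℝ, (Fin (n + 1) → ℂ) × ℂ) ∞
      (fun z : TS n × ℂ => (unit z.1, β z)) (x, w) :=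
    ((contMDiffAt_unit hx).comp (x, w) contMDiffAt_fst).prodMk_space hβ
  exact contDiff_comb.contMDiff.contMDiffAt.comp (x, w) h

theorem sqrt_one_sub_dot (x : TS n) (hx : energy x ≤ 1) :
    √(1 - x.1.2 ⬝ᵥ x.1.2) = √(1 - energy x) * √(1 + energy x) := by
  rw [← energy_sq, ← Real.sqrt_mul (by linarith)]
  congr 1
  ring

/-- The reduction map to `CP^n`. -/
def projReduction (z : TS n × ℂ) : CP n := CP.ofVec (comb (unit z.1) (rescale 1 (energy z.1) z.2))

theorem projReduction_antipode (x : TS n) (w : ℂ) :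
    projReduction (antipode x, w) = projReduction (x, w) := by
  rw [projReduction, energy_antipode, unit_antipode, projReduction, ← CP.ofVec_neg]
  congr 1
  ext k
  simp [comb]
  ring

/-- For T = π the circle turns w by e^{-2it}, the square of the phase by which the flow turns X, so
`comb_phase` applies. -/
theorem projReduction_flow {x : TS n} (hx : 0 < energy x) (w : ℂ) (t : ℝ) :
    projReduction (flow t x, Complex.exp (-(2 * t * Complex.I)) * w) = projReduction (x, w) := by
  have h2 : Complex.exp (-(2 * t * Complex.I)) = Complex.exp (-(t * Complex.I)) ^ 2 := by
    rw [← Complex.exp_nat_mul]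
    congr 1
    push_cast
    ring
  rw [projReduction, energy_flow, unit_flow t hx, rescale_mul, h2,
    comb_phase (exp_neg_mul_conj t), CP.ofVec_smul (Complex.exp_ne_zero _)
      (comb_ne_zero (sumSq_unit hx) (hermSq_unit hx) _)]
  rfl

/-- For real b, X + bX̄ = (1 + b)p + i(1 - b)q/|q|. With b = √((1 - |q|)/(1 + |q|)) the ratio (1 -
b)/((1 + b)|q|) is 1/(1 + √(1 - |q|²)), which is where `shrink` comes from. -/
theorem projReduction_real {x : TS n} (hx : 0 < energy x) (hx1 : energy x ≤ 1) :
    projReduction (x, (√(1 - energy x) : ℝ)) = Q.proj n (toQuadric (shrink x)) := by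
  have hu := sqrt_one_sub_dot x hx1
  rw [proj_toQuadric (energy_shrink_le hx1)]
  have hc : 0 < √(1 + energy x) := Real.sqrt_pos.2 (by linarith)
  have ha : 0 ≤ √(1 - energy x) := Real.sqrt_nonneg _
  have hc2 := Real.sq_sqrt (show 0 ≤ 1 + energy x by linarith)
  have ha2 := Real.sq_sqrt (show 0 ≤ 1 - energy x by linarith)
  set a := √(1 - energy x)
  set c := √(1 + energy x)
  have hb : rescale 1 (energy x) (a : ℂ) = ((a / c : ℝ) : ℂ) := by
    rw [rescale, one_mul, div_eq_inv_mul]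
    push_cast
    rfl
  have hf : (1 - a / c) * (energy x)⁻¹ = (1 + a / c) * shrinkFactor x := by
    rw [shrinkFactor, hu]
    have h1 : 0 < 1 + a * c := by positivity
    field_simp
    linear_combination a * hc2 - c * ha2
  have hv : comb (unit x) ((a / c : ℝ) : ℂ) = ((1 + a / c : ℝ) : ℂ) • cplx (shrink x).1 := by
    ext k
    have hf' := congrArg (fun r : ℝ => (r : ℂ)) hf
    simp only [shrink, scale_val, comb, unit, cplx, map_add, map_mul, Complex.conj_ofReal,
      Complex.conj_I, Pi.smul_apply, smul_eq_mul]
    push_cast at hf' ⊢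
    linear_combination (x.1.2 k * Complex.I) * hf'
  have h0 : ((1 + a / c : ℝ) : ℂ) ≠ 0 := by
    have : 0 < 1 + a / c := by positivity
    exact_mod_cast this.ne'
  rw [projReduction, hb, hv, CP.ofVec_smul h0 (cplx_ne_zero _)]

/-- The reduction map to the quadric. -/
def quadricReduction (z : TS n × ℂ) : Q n :=
  Q.pt (comb (unit z.1) (rescale 2 (energy z.1) z.2 ^ 2))
    (2 * Complex.I * rescale 2 (energy z.1) z.2)

/-- The first block has sum of squares 4d². Taking d² as the coefficient of X̄ is what makes its
root 2id available as last coordinate. -/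
theorem quadricReduction_cone {x : TS n} (hx : 0 < energy x) (d : ℂ) :
    ∑ k, comb (unit x) (d ^ 2) k ^ 2 + (2 * Complex.I * d) ^ 2 = 0 := by
  have := sumSq_comb (sumSq_unit hx) (hermSq_unit hx) (d ^ 2)
  rw [sumSq] at this
  rw [this]
  linear_combination (4 * d ^ 2) * Complex.I_sq

/-- For T = 2π the number d turns by the same phase as X, so d² turns by its square and the whole
vector is multiplied by one phase. -/
theorem quadricReduction_flow {x : TS n} (hx : 0 < energy x) (w : ℂ) (t : ℝ) :
    quadricReduction (flow t x, Complex.exp (-(t * Complex.I)) * w) = quadricReduction (x, w) := by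
  rw [quadricReduction, energy_flow, unit_flow t hx, rescale_mul, mul_pow,
    comb_phase (exp_neg_mul_conj t), mul_left_comm,
    Q.pt_smul (Complex.exp_ne_zero _) (comb_ne_zero (sumSq_unit hx) (hermSq_unit hx) _)
      (quadricReduction_cone hx _)]
  rfl

/-- Here d² = (1 - |q|)/(1 + |q|), hence 1 + d² and (1 - d²)/|q| both equal 2/(1 + |q|). The vector
is a multiple of p + iq, and no radial change is needed. -/
theorem quadricReduction_real {x : TS n} (hx : 0 < energy x) (hx1 : energy x ≤ 1) :
    quadricReduction (x, (√(2 * (1 - energy x)) : ℝ)) = toQuadric x := by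
  have hu := sqrt_one_sub_dot x hx1
  have hc : 0 < √(1 + energy x) := Real.sqrt_pos.2 (by linarith)
  have hc2 := Real.sq_sqrt (show 0 ≤ 1 + energy x by linarith)
  have ha2 := Real.sq_sqrt (show 0 ≤ 1 - energy x by linarith)
  have hb : rescale 2 (energy x) (√(2 * (1 - energy x)) : ℝ) =
      ((√(1 - energy x) / √(1 + energy x) : ℝ) : ℂ) := by
    have h2 : 0 < √(2 : ℝ) := by positivity
    rw [rescale, ← Complex.ofReal_mul, Real.sqrt_mul two_pos.le, Real.sqrt_mul two_pos.le]
    congr 1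
    field_simp
  set a := √(1 - energy x)
  set c := √(1 + energy x)
  have h1 : 0 < 1 + energy x := by linarith
  have hd : (a / c) ^ 2 = (1 - energy x) / (1 + energy x) := by rw [div_pow, ha2, hc2]
  have hv : comb (unit x) (((a / c : ℝ) : ℂ) ^ 2) =
      ((2 / (1 + energy x) : ℝ) : ℂ) • cplx x.1 := by
    have e1 : 1 + (a / c) ^ 2 = 2 / (1 + energy x) := by
      rw [hd]
      field_simp
      ring
    have e2 : (1 - (a / c) ^ 2) * (energy x)⁻¹ = 2 / (1 + energy x) := by
      rw [hd]
      field_simp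
      ring
    have e1' := congrArg (fun r : ℝ => (r : ℂ)) e1
    have e2' := congrArg (fun r : ℝ => (r : ℂ)) e2
    ext k
    simp only [comb, unit, cplx, map_add, map_mul, Complex.conj_ofReal,
      Complex.conj_I, Pi.smul_apply, smul_eq_mul]
    push_cast at e1' e2' ⊢
    linear_combination (x.1.1 k) * e1' + (x.1.2 k * Complex.I) * e2'
  have hw : 2 * Complex.I * ((a / c : ℝ) : ℂ) =
      ((2 / (1 + energy x) : ℝ) : ℂ) * (Complex.I * (√(1 - x.1.2 ⬝ᵥ x.1.2) : ℝ)) := by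
    have e : a / c = 1 / (1 + energy x) * √(1 - x.1.2 ⬝ᵥ x.1.2) := by
      rw [hu, ← hc2]
      field_simp
    rw [e]
    push_cast
    ring
  have h0 : ((2 / (1 + energy x) : ℝ) : ℂ) ≠ 0 := by
    have : 0 < 2 / (1 + energy x) := by positivity
    exact_mod_cast this.ne'
  rw [quadricReduction, hb, hv, hw, Q.pt_smul h0 (cplx_ne_zero x) (toQuadric_cone hx1)]
  rfl

end TS

end

/-! ### The cut of the cotangent bundle of RP^n as CP^n -/

noncomputable section

namespace TRP

variable {n : ℕ}

/-- The reduction map of the cut of `T^*RP^n`. -/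
def reduction (z : TRP n × ℂ) : CP n :=
  descend (fun x => TS.projReduction (x, z.2)) (fun x => TS.projReduction_antipode x z.2) z.1

theorem reduction_cover (x : TS n) (w : ℂ) :
    reduction (cover n x, w) = TS.projReduction (x, w) := rfl

theorem contMDiffAt_reduction {x : TS n} (hx : 0 < TS.energy x) (w : ℂ) :
    ContMDiffAt (𝓘(ℝ, TModel n).prod 𝓘(ℝ, ℂ)) 𝓘(ℝ, Fin n → ℂ) ∞ reduction (cover n x, w) :=
  (isLocalDiffeomorph_cover n x).contMDiffAt_of_comp_prod
    (CP.contMDiffAt_ofVec (TS.contMDiffAt_comb hx (TS.contMDiffAt_rescale one_pos hx w))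
      (comb_ne_zero (TS.sumSq_unit hx) (TS.hermSq_unit hx) _))

/-- Lift a point of CP^n smoothly to a vector and decompose it as X + bX̄: the height is the energy,
X determines p and q/|q|, and w = b√(1 + h). Strict positivity of the energy keeps |b| < 1. -/
theorem exists_section_reduction {x : TS n} (hx : 0 < TS.energy x) {w : ℂ}
    (hw : TS.energy x + 1⁻¹ * ‖w‖ ^ 2 = 1) :
    ∃ τ : CP n → TRP n × ℂ,
      ContMDiffAt 𝓘(ℝ, Fin n → ℂ) (𝓘(ℝ, TModel n).prod 𝓘(ℝ, ℂ)) ∞ τ (reduction (cover n x, w)) ∧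
      τ (reduction (cover n x, w)) = (cover n x, w) ∧
      ∀ᶠ y in 𝓝 (reduction (cover n x, w)), (0 < energy (τ y).1 ∧
        energy (τ y).1 + 1⁻¹ * ‖(τ y).2‖ ^ 2 = 1) ∧ reduction (τ y) = y := by
  have hX := TS.sumSq_unit hx
  have hX' := TS.hermSq_unit hx
  have hb := normSq_rescale_lt_one one_pos hx hw
  have hbh := height_rescale one_pos hx hw
  have hbw := sqrt_mul_rescale one_pos hx w
  have hK : reduction (cover n x, w) =
    CP.ofVec (comb (TS.unit x) (rescale 1 (TS.energy x) w)) := rfl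
  rw [hK]
  generalize rescale 1 (TS.energy x) w = b at *
  obtain ⟨L, hL, hLv, hLe⟩ := CP.exists_lift (comb_ne_zero hX hX' b)
  have hgen := comb_mem_generic hX hX' hb
  have hZ : L (CP.ofVec (comb (TS.unit x) b)) ∈ generic (n + 1) := by rwa [hLv]
  have hev : ∀ᶠ y in 𝓝 (CP.ofVec (comb (TS.unit x) b)), L y ∈ generic (n + 1) :=
    hL.continuousAt.eventually ((isOpen_generic _).mem_nhds hZ)
  refine ⟨fun y => (cover n (TS.ofUnit (isotropic (L y)) (height (L y))),
    coeff (L y) * (√(1 * (1 + height (L y))) : ℝ)), ?_, ?_, ?_⟩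
  · have hh := (contDiffAt_height hZ).contMDiffAt.comp _ hL
    refine ContMDiffAt.prodMk (((isLocalDiffeomorph_cover n _).contMDiffAt).comp _
      (TS.contMDiffAt_ofUnit ((contDiffAt_isotropic hZ).contMDiffAt.comp _ hL) hh ?_)) ?_
    · filter_upwards [hev] with y hy
      exact ⟨sumSq_isotropic hy, hermSq_isotropic hy⟩
    · exact (contDiffAt_mul_sqrt one_pos (height_pos hZ) (coeff (L _))).contMDiffAt.comp
        (CP.ofVec (comb (TS.unit x) b)) (hh.prodMk_space ((contDiffAt_coeff hZ).contMDiffAt.comp _ hL))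
  · simp only [hLv]
    rw [isotropic_comb hX hX' hb, height_comb hX hX' hb, coeff_comb hX hX' hb, hbh,
      TS.ofUnit_unit hx, hbw]
  · filter_upwards [hev, hLe] with y hy hyL
    have h1 := sumSq_isotropic hy
    have h2 := hermSq_isotropic hy
    have hp := height_pos hy
    rw [energy_cover, TS.energy_ofUnit h1 h2 hp.le]
    refine ⟨⟨hp, level_of_normSq one_pos hp (normSq_coeff hy)⟩, ?_⟩
    have hf : (factor (L y) : ℂ) ≠ 0 := by exact_mod_cast (factor_pos hy).ne'
    rw [reduction_cover, TS.projReduction, TS.energy_ofUnit h1 h2 hp.le, TS.unit_ofUnit h1 h2 hp,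
      rescale_mul_sqrt one_pos hp, comb_isotropic hy, CP.ofVec_smul hf hyL.1, hyL.2]

theorem isCutModel {μ : {y : TRP n // energy y ≤ 1} → CP n}
    (hi : ∃ j : TRP n → CP n, (∀ y : {y : TRP n // energy y ≤ 1}, j y = μ y) ∧
      IsLocalDiffeomorphOn 𝓘(ℝ, TModel n) 𝓘(ℝ, Fin n → ℂ) ∞ j {y | energy y < 1})
    (hμ : ∀ x : {x : TS n // TS.energy x ≤ 1},
      μ (discCover n x) = Q.proj n (TS.toQuadric (TS.shrink x.1))) :
    IsCutModel (E := TModel n) (F := Fin n → ℂ) {y : TRP n | 0 < energy y} energy flow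
      Real.pi 1 μ := by
  have hπ : Real.pi / Real.pi = 1⁻¹ := by rw [div_self Real.pi_ne_zero, inv_one]
  have hlev : ∀ z : TRP n × ℂ, z ∈ cutLevel {y : TRP n | 0 < energy y} energy Real.pi 1 ↔
      0 < energy z.1 ∧ energy z.1 + 1⁻¹ * ‖z.2‖ ^ 2 = 1 := fun z => by
    rw [cutLevel, mem_ofPred_eq, hπ]
    rfl
  refine ⟨hi, reduction, ?_, ?_, ?_, ?_⟩
  · intro y hy
    obtain ⟨x, rfl⟩ := discCover_surjective n y
    rw [hμ, hπ, inv_one, one_mul]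
    exact TS.projReduction_real hy x.2
  · rintro ⟨y, w⟩ hz t
    obtain ⟨x, rfl⟩ := cover_surjective n y
    have hexp : (2 * Real.pi * t / Real.pi * Complex.I : ℂ) = 2 * t * Complex.I := by
      have : (Real.pi : ℂ) ≠ 0 := by exact_mod_cast Real.pi_ne_zero
      field_simp
    rw [hexp]
    exact TS.projReduction_flow ((hlev _).1 hz).1 w t
  · rintro ⟨y, w⟩ hz
    obtain ⟨x, rfl⟩ := cover_surjective n y
    exact (contMDiffAt_reduction ((hlev _).1 hz).1 w).contMDiffWithinAt
  · rintro ⟨y, w⟩ hz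
    obtain ⟨x, rfl⟩ := cover_surjective n y
    simp only [hlev] at hz ⊢
    exact exists_section_reduction hz.1 hz.2

end TRP

/-! ### The cut of the cotangent bundle of S^n as the quadric -/

namespace TS

variable {n : ℕ}

theorem contMDiffAt_quadricReduction {x : TS n} (hx : 0 < energy x) (w : ℂ) :
    ContMDiffAt (𝓘(ℝ, TModel n).prod 𝓘(ℝ, ℂ)) 𝓘(ℝ, Fin n → ℂ) ∞ quadricReduction (x, w) := by
  have hr := contMDiffAt_rescale two_pos hx w
  have hsq : ContDiff ℝ ∞ fun d : ℂ => d ^ 2 := contDiff_id.pow 2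
  have hI : ContDiff ℝ ∞ fun d : ℂ => 2 * Complex.I * d := contDiff_const.mul contDiff_id
  have h1 : ContMDiffAt (𝓘(ℝ, TModel n).prod 𝓘(ℝ, ℂ)) 𝓘(ℝ, (Fin (n + 1) → ℂ) × ℂ) ∞
      (fun z : TS n × ℂ => (comb (unit z.1) (rescale 2 (energy z.1) z.2 ^ 2),
        2 * Complex.I * rescale 2 (energy z.1) z.2)) (x, w) :=
    (contMDiffAt_comb hx (hsq.contMDiff.contMDiffAt.comp _ hr)).prodMk_space
      (hI.contMDiff.contMDiffAt.comp _ hr)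
  refine Q.contMDiffAt_ofVec (Q.contDiff_vec.contMDiff.contMDiffAt.comp (x, w) h1)
    (Q.vec_ne_zero (comb_ne_zero (sumSq_unit hx) (hermSq_unit hx) _) _) ?_
  have hc : Continuous fun z : TS n × ℂ => energy z.1 := continuous_energy.comp continuous_fst
  filter_upwards [(isOpen_lt continuous_const hc).mem_nhds hx] with z hz
  exact (Q.sum_vec _ _).trans (quadricReduction_cone hz _)

/-- As on CP^n, except that the number d is needed and not just d². It is read off from the last
coordinate, so no square root has to be chosen, even at d = 0. -/
theorem exists_section_quadricReduction {x : TS n} (hx : 0 < energy x) {w : ℂ}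
    (hw : energy x + 2⁻¹ * ‖w‖ ^ 2 = 1) :
    ∃ τ : Q n → TS n × ℂ,
      ContMDiffAt 𝓘(ℝ, Fin n → ℂ) (𝓘(ℝ, TModel n).prod 𝓘(ℝ, ℂ)) ∞ τ (quadricReduction (x, w)) ∧
      τ (quadricReduction (x, w)) = (x, w) ∧
      ∀ᶠ y in 𝓝 (quadricReduction (x, w)), (0 < energy (τ y).1 ∧
        energy (τ y).1 + 2⁻¹ * ‖(τ y).2‖ ^ 2 = 1) ∧ quadricReduction (τ y) = y := by
  have hX := sumSq_unit hx
  have hX' := hermSq_unit hx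
  have hb := normSq_rescale_lt_one two_pos hx hw
  have hbh := height_rescale two_pos hx hw
  have hbw := sqrt_mul_rescale two_pos hx w
  have hK : quadricReduction (x, w) = Q.pt (comb (unit x) (rescale 2 (energy x) w ^ 2))
    (2 * Complex.I * rescale 2 (energy x) w) := rfl
  rw [hK]
  generalize rescale 2 (energy x) w = d at *
  have hb2 : Complex.normSq (d ^ 2) < 1 := by
    rw [map_pow]
    exact pow_lt_one₀ (Complex.normSq_nonneg d) hb two_ne_zero
  obtain ⟨L, hL, hLv, hLe⟩ := Q.exists_lift (comb_ne_zero hX hX' (d ^ 2))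
    (quadricReduction_cone hx d)
  set v := Q.pt (comb (unit x) (d ^ 2)) (2 * Complex.I * d)
  have hL1 : ContMDiffAt 𝓘(ℝ, Fin n → ℂ) 𝓘(ℝ, Fin (n + 1) → ℂ) ∞ (fun y => (L y).1) v :=
    contDiff_fst.contMDiff.contMDiffAt.comp v hL
  have hL2 : ContMDiffAt 𝓘(ℝ, Fin n → ℂ) 𝓘(ℝ, ℂ) ∞ (fun y => (L y).2) v :=
    contDiff_snd.contMDiff.contMDiffAt.comp v hL
  have hgen := comb_mem_generic hX hX' hb2
  have hZ : (L v).1 ∈ generic (n + 1) := by rwa [hLv]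
  have hev : ∀ᶠ y in 𝓝 v, (L y).1 ∈ generic (n + 1) :=
    hL1.continuousAt.eventually ((isOpen_generic _).mem_nhds hZ)
  -- Solves ζ = 2id for the lift rescaled by `factor`.
  let D : Q n → ℂ := fun y => -Complex.I / 2 * (factor (L y).1 * (L y).2)
  -- The energy is tied to |d|². The height of the first block would be (1 - |d|⁴)/(1 + |d|⁴),
  -- because its coefficient is d².
  let η : Q n → ℝ := fun y => (1 - Complex.normSq (D y)) / (1 + Complex.normSq (D y))
  have hpos : ∀ y, 0 < 1 + Complex.normSq (D y) := fun y => by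
    have := Complex.normSq_nonneg (D y)
    linarith
  have hDv : D v = d := by
    change -Complex.I / 2 * (factor (L v).1 * (L v).2) = d
    rw [hLv, factor_comb hX hX' hb2]
    push_cast
    linear_combination (-d) * Complex.I_sq
  have hηv : η v = energy x := by
    change (1 - Complex.normSq (D v)) / (1 + Complex.normSq (D v)) = _
    rw [hDv, hbh]
  have hDs : ContMDiffAt 𝓘(ℝ, Fin n → ℂ) 𝓘(ℝ, ℂ) ∞ D v := by
    have hm : ContDiff ℝ ∞ fun p : ℂ × ℂ => -Complex.I / 2 * (p.1 * p.2) :=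
      contDiff_const.mul (contDiff_fst.mul contDiff_snd)
    exact hm.contMDiff.contMDiffAt.comp v
      (((contDiffAt_ofReal_factor hZ).contMDiffAt.comp v hL1).prodMk_space hL2)
  have hηs : ContMDiffAt 𝓘(ℝ, Fin n → ℂ) 𝓘(ℝ, ℝ) ∞ η v := by
    have hm : ContDiffAt ℝ ∞ (fun p : ℂ => (1 - Complex.normSq p) / (1 + Complex.normSq p)) (D v) :=
      (contDiffAt_const.sub contDiff_normSq.contDiffAt).div
        (contDiffAt_const.add contDiff_normSq.contDiffAt) (hpos v).ne'
    exact hm.contMDiffAt.comp v hDs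
  refine ⟨fun y => (ofUnit (isotropic (L y).1) (η y), D y * (√(2 * (1 + η y)) : ℝ)), ?_, ?_, ?_⟩
  · refine ContMDiffAt.prodMk
      (contMDiffAt_ofUnit ((contDiffAt_isotropic hZ).contMDiffAt.comp v hL1) hηs ?_) ?_
    · filter_upwards [hev] with y hy
      exact ⟨sumSq_isotropic hy, hermSq_isotropic hy⟩
    · exact (contDiffAt_mul_sqrt two_pos (by rw [hηv]; exact hx) _).contMDiffAt.comp v
        (hηs.prodMk_space hDs)
  · simp only [hηv, hDv]
    rw [hLv, isotropic_comb hX hX' hb2, ofUnit_unit hx, hbw]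
  · filter_upwards [hev, hLe] with y hy hyL
    have h1 := sumSq_isotropic hy
    have h2 := hermSq_isotropic hy
    have hD2 : D y ^ 2 = coeff (L y).1 := by
      rw [coeff, sumSq]
      simp only [D]
      linear_combination ((factor (L y).1 : ℂ) ^ 2 * (L y).2 ^ 2 / 4) * Complex.I_sq -
        ((factor (L y).1 : ℂ) ^ 2 / 4) * hyL.2.1
    have hDlt : Complex.normSq (D y) < 1 := by
      have h3 := one_sub_normSq_coeff_pos hy
      rw [← hD2, map_pow] at h3
      nlinarith [Complex.normSq_nonneg (D y)]
    have hp : 0 < η y := div_pos (by linarith) (hpos y)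
    have hDη : Complex.normSq (D y) = (1 - η y) / (1 + η y) :=
      eq_div_of_height (Complex.normSq_nonneg _) rfl
    rw [energy_ofUnit h1 h2 hp.le]
    refine ⟨⟨hp, level_of_normSq two_pos hp hDη⟩, ?_⟩
    have hf : (factor (L y).1 : ℂ) ≠ 0 := by exact_mod_cast (factor_pos hy).ne'
    have hζ : 2 * Complex.I * D y = factor (L y).1 * (L y).2 := by
      simp only [D]
      linear_combination (-(factor (L y).1 : ℂ) * (L y).2) * Complex.I_sq
    rw [quadricReduction, energy_ofUnit h1 h2 hp.le, unit_ofUnit h1 h2 hp,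
      rescale_mul_sqrt two_pos hp, hD2, comb_isotropic hy, hζ, Q.pt_smul hf hyL.1 hyL.2.1,
      hyL.2.2]

theorem isCutModel {μ : {x : TS n // energy x ≤ 1} → Q n}
    (hi : ∃ j : TS n → Q n, (∀ x : {x : TS n // energy x ≤ 1}, j x = μ x) ∧
      IsLocalDiffeomorphOn 𝓘(ℝ, TModel n) 𝓘(ℝ, Fin n → ℂ) ∞ j {x | energy x < 1})
    (hμ : ∀ x : {x : TS n // energy x ≤ 1}, μ x = toQuadric x.1) :
    IsCutModel (E := TModel n) (F := Fin n → ℂ) {x : TS n | 0 < energy x} energy flow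
      (2 * Real.pi) 1 μ := by
  have hπ : Real.pi / (2 * Real.pi) = 2⁻¹ := by
    have := Real.pi_ne_zero
    field_simp
  have hlev : ∀ z : TS n × ℂ, z ∈ cutLevel {x : TS n | 0 < energy x} energy (2 * Real.pi) 1 ↔
      0 < energy z.1 ∧ energy z.1 + 2⁻¹ * ‖z.2‖ ^ 2 = 1 := fun z => by
    rw [cutLevel, mem_ofPred_eq, hπ]
    rfl
  refine ⟨hi, quadricReduction, ?_, ?_, ?_, ?_⟩
  · intro x hx
    rw [hμ, mul_div_cancel_right₀ _ Real.pi_ne_zero]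
    exact quadricReduction_real hx x.2
  · rintro ⟨x, w⟩ hz t
    have hexp : (2 * Real.pi * t / (2 * Real.pi : ℝ) * Complex.I : ℂ) = t * Complex.I := by
      have : (Real.pi : ℂ) ≠ 0 := by exact_mod_cast Real.pi_ne_zero
      push_cast
      field_simp
    rw [hexp]
    exact quadricReduction_flow ((hlev _).1 hz).1 w t
  · rintro ⟨x, w⟩ hz
    exact (contMDiffAt_quadricReduction ((hlev _).1 hz).1 w).contMDiffWithinAt
  · rintro ⟨x, w⟩ hz
    simp only [hlev] at hz ⊢
    exact exists_section_quadricReduction hz.1 hz.2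

end TS

end

/-! ### The two pairs of homeomorphisms and the theorem -/

noncomputable section

/-- The homeomorphism for which the cut of `T^*RP^n` is diffeomorphic to `CP^n`. -/
theorem exists_extendsDoubleCover_isCutModel_proj (n : ℕ) :
    ∃ (Ψ : CutTS n ≃ₜ Q n) (Φ : CutTRP n ≃ₜ CP n), ExtendsDoubleCover Ψ Φ ∧
      IsCutModel (E := TModel n) (F := Fin n → ℂ) {y : TRP n | 0 < TRP.energy y} TRP.energy
        TRP.flow Real.pi 1 fun y => Φ (CutSpace.mk _ _ _ y) := by
  have hf := (TS.isDiscModel_toQuadric n).comp_shrink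
  obtain ⟨Ψ, Φ, h, -, hΦ⟩ := hf.exists_extendsDoubleCover
  exact ⟨Ψ, Φ, h, TRP.isCutModel h.smooth_target fun x =>
    (hΦ _).trans (hf.descend_cover x.2)⟩

/-- The homeomorphism for which the cut of `T^*S^n` is diffeomorphic to the quadric. -/
theorem exists_extendsDoubleCover_isCutModel_quadric (n : ℕ) :
    ∃ (Ψ : CutTS n ≃ₜ Q n) (Φ : CutTRP n ≃ₜ CP n), ExtendsDoubleCover Ψ Φ ∧
      IsCutModel (E := TModel n) (F := Fin n → ℂ) {x : TS n | 0 < TS.energy x} TS.energy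
        TS.flow (2 * Real.pi) 1 fun x => Ψ (CutSpace.mk _ _ _ x) := by
  obtain ⟨Ψ, Φ, h, hΨ, -⟩ := (TS.isDiscModel_toQuadric n).exists_extendsDoubleCover
  exact ⟨Ψ, Φ, h, TS.isCutModel h.smooth_source hΨ⟩

end

theorem mainTheorem10 (n : ℕ) :
    IsSymplecticDoubleCover (TRP.cover n) TS.form TRP.form ∧
    IsHamiltonianCircleAction TS.form {x : TS n | 0 < TS.energy x} TS.energy TS.flow
      (2 * Real.pi) 1 ∧
    IsHamiltonianCircleAction TRP.form {x : TRP n | 0 < TRP.energy x} TRP.energy TRP.flow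
      Real.pi 1 ∧
    IsBranchedDoubleCover n (Q.proj n) (quadric n) ∧
    ((∃ _ : ChartedSpace (TModel n) (CutTRP n), IsCutTRP n) ∧
      ∀ [ChartedSpace (TModel n) (CutTRP n)], IsCutTRP n →
        ∃ (Φ : CutTRP n ≃ₘ⟮𝓘(ℝ, TModel n), 𝓘(ℝ, Fin n → ℂ)⟯ CP n) (Ψ : CutTS n ≃ₜ Q n),
          ExtendsDoubleCover Ψ Φ.toHomeomorph) ∧
    ((∃ _ : ChartedSpace (TModel n) (CutTS n), IsCutTS n) ∧
      ∀ [ChartedSpace (TModel n) (CutTS n)], IsCutTS n →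
        ∃ (Ψ : CutTS n ≃ₘ⟮𝓘(ℝ, TModel n), 𝓘(ℝ, Fin n → ℂ)⟯ Q n) (Φ : CutTRP n ≃ₜ CP n),
          ExtendsDoubleCover Ψ.toHomeomorph Φ) := by
  have hS := TS.isHamiltonianCircleAction n
  have hP := TRP.isHamiltonianCircleAction n
  refine ⟨TRP.isSymplecticDoubleCover n, hS, hP, Q.isBranchedDoubleCover n, ?_, ?_⟩
  · obtain ⟨Ψ, Φ, h, hm⟩ := exists_extendsDoubleCover_isCutModel_proj n
    refine ⟨hm.exists_isSymplecticCut Φ (modelEquiv n), fun hc => ?_⟩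
    -- For every smooth structure of the cut the same homeomorphism underlies the diffeomorphism, so
    -- its compatibility with the cover carries over.
    obtain ⟨D, rfl⟩ := hm.exists_diffeomorph Φ hc hP.continuous hP.level_subset hP.period_pos
      hP.mapsTo fun y _ t => by
        obtain ⟨x, rfl⟩ := TRP.cover_surjective n y
        exact TS.energy_flow t x
    exact ⟨D, Ψ, h⟩
  · obtain ⟨Ψ, Φ, h, hm⟩ := exists_extendsDoubleCover_isCutModel_quadric n
    refine ⟨hm.exists_isSymplecticCut Ψ (modelEquiv n), fun hc => ?_⟩
    obtain ⟨D, rfl⟩ := hm.exists_diffeomorph Ψ hc hS.continuous hS.level_subset hS.period_pos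
      hS.mapsTo fun x _ t => TS.energy_flow t x
    exact ⟨D, Φ, h⟩
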